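/- Let $H$ be a separable complex Hilbert space of dimension at least $2$ (possibly infinite) with orthonormal basis $\{e_i\}_{i\in\Theta}$, let $\mathcal F(H)=\bigoplus_{n\ge 0}H^{\otimes n}$ be the full Fock space, $l_i=l_{e_i}$ the left creation operators, and $(\omega_i)_{i\in\Theta}$ positive reals with $\sum_i\omega_i=1$. On $B(\mathcal F(H))$ let $P_\omega(x)=\sum_{i\in\Theta}\omega_i\,l_i^*xl_i$. For $|\lambda|=1$ let $E_\lambda=\{x: P_\omega(x)=\lambda x\}$. Let $F(P_\omega)=E_1$ (the Poisson boundary) and let $P(P_\omega)$ (the peripheral Poisson boundary) be the norm closed linear span of $\bigcup_{|\lambda|=1}E_\lambda$. There is exactly one bounded bilinear product $\circ$ on $P(P_\omega)$ such that $$x\circ y=\mathrm{SOT}\text{-}\lim_{n\to\infty}(\lambda\mu)^{-n}P_\omega^n(xy)\qquad (x\in E_\lambda,\ y\in E_\mu,\ |\lambda|=|\mu|=1).$$ With this product, the operator adjoint, the operator norm and the unit $1$, $P(P_\omega)$ is a unital C*-algebra and $F(P_\omega)$ is a unital C*-subalgebra of it. There is a conditional expectation $E:P(P_\omega)\to F(P_\omega)$,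 that is, a completely positive contractive linear map with $E(a)=a$ and $E(a\circ x\circ b)=a\circ E(x)\circ b$ for $a,b\in F(P_\omega)$, $x\in P(P_\omega)$. For every such $E$, the left and right actions $a\cdot x=a\circ x$ and $x\cdot a=x\circ a$ ($a\in F(P_\omega)$, $x\in P(P_\omega)$) and the $F(P_\omega)$-valued inner product $$\langle x,y\rangle=E(x\circ y^*)$$ make $P(P_\omega)$ a pre-Hilbert C*-bimodule over $(F(P_\omega),\circ)$. This means: $P(P_\omega)$ is a unital $F(P_\omega)$-bimodule with complex bilinear, commuting actions; $\langle\cdot,\cdot\rangle$ is complex linear in the first variable, $\langle a\cdot x,y\rangle=a\circ\langle x,y\rangle$, $\langle x,y\rangle^*=\langle y,x\rangle$, $\langle x,x\rangle\ge 0$, and $\langle x,x\rangle=0$ only for $x=0$; and the right action is by bounded adjointable operators: $\langle x\cdot a,y\rangle=\langle x,y\cdot a^*\rangle$ and $\langle x\cdot a,x\cdot a\rangle\le\|a\|^2\langle x,x\rangle$. (Positivity is meant in the C*-algebra $(F(P_\omega),\circ)$; completeness for $\|\langle x,x\rangle\|^{1/2}$ is not claimed.) -/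

import Mathlib

open Filter Topology
open scoped TensorProduct ComplexConjugate

universe u v

noncomputable section

/-! ### The full Fock space -/

/-- A complex Hilbert space, bundled with its structure. -/
structure HilbertObj : Type (u + 1) where
  carrier : Type u
  [normed : NormedAddCommGroup carrier]
  [inner : InnerProductSpace ℂ carrier]
  [complete : CompleteSpace carrier]

attribute [instance] HilbertObj.normed HilbertObj.inner HilbertObj.complete

/-- The Hilbert space tensor powers: the zeroth one is one-dimensional (a copy of `ℂ` in the
universe of `H`), and the `(n+1)`-st one is the completion of `H ⊗ H^{⊗ n}`. -/
def hilbertTensorPower (H : Type u) [NormedAddCommGroup H] [InnerProductSpace ℂ H] :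
    ℕ → HilbertObj.{u}
  | 0 => ⟨EuclideanSpace ℂ PUnit.{u + 1}⟩
  | n + 1 => ⟨UniformSpace.Completion (H ⊗[ℂ] (hilbertTensorPower H n).carrier)⟩

/-- The full Fock space: the Hilbert space direct sum of all tensor powers of `H`. -/
abbrev FockSpace (H : Type u) [NormedAddCommGroup H] [InnerProductSpace ℂ H] : Type u :=
  lp (fun n => (hilbertTensorPower H n).carrier) 2

/-- The bounded operators on the full Fock space. -/
abbrev FockOperators (H : Type u) [NormedAddCommGroup H] [InnerProductSpace ℂ H] : Type u :=
  FockSpace H →L[ℂ] FockSpace H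

section Creation

variable {H : Type u} [NormedAddCommGroup H] [InnerProductSpace ℂ H]

/-- Left tensoring `η ↦ ξ ⊗ η` from `H^{⊗ n}` to `H^{⊗ (n+1)}`. -/
def tensorLeft (ξ : H) (n : ℕ) (η : (hilbertTensorPower H n).carrier) :
    (hilbertTensorPower H (n + 1)).carrier :=
  ((ξ ⊗ₜ[ℂ] η : H ⊗[ℂ] (hilbertTensorPower H n).carrier) :
    UniformSpace.Completion (H ⊗[ℂ] (hilbertTensorPower H n).carrier))

theorem norm_tensorLeft (ξ : H) (n : ℕ) (η : (hilbertTensorPower H n).carrier) :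
    ‖tensorLeft ξ n η‖ = ‖ξ‖ * ‖η‖ :=
  (UniformSpace.Completion.norm_coe _).trans (TensorProduct.norm_tmul ξ η)

theorem tensorLeft_add (ξ : H) (n : ℕ) (η ζ : (hilbertTensorPower H n).carrier) :
    tensorLeft ξ n (η + ζ) = tensorLeft ξ n η + tensorLeft ξ n ζ := by
  have h : (ξ ⊗ₜ[ℂ] (η + ζ) : H ⊗[ℂ] (hilbertTensorPower H n).carrier)
      = ξ ⊗ₜ[ℂ] η + ξ ⊗ₜ[ℂ] ζ := TensorProduct.tmul_add ξ η ζ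
  exact (congrArg _ h).trans (UniformSpace.Completion.coe_add _ _)

theorem tensorLeft_smul (ξ : H) (n : ℕ) (c : ℂ) (η : (hilbertTensorPower H n).carrier) :
    tensorLeft ξ n (c • η) = c • tensorLeft ξ n η := by
  have h : (ξ ⊗ₜ[ℂ] (c • η) : H ⊗[ℂ] (hilbertTensorPower H n).carrier)
      = c • ξ ⊗ₜ[ℂ] η := TensorProduct.tmul_smul c ξ η
  exact (congrArg _ h).trans (UniformSpace.Completion.coe_smul _ _)

/-- The components of `ξ ⊗ η` for `η` in the full Fock space. -/
def creationFun (ξ : H) (η : ∀ n, (hilbertTensorPower H n).carrier) :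
    ∀ n, (hilbertTensorPower H n).carrier
  | 0 => 0
  | n + 1 => tensorLeft ξ n (η n)

theorem hasSum_creationFun (ξ : H) (η : FockSpace H) :
    HasSum (fun n => ‖creationFun ξ η n‖ ^ (2 : ENNReal).toReal) ((‖ξ‖ * ‖η‖) ^ 2) := by
  have h := (lp.hasSum_norm (p := 2) (by norm_num) η).mul_left (‖ξ‖ ^ 2)
  rw [← hasSum_nat_add_iff' 1]
  simp only [Finset.range_one, Finset.sum_singleton, creationFun, norm_tensorLeft, norm_zero]
  norm_num [mul_pow] at h ⊢
  exact h

/-- The left creation operator `l_ξ`. -/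
def leftCreation (ξ : H) : FockOperators H :=
  LinearMap.mkContinuous
    { toFun := fun η => ⟨creationFun ξ η, memℓp_gen (hasSum_creationFun ξ η).summable⟩
      map_add' := fun η ζ => by
        ext n
        cases n with
        | zero => exact (add_zero _).symm
        | succ n => exact tensorLeft_add ξ n _ _
      map_smul' := fun c η => by
        ext n
        cases n with
        | zero => exact (smul_zero c).symm
        | succ n => exact tensorLeft_smul ξ n c _ }
    ‖ξ‖ (fun η => by
      refine lp.norm_le_of_tsum_le (p := 2) (by norm_num) (by positivity) ?_
      refine (hasSum_creationFun ξ η).tsum_eq.le.trans ?_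
      norm_num)

theorem norm_leftCreation_apply (ξ : H) (η : FockSpace H) :
    ‖leftCreation ξ η‖ = ‖ξ‖ * ‖η‖ := by
  have h₁ := lp.hasSum_norm (p := 2) (by norm_num) (leftCreation ξ η)
  have h₂ := h₁.unique (hasSum_creationFun ξ η)
  norm_num at h₂
  exact (pow_left_inj₀ (norm_nonneg _) (by positivity) two_ne_zero).1 h₂

theorem norm_leftCreation_le (ξ : H) : ‖leftCreation ξ‖ ≤ ‖ξ‖ :=
  ContinuousLinearMap.opNorm_le_bound _ (norm_nonneg _)
    fun η => (norm_leftCreation_apply ξ η).le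

theorem star_leftCreation_mul_self (ξ : H) (hξ : ‖ξ‖ = 1) :
    star (leftCreation ξ) * leftCreation ξ = 1 :=
  (ContinuousLinearMap.norm_map_iff_adjoint_comp_self _).1
    fun η => by rw [norm_leftCreation_apply, hξ, one_mul]

end Creation

/-! ### The completely positive map `P_ω` -/

/-- A family of positive real numbers with sum `1`. -/
structure PositiveWeights (Θ : Type v) where
  val : Θ → ℝ
  pos : ∀ i, 0 < val i
  hasSum_one : HasSum val 1

section POmega

variable {Θ : Type v} {H : Type u} [NormedAddCommGroup H] [InnerProductSpace ℂ H]

theorem norm_POmega_term_le (b : HilbertBasis Θ ℂ H) (ω : PositiveWeights Θ)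
    (x : FockOperators H) (i : Θ) :
    ‖(ω.val i : ℂ) • (star (leftCreation (b i)) * x * leftCreation (b i))‖ ≤ ω.val i * ‖x‖ := by
  have hl : ‖leftCreation (b i)‖ ≤ 1 :=
    (norm_leftCreation_le _).trans (b.orthonormal.1 i).le
  have hs : ‖star (leftCreation (b i))‖ ≤ 1 := by
    rw [ContinuousLinearMap.star_eq_adjoint, LinearIsometryEquiv.norm_map]
    exact hl
  rw [norm_smul, Complex.norm_real, Real.norm_of_nonneg (ω.pos i).le]
  refine mul_le_mul_of_nonneg_left ?_ (ω.pos i).le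
  calc ‖star (leftCreation (b i)) * x * leftCreation (b i)‖
      ≤ ‖star (leftCreation (b i))‖ * ‖x‖ * ‖leftCreation (b i)‖ :=
        (norm_mul_le _ _).trans (mul_le_mul_of_nonneg_right (norm_mul_le _ _) (norm_nonneg _))
    _ ≤ 1 * ‖x‖ * 1 := by gcongr
    _ = ‖x‖ := by ring

theorem summable_POmega (b : HilbertBasis Θ ℂ H) (ω : PositiveWeights Θ) (x : FockOperators H) :
    Summable fun i =>
      (ω.val i : ℂ) • (star (leftCreation (b i)) * x * leftCreation (b i)) :=
  Summable.of_norm_bounded (ω.hasSum_one.summable.mul_right ‖x‖) (norm_POmega_term_le b ω x)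

/-- The map `P_ω(x) = ∑ᵢ ωᵢ lᵢ* x lᵢ` on the bounded operators of the full Fock space, where
`lᵢ` is the left creation operator of the `i`-th basis vector. The series converges in norm. -/
def POmega (b : HilbertBasis Θ ℂ H) (ω : PositiveWeights Θ) :
    FockOperators H →L[ℂ] FockOperators H :=
  LinearMap.mkContinuous
    { toFun := fun x =>
        ∑' i, (ω.val i : ℂ) • (star (leftCreation (b i)) * x * leftCreation (b i))
      map_add' := fun x y => by
        rw [← (summable_POmega b ω x).tsum_add (summable_POmega b ω y)]
        simp only [mul_add, add_mul, smul_add]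
      map_smul' := fun c x => by
        rw [RingHom.id_apply, ← (summable_POmega b ω x).tsum_const_smul c]
        simp only [mul_smul_comm, smul_mul_assoc, smul_comm c] }
    1 (fun x => tsum_of_norm_bounded (ω.hasSum_one.mul_right ‖x‖) (norm_POmega_term_le b ω x))

theorem POmega_apply (b : HilbertBasis Θ ℂ H) (ω : PositiveWeights Θ) (x : FockOperators H) :
    POmega b ω x =
      ∑' i, (ω.val i : ℂ) • (star (leftCreation (b i)) * x * leftCreation (b i)) := rfl

theorem POmega_star (b : HilbertBasis Θ ℂ H) (ω : PositiveWeights Θ) (x : FockOperators H) :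
    POmega b ω (star x) = star (POmega b ω x) := by
  rw [POmega_apply, POmega_apply, tsum_star]
  refine tsum_congr fun i => ?_
  rw [star_smul, star_mul, star_mul, star_star, mul_assoc]
  congr 1
  exact (Complex.conj_ofReal _).symm

theorem POmega_one (b : HilbertBasis Θ ℂ H) (ω : PositiveWeights Θ) : POmega b ω 1 = 1 := by
  rw [POmega_apply]
  have h : ∀ i, (ω.val i : ℂ) • (star (leftCreation (b i)) * 1 * leftCreation (b i))
      = (ω.val i : ℂ) • (1 : FockOperators H) := fun i => by
    rw [mul_one, star_leftCreation_mul_self _ (b.orthonormal.1 i)]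
  simp only [h]
  have := (Complex.hasSum_ofReal.2 ω.hasSum_one).smul_const (1 : FockOperators H)
  simpa using this.tsum_eq

end POmega

/-! ### Poisson boundary and peripheral Poisson boundary -/

section Boundary

variable {B : Type u} [NormedAddCommGroup B] [NormedSpace ℂ B]

/-- The eigenspace `E_λ(τ) = {x | τ x = λ x}`. -/
def eigenSubspace (τ : B →L[ℂ] B) (c : ℂ) : Submodule ℂ B where
  carrier := {x | τ x = c • x}
  add_mem' := fun {x y} hx hy => by
    rw [Set.mem_ofPred_eq] at *; rw [map_add, hx, hy, smul_add]
  zero_mem' := by simp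
  smul_mem' := fun d x hx => by
    rw [Set.mem_ofPred_eq] at *; rw [map_smul, hx, smul_comm]

/-- The peripheral Poisson boundary `P(τ)` as a norm closed subspace: the closed linear span of
the eigenvectors of `τ` for eigenvalues on the unit circle. -/
def peripheralBoundary (τ : B →L[ℂ] B) : Submodule ℂ B :=
  (Submodule.span ℂ {x | ∃ c : ℂ, ‖c‖ = 1 ∧ x ∈ eigenSubspace τ c}).topologicalClosure

/-- The Poisson boundary `F(τ) = {x | τ x = x}`, as a subspace of `P(τ)`, in which it is contained
by `mem_peripheralBoundary_of_fixed`. -/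
def poissonBoundary (τ : B →L[ℂ] B) : Submodule ℂ (peripheralBoundary τ) where
  carrier := {x | τ (x : B) = x}
  add_mem' := fun {x y} hx hy => by
    rw [Set.mem_ofPred_eq] at *; rw [Submodule.coe_add, map_add, hx, hy]
  zero_mem' := by simp
  smul_mem' := fun d x hx => by
    rw [Set.mem_ofPred_eq] at *; rw [Submodule.coe_smul, map_smul, hx]

theorem mem_peripheralBoundary_of_fixed (τ : B →L[ℂ] B) {x : B} (hx : τ x = x) :
    x ∈ peripheralBoundary τ :=
  Submodule.le_topologicalClosure _
    (Submodule.subset_span ⟨1, norm_one, hx.trans (one_smul ℂ x).symm⟩)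

end Boundary

section PeripheralStar

variable {Θ : Type v} {H : Type u} [NormedAddCommGroup H] [InnerProductSpace ℂ H]

theorem star_mem_peripheralBoundary (b : HilbertBasis Θ ℂ H) (ω : PositiveWeights Θ)
    {x : FockOperators H} (hx : x ∈ peripheralBoundary (POmega b ω)) :
    star x ∈ peripheralBoundary (POmega b ω) := by
  have hspan : ∀ y ∈ Submodule.span ℂ
      {x | ∃ c : ℂ, ‖c‖ = 1 ∧ x ∈ eigenSubspace (POmega b ω) c},
      star y ∈ Submodule.span ℂ
        {x | ∃ c : ℂ, ‖c‖ = 1 ∧ x ∈ eigenSubspace (POmega b ω) c} := by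
    intro y hy
    induction hy using Submodule.span_induction with
    | mem y hy =>
      obtain ⟨c, hc, hy⟩ := hy
      refine Submodule.subset_span ⟨star c, by rwa [norm_star], ?_⟩
      change POmega b ω (star y) = _
      rw [POmega_star, show POmega b ω y = c • y from hy, star_smul]
    | zero => rw [star_zero]; exact Submodule.zero_mem _
    | add y z _ _ hy hz => rw [star_add]; exact Submodule.add_mem _ hy hz
    | smul c y _ hy => rw [star_smul]; exact Submodule.smul_mem _ _ hy
  exact map_mem_closure continuous_star hx hspan

theorem one_mem_peripheralBoundary (b : HilbertBasis Θ ℂ H) (ω : PositiveWeights Θ) :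
    (1 : FockOperators H) ∈ peripheralBoundary (POmega b ω) :=
  mem_peripheralBoundary_of_fixed _ (POmega_one b ω)

/-- `m` is the product `∘` of `P(P_ω)`: the bounded bilinear operation which on peripheral
eigenvectors `x ∈ E_c`, `y ∈ E_d` is `x ∘ y = SOT-lim (c d)⁻ⁿ P_ωⁿ(x y)`. -/
def IsPeripheralProduct (b : HilbertBasis Θ ℂ H) (ω : PositiveWeights Θ)
    (m : peripheralBoundary (POmega b ω) →L[ℂ] peripheralBoundary (POmega b ω) →L[ℂ]
      peripheralBoundary (POmega b ω)) : Prop :=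
  ∀ (c d : ℂ), ‖c‖ = 1 → ‖d‖ = 1 → ∀ x y : peripheralBoundary (POmega b ω),
    (x : FockOperators H) ∈ eigenSubspace (POmega b ω) c →
    (y : FockOperators H) ∈ eigenSubspace (POmega b ω) d →
    ∀ η : FockSpace H,
      Tendsto (fun n : ℕ => (((c * d) ^ n)⁻¹ •
          (POmega b ω)^[n] ((x : FockOperators H) * (y : FockOperators H))) η)
        atTop (𝓝 ((m x y : FockOperators H) η))

end PeripheralStar

/-! ### C⋆-algebras with a given product, conditional expectations, bimodules -/

/-- A product, an involution and a unit on `X` (data only). -/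
structure StarProduct (X : Type u) where
  mul : X → X → X
  adj : X → X
  unit : X

namespace StarProduct

section

variable {X : Type u} [NormedAddCommGroup X] [NormedSpace ℂ X]

/-- The normed space `X` is a unital C⋆-algebra for the given product, involution and unit. -/
structure IsUnitalCStarAlgebra (S : StarProduct X) : Prop where
  complete : CompleteSpace X
  add_mul : ∀ x y z, S.mul (x + y) z = S.mul x z + S.mul y z
  mul_add : ∀ x y z, S.mul x (y + z) = S.mul x y + S.mul x z
  smul_mul : ∀ (c : ℂ) x y, S.mul (c • x) y = c • S.mul x y
  mul_smul : ∀ (c : ℂ) x y, S.mul x (c • y) = c • S.mul x y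
  mul_assoc : ∀ x y z, S.mul (S.mul x y) z = S.mul x (S.mul y z)
  unit_mul : ∀ x, S.mul S.unit x = x
  mul_unit : ∀ x, S.mul x S.unit = x
  adj_add : ∀ x y, S.adj (x + y) = S.adj x + S.adj y
  adj_smul : ∀ (c : ℂ) x, S.adj (c • x) = conj c • S.adj x
  adj_adj : ∀ x, S.adj (S.adj x) = x
  adj_mul : ∀ x y, S.adj (S.mul x y) = S.mul (S.adj y) (S.adj x)
  norm_mul_le : ∀ x y, ‖S.mul x y‖ ≤ ‖x‖ * ‖y‖
  norm_adj_mul_self : ∀ x, ‖S.mul (S.adj x) x‖ = ‖x‖ * ‖x‖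

/-- `F` is a unital C⋆-subalgebra. -/
structure IsCStarSubalgebra (S : StarProduct X) (F : Submodule ℂ X) : Prop where
  isClosed : IsClosed (F : Set X)
  mul_mem : ∀ {x y}, x ∈ F → y ∈ F → S.mul x y ∈ F
  adj_mem : ∀ {x}, x ∈ F → S.adj x ∈ F
  unit_mem : S.unit ∈ F

/-- The product, involution and unit of a C⋆-subalgebra. -/
def restrict (S : StarProduct X) (F : Submodule ℂ X) (hF : S.IsCStarSubalgebra F) :
    StarProduct F where
  mul x y := ⟨S.mul x y, hF.mul_mem x.2 y.2⟩
  adj x := ⟨S.adj x, hF.adj_mem x.2⟩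
  unit := ⟨S.unit, hF.unit_mem⟩

/-- Positivity in a C⋆-algebra. -/
def IsPositive (S : StarProduct X) (a : X) : Prop :=
  ∃ c, a = S.mul (S.adj c) c

/-- Positivity in the C⋆-algebra of `n × n` matrices: `a = c* c` for some matrix `c`. -/
def IsPositiveMatrix (S : StarProduct X) {n : ℕ} (a : Fin n → Fin n → X) : Prop :=
  ∃ c : Fin n → Fin n → X, ∀ i j, a i j = ∑ k, S.mul (S.adj (c k i)) (c k j)

/-- `E` is a conditional expectation of the C⋆-algebra `X` onto its C⋆-subalgebra `F`:
a completely positive contraction onto `F` which fixes `F` and is an `F`-bimodule map. -/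
structure IsConditionalExpectation (S : StarProduct X) (F : Submodule ℂ X)
    (hF : S.IsCStarSubalgebra F) (E : X →ₗ[ℂ] F) : Prop where
  map_coe : ∀ a : F, E a = a
  norm_le : ∀ x, ‖E x‖ ≤ ‖x‖
  completelyPositive : ∀ (n : ℕ) (a : Fin n → Fin n → X), S.IsPositiveMatrix a →
    (S.restrict F hF).IsPositiveMatrix fun i j => E (a i j)
  map_bimodule : ∀ (a c : F) (x : X),
    E (S.mul (S.mul a x) c) = (S.restrict F hF).mul ((S.restrict F hF).mul a (E x)) c

end

end StarProduct

/-- `X`, with the left action `l`, the right action `r` and the `A`-valued inner product `ip`, is a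
pre-Hilbert C⋆-bimodule over the unital C⋆-algebra `A` (the product, involution and unit of `A` are
those of `S`). The inner product is linear in the first variable, compatible with the left action,
and the right action is by bounded adjointable operators. Completeness of `X` for the norm
`‖ip x x‖ ^ (1/2)` is not asked for. -/
structure IsPreHilbertCStarBimodule {A : Type u} {X : Type v} [NormedAddCommGroup A]
    [NormedSpace ℂ A] [AddCommGroup X] [Module ℂ X] (S : StarProduct A)
    (l : A → X → X) (r : X → A → X) (ip : X → X → A) : Prop where
  isUnitalCStarAlgebra : S.IsUnitalCStarAlgebra
  -- left module
  left_add : ∀ a x y, l a (x + y) = l a x + l a y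
  add_left : ∀ a c x, l (a + c) x = l a x + l c x
  left_smul : ∀ (z : ℂ) a x, l a (z • x) = z • l a x
  smul_left : ∀ (z : ℂ) a x, l (z • a) x = z • l a x
  mul_left : ∀ a c x, l (S.mul a c) x = l a (l c x)
  unit_left : ∀ x, l S.unit x = x
  -- right module
  add_right : ∀ x y a, r (x + y) a = r x a + r y a
  right_add : ∀ x a c, r x (a + c) = r x a + r x c
  smul_right : ∀ (z : ℂ) x a, r (z • x) a = z • r x a
  right_smul : ∀ (z : ℂ) x a, r x (z • a) = z • r x a
  right_mul : ∀ x a c, r x (S.mul a c) = r (r x a) c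
  right_unit : ∀ x, r x S.unit = x
  -- the actions commute
  left_right : ∀ a x c, r (l a x) c = l a (r x c)
  -- the inner product
  inner_add : ∀ x y z, ip (x + y) z = ip x z + ip y z
  inner_smul : ∀ (c : ℂ) x y, ip (c • x) y = c • ip x y
  inner_left : ∀ a x y, ip (l a x) y = S.mul a (ip x y)
  adj_inner : ∀ x y, S.adj (ip x y) = ip y x
  inner_self_positive : ∀ x, S.IsPositive (ip x x)
  inner_self_eq_zero : ∀ x, ip x x = 0 → x = 0
  -- the right action is by bounded adjointable operators
  inner_right : ∀ x a y, ip (r x a) y = ip x (r y (S.adj a))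
  inner_right_le : ∀ x a, S.IsPositive (((‖a‖ ^ 2 : ℝ) : ℂ) • ip x x - ip (r x a) (r x a))

/-- The involution (the operator adjoint), the unit and the product `m` on `P(P_ω)`. -/
def peripheralStarProduct {Θ : Type v} {H : Type u} [NormedAddCommGroup H] [InnerProductSpace ℂ H]
    (b : HilbertBasis Θ ℂ H) (ω : PositiveWeights Θ)
    (m : peripheralBoundary (POmega b ω) →L[ℂ] peripheralBoundary (POmega b ω) →L[ℂ]
      peripheralBoundary (POmega b ω)) : StarProduct (peripheralBoundary (POmega b ω)) where
  mul x y := m x y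
  adj x := ⟨star (x : FockOperators H), star_mem_peripheralBoundary b ω x.2⟩
  unit := ⟨1, one_mem_peripheralBoundary b ω⟩

end

/-! ### C⋆-algebras given by a product on a normed space -/

/-! The map `POmega` is an infinite convex combination of compressions `x ↦ lᵢ* x lᵢ` by isometries.
Hence it is unital, contractive, normal and satisfies a Schwarz inequality for pairs of operators
(`IsConvexCompression.isSchwarzMap`). Everything except the last clause of the theorem holds for any
such map `τ`.

Existence of `x ∘ y`: for peripheral eigenvectors the defect `τᵏ(xy) - τᵏ(x)τᵏ(y)` is an
off-diagonal corner of a positive operator matrix. One diagonal corner is `τᵏ(y*y) - y*y`, an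
increment of a bounded increasing sequence. So the scaled sequence is strongly Cauchy
(`norm_pow_defect_apply_sq_le`, `exists_tendsto_product`). To pass from eigenvectors to their closed
span, take an ultrafilter `l` on `ℕ` along which `cⁿ → 1` for all unimodular `c` at once. Then `x ∘
y` is the weak limit of `τⁿ(xy)` along `l`, with no reference to eigenvalues, and is therefore
bilinear and contractive. Along `l` also `τⁿ x → x` in norm, so the Schwarz inequality gives `x*x ≤
x* ∘ x` and thus the C⋆-identity. Associativity compares two defects of `τᵏ(xyz)`, each small by the
same estimate (`norm_inner_associator_le`).

Conditional expectation: the Cesàro means of `τ` on the peripheral boundary converge in norm to an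
expectation `E₀`, because powers of `τ` act there as isometric ⋆-homomorphisms for `∘`. Orbits are
totally bounded, so a positive element returns near itself within bounded gaps and its mean cannot
vanish. Hence `E₀` is faithful (`eq_zero_of_ergodicMean_eq_zero`), which makes the inner product
definite.

An arbitrary expectation `E`: it must equal `E₀`. The vectors `e_{i₁} ⊗ ⋯ ⊗ e_{iₙ}` form a basis
labelled by words. The operators `r j` appending a letter are fixed by `τ`, and the gauge unitary
`U`, acting by `c ^ length`, lies in `E_c`. Since `U ∘ r j = c (r j ∘ U)`, the bimodule property
gives the same relation for `E U`. In terms of matrix entries this relation rotates words and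
multiplies by weights less than `1`, which forces `E U = 0` when `c ≠ 1` (`eq_zero_of_rotate`,
`eq_zero_of_twisted`). As `E_c = F ∘ U`, every expectation kills `E_c` (`condExp_eigen`) and agrees
with `E₀` on a total set. -/

theorem CStarAlgebra.nonneg_iff_exists_star_mul_self {A : Type*} [NonUnitalCStarAlgebra A]
    [PartialOrder A] [StarOrderedRing A] {a : A} : 0 ≤ a ↔ ∃ c, a = star c * c :=
  CStarAlgebra.nonneg_iff_eq_star_mul_self

/-- Compressing `x` by its negative part gives `x⁻ x x⁻ = -(x⁻)³`. Its image is both nonnegative and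
nonpositive, so injectivity yields `(x⁻)³ = 0` and then `x⁻ = 0`. This is needed because positivity
in a C⋆-subalgebra asks for a square root inside the subalgebra. -/
theorem NonUnitalStarAlgHom.nonneg_of_map_nonneg {A B : Type*} [NonUnitalCStarAlgebra A]
    [PartialOrder A] [StarOrderedRing A] [NonUnitalCStarAlgebra B] [PartialOrder B]
    [StarOrderedRing B] (φ : A →⋆ₙₐ[ℂ] B) (hφ : Function.Injective φ) {x : A}
    (h : 0 ≤ φ x) : 0 ≤ x := by
  have hx : IsSelfAdjoint x := by
    apply hφ
    rw [map_star]
    exact (IsSelfAdjoint.of_nonneg h).star_eq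
  have hn : IsSelfAdjoint x⁻ := IsSelfAdjoint.of_nonneg (CFC.negPart_nonneg x)
  have key : star x⁻ * x * x⁻ = -(star x⁻ * x⁻ * x⁻) := by
    calc star x⁻ * x * x⁻ = star x⁻ * (x⁺ - x⁻) * x⁻ := by rw [CFC.posPart_sub_negPart x hx]
      _ = -(star x⁻ * x⁻ * x⁻) := by
        rw [hn.star_eq, mul_sub, sub_mul, CFC.negPart_mul_posPart, zero_mul, zero_sub]
  have h1 : 0 ≤ φ (star x⁻ * x * x⁻) := by
    rw [map_mul, map_mul, map_star]
    exact star_left_conjugate_nonneg h _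
  have h2 : 0 ≤ φ (star x⁻ * x⁻ * x⁻) := by
    have : 0 ≤ star x⁻ * x⁻ * x⁻ := star_left_conjugate_nonneg (CFC.negPart_nonneg x) _
    obtain ⟨c, hc⟩ := CStarAlgebra.nonneg_iff_eq_star_mul_self.1 this
    rw [hc, map_mul, map_star]
    exact star_mul_self_nonneg _
  rw [key, map_neg, Left.nonneg_neg_iff] at h1
  have h3 : star x⁻ * x⁻ * x⁻ = 0 := hφ ((le_antisymm h1 h2).trans (map_zero φ).symm)
  have h4 : star (x⁻ * x⁻) * (x⁻ * x⁻) = 0 := by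
    rw [star_mul, hn.star_eq] at *
    rw [← mul_assoc, h3, zero_mul]
  have h5 : x⁻ = 0 := by
    have := CStarRing.star_mul_self_eq_zero_iff (x⁻ * x⁻) |>.1 h4
    rw [← CStarRing.star_mul_self_eq_zero_iff, hn.star_eq, this]
  rw [CStarAlgebra.nonneg_iff_isSelfAdjoint_and_negPart_eq_zero]
  exact ⟨hx, h5⟩

namespace StarProduct

section

variable {X : Type u} [NormedAddCommGroup X] [NormedSpace ℂ X]

/-- The space `X`, regarded as a C⋆-algebra with the product, involution and unit of `S`. -/
def Carrier (S : StarProduct X) (_ : S.IsUnitalCStarAlgebra) : Type u := X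

noncomputable section

variable {S : StarProduct X} (h : S.IsUnitalCStarAlgebra)

instance : NormedAddCommGroup (S.Carrier h) := inferInstanceAs (NormedAddCommGroup X)

instance : NormedSpace ℂ (S.Carrier h) := inferInstanceAs (NormedSpace ℂ X)

instance : CompleteSpace (S.Carrier h) := h.complete

instance : NormedRing (S.Carrier h) where
  __ := (inferInstance : NormedAddCommGroup (S.Carrier h))
  mul := S.mul
  one := S.unit
  left_distrib := h.mul_add
  right_distrib := h.add_mul
  zero_mul x := by
    have := h.smul_mul 0 0 x
    simp only [zero_smul] at this
    exact this
  mul_zero x := by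
    have := h.mul_smul 0 x 0
    simp only [zero_smul] at this
    exact this
  mul_assoc := h.mul_assoc
  one_mul := h.unit_mul
  mul_one := h.mul_unit
  norm_mul_le := h.norm_mul_le

instance : StarRing (S.Carrier h) where
  star := S.adj
  star_involutive := h.adj_adj
  star_mul := h.adj_mul
  star_add := h.adj_add

instance : CStarRing (S.Carrier h) where
  norm_mul_self_le x := (h.norm_adj_mul_self x).ge

instance : NormedAlgebra ℂ (S.Carrier h) where
  __ := Algebra.ofModule (R := ℂ) (A := S.Carrier h) h.smul_mul h.mul_smul
  norm_smul_le := norm_smul_le (α := ℂ) (β := X)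

instance : StarModule ℂ (S.Carrier h) where
  star_smul := h.adj_smul

instance : CStarAlgebra (S.Carrier h) where

instance : PartialOrder (S.Carrier h) := CStarAlgebra.spectralOrder _

instance : StarOrderedRing (S.Carrier h) := CStarAlgebra.spectralOrderedRing _

/-- With this translation, sums and limits of positive matrices are handled by the order on the
C⋆-algebra of matrices; neither is visible from the factorisation `c* c`. -/
theorem isPositiveMatrix_iff {n : ℕ} (a : Fin n → Fin n → X) :
    S.IsPositiveMatrix a ↔
      0 ≤ (CStarMatrix.ofMatrix (fun i j => a i j) : CStarMatrix (Fin n) (Fin n) (S.Carrier h)) := by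
  rw [CStarAlgebra.nonneg_iff_exists_star_mul_self]
  constructor
  · rintro ⟨c, hc⟩
    refine ⟨CStarMatrix.ofMatrix (fun i j => c i j), CStarMatrix.ext fun i j => ?_⟩
    rw [CStarMatrix.mul_apply]
    exact hc i j
  · rintro ⟨c, hc⟩
    refine ⟨fun i j => c i j, fun i j => ?_⟩
    have := congrArg (fun M : CStarMatrix (Fin n) (Fin n) (S.Carrier h) => M i j) hc
    simp only [CStarMatrix.mul_apply] at this
    exact this

include h in
theorem IsPositiveMatrix.add {n : ℕ} {a c : Fin n → Fin n → X} (ha : S.IsPositiveMatrix a)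
    (hc : S.IsPositiveMatrix c) : S.IsPositiveMatrix fun i j => a i j + c i j := by
  rw [isPositiveMatrix_iff h] at *
  exact add_nonneg ha hc

include h in
theorem IsPositiveMatrix.smul {n : ℕ} {a : Fin n → Fin n → X} (ha : S.IsPositiveMatrix a)
    {t : ℝ} (ht : 0 ≤ t) : S.IsPositiveMatrix fun i j => (t : ℂ) • a i j := by
  obtain ⟨c, hc⟩ := ha
  refine ⟨fun i j => ((√t : ℝ) : ℂ) • c i j, fun i j => ?_⟩
  simp only [h.adj_smul, h.smul_mul, h.mul_smul, hc, Finset.smul_sum, smul_smul,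
    Complex.conj_ofReal]
  norm_cast
  rw [Real.mul_self_sqrt ht]

include h in
theorem IsPositiveMatrix.zero {n : ℕ} : S.IsPositiveMatrix fun (_ _ : Fin n) => (0 : X) := by
  rw [isPositiveMatrix_iff h]
  exact le_rfl

include h in
theorem IsPositiveMatrix.of_tendsto {n : ℕ} {a : ℕ → Fin n → Fin n → X} {c : Fin n → Fin n → X}
    (ha : ∀ k, S.IsPositiveMatrix (a k))
    (hc : ∀ i j, Tendsto (fun k => a k i j) atTop (𝓝 (c i j))) : S.IsPositiveMatrix c := by
  simp only [isPositiveMatrix_iff h] at *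
  have hcl := CStarAlgebra.isClosed_nonneg (A := CStarMatrix (Fin n) (Fin n) (S.Carrier h))
  -- The topology of `CStarMatrix` is that of entrywise convergence.
  have ht : Tendsto (fun k => (CStarMatrix.ofMatrix (fun i j => a k i j) :
      CStarMatrix (Fin n) (Fin n) (S.Carrier h))) atTop
      (𝓝 (CStarMatrix.ofMatrix fun i j => c i j)) :=
    tendsto_pi_nhds.2 fun i => tendsto_pi_nhds.2 fun j => hc i j
  exact Set.mem_ofPred.1 (hcl.mem_of_tendsto ht (Eventually.of_forall fun k => Set.mem_ofPred.2 (ha k)))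

include h in
theorem exists_norm_sq_sub_mul_adj (a : X) :
    ∃ c, ((‖a‖ ^ 2 : ℝ) : ℂ) • S.unit - S.mul a (S.adj a) = S.mul (S.adj c) c := by
  have h1 := sub_nonneg.2 (CStarAlgebra.mul_star_le_algebraMap_norm_sq (A := S.Carrier h) (a := a))
  obtain ⟨c, hc⟩ := CStarAlgebra.nonneg_iff_eq_star_mul_self.1 h1
  refine ⟨c, ?_⟩
  rw [IsScalarTower.algebraMap_apply ℝ ℂ, Algebra.algebraMap_eq_smul_one] at hc
  exact hc

variable {F : Submodule ℂ X} (hF : S.IsCStarSubalgebra F)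

include h in
theorem IsUnitalCStarAlgebra.restrict : (S.restrict F hF).IsUnitalCStarAlgebra where
  complete := by
    have := h.complete
    exact hF.isClosed.completeSpace_coe
  add_mul x y z := Subtype.ext (h.add_mul _ _ _)
  mul_add x y z := Subtype.ext (h.mul_add _ _ _)
  smul_mul c x y := Subtype.ext (h.smul_mul _ _ _)
  mul_smul c x y := Subtype.ext (h.mul_smul _ _ _)
  mul_assoc x y z := Subtype.ext (h.mul_assoc _ _ _)
  unit_mul x := Subtype.ext (h.unit_mul _)
  mul_unit x := Subtype.ext (h.mul_unit _)
  adj_add x y := Subtype.ext (h.adj_add _ _)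
  adj_smul c x := Subtype.ext (h.adj_smul _ _)
  adj_adj x := Subtype.ext (h.adj_adj _)
  adj_mul x y := Subtype.ext (h.adj_mul _ _)
  norm_mul_le x y := h.norm_mul_le _ _
  norm_adj_mul_self x := h.norm_adj_mul_self _

/-- The inclusion of a C⋆-subalgebra as a homomorphism. -/
def restrictHom : ((S.restrict F hF).Carrier (h.restrict hF)) →⋆ₙₐ[ℂ] S.Carrier h where
  toFun x := (x : F).1
  map_smul' _ _ := rfl
  map_zero' := rfl
  map_add' _ _ := rfl
  map_mul' _ _ := rfl
  map_star' _ := rfl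

include h in
-- The inclusion of the subalgebra induces an injective homomorphism of matrix algebras, and these
-- reflect positivity.
theorem IsPositiveMatrix.restrict {n : ℕ} {a : Fin n → Fin n → F}
    (ha : S.IsPositiveMatrix fun i j => (a i j : X)) :
    (S.restrict F hF).IsPositiveMatrix a := by
  rw [isPositiveMatrix_iff h] at ha
  rw [isPositiveMatrix_iff (h.restrict hF)]
  refine NonUnitalStarAlgHom.nonneg_of_map_nonneg
    (CStarMatrix.mapₙₐ (n := Fin n) (restrictHom h hF)) ?_ ha
  intro M N hMN
  refine CStarMatrix.ext fun i j => Subtype.ext ?_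
  exact congrArg (fun M : CStarMatrix (Fin n) (Fin n) (S.Carrier h) => M i j) hMN

end

end

end StarProduct

/-! ### Normal Schwarz maps on the bounded operators of a Hilbert space -/

section SchwarzMaps

set_option linter.unusedSectionVars false

variable {K : Type u} [NormedAddCommGroup K] [InnerProductSpace ℂ K] [CompleteSpace K]

/-- The operator matrix `[A, B; B*, C]` has a nonnegative quadratic form. -/
def IsPositiveTriple (A B C : K →L[ℂ] K) : Prop :=
  ∀ ξ η : K, 0 ≤ (inner ℂ ξ (A ξ)).re + 2 * (inner ℂ ξ (B η)).re + (inner ℂ η (C η)).re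

/-- Convergence in the weak operator topology. -/
def WeakTendsto (w : ℕ → K →L[ℂ] K) (l : Filter ℕ) (z : K →L[ℂ] K) : Prop :=
  ∀ ξ η : K, Tendsto (fun n => inner ℂ ξ (w n η)) l (𝓝 (inner ℂ ξ (z η)))

/-- A unital normal `2`-positive contraction which satisfies the operator Schwarz inequality for
pairs of operators. -/
structure IsSchwarzMap (τ : (K →L[ℂ] K) →L[ℂ] (K →L[ℂ] K)) : Prop where
  map_one : τ 1 = 1
  map_star : ∀ x, τ (star x) = star (τ x)
  norm_le : ∀ x, ‖τ x‖ ≤ ‖x‖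
  normal : ∀ (l : Filter ℕ) (w : ℕ → K →L[ℂ] K) (z : K →L[ℂ] K) (M : ℝ),
    (∀ n, ‖w n‖ ≤ M) → WeakTendsto w l z → WeakTendsto (fun n => τ (w n)) l (τ z)
  map_triple : ∀ A B C, IsPositiveTriple A B C → IsPositiveTriple (τ A) (τ B) (τ C)
  schwarz : ∀ a b, IsPositiveTriple (τ (star a * a) - star (τ a) * τ a)
    (τ (star a * b) - star (τ a) * τ b) (τ (star b * b) - star (τ b) * τ b)

namespace IsPositiveTriple

variable {A B C : K →L[ℂ] K}

theorem add {A' B' C' : K →L[ℂ] K} (h : IsPositiveTriple A B C) (h' : IsPositiveTriple A' B' C') :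
    IsPositiveTriple (A + A') (B + B') (C + C') := fun ξ η => by
  have h1 := h ξ η
  have h2 := h' ξ η
  simp only [add_apply, inner_add_right, Complex.add_re]
  linarith

theorem re_inner_nonneg_left (h : IsPositiveTriple A B C) (ξ : K) : 0 ≤ (inner ℂ ξ (A ξ)).re := by
  simpa using h ξ 0

/-- The Cauchy–Schwarz inequality for a positive `2 × 2` operator matrix: a small diagonal corner
forces a small off-diagonal corner, as soon as the other diagonal corner is bounded. -/
theorem norm_star_apply_sq_le (h : IsPositiveTriple A B C) {M : ℝ} (hM : 0 < M) (hC : ‖C‖ ≤ M)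
    (ξ : K) : ‖star B ξ‖ ^ 2 ≤ M * (inner ℂ ξ (A ξ)).re := by
  -- Along `η = -t B*ξ` the form is at most `⟨ξ, Aξ⟩ - 2t‖B*ξ‖² + t²M‖B*ξ‖²`, which is smallest at
  -- `t = 1/M`.
  have h1 := h ξ ((-(M⁻¹ : ℝ) : ℂ) • star B ξ)
  have h2 : inner ℂ ξ (B (star B ξ)) = ((‖star B ξ‖ ^ 2 : ℝ) : ℂ) := by
    rw [ContinuousLinearMap.star_eq_adjoint, ← ContinuousLinearMap.adjoint_inner_left,
      inner_self_eq_norm_sq_to_K]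
    norm_cast
  have h3 : (inner ℂ (star B ξ) (C (star B ξ))).re ≤ M * ‖star B ξ‖ ^ 2 := by
    calc (inner ℂ (star B ξ) (C (star B ξ))).re ≤ ‖star B ξ‖ * ‖C (star B ξ)‖ :=
          re_inner_le_norm (𝕜 := ℂ) _ _
      _ ≤ ‖star B ξ‖ * (M * ‖star B ξ‖) := by
          gcongr
          exact C.le_of_opNorm_le hC _
      _ = _ := by ring
  simp only [map_smul, inner_smul_right, inner_smul_left, h2] at h1
  rw [← Complex.ofReal_neg, Complex.conj_ofReal, Complex.re_ofReal_mul, Complex.re_ofReal_mul,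
    Complex.re_ofReal_mul, Complex.ofReal_re] at h1
  have h4 : -M⁻¹ * (-M⁻¹ * (inner ℂ (star B ξ) (C (star B ξ))).re) ≤ M⁻¹ * ‖star B ξ‖ ^ 2 := by
    calc -M⁻¹ * (-M⁻¹ * (inner ℂ (star B ξ) (C (star B ξ))).re)
        = M⁻¹ * M⁻¹ * (inner ℂ (star B ξ) (C (star B ξ))).re := by ring
      _ ≤ M⁻¹ * M⁻¹ * (M * ‖star B ξ‖ ^ 2) := by gcongr
      _ = _ := by field_simp
  have h5 : M⁻¹ * ‖star B ξ‖ ^ 2 ≤ (inner ℂ ξ (A ξ)).re := by linarith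
  rwa [inv_mul_le_iff₀ hM] at h5

theorem swap (h : IsPositiveTriple A B C) : IsPositiveTriple C (star B) A := fun ξ η => by
  have h1 := h η ξ
  have h2 : (inner ℂ ξ (star B η)).re = (inner ℂ η (B ξ)).re := by
    rw [ContinuousLinearMap.star_eq_adjoint, ContinuousLinearMap.adjoint_inner_right,
      ← inner_conj_symm, Complex.conj_re]
  linarith

theorem norm_apply_sq_le (h : IsPositiveTriple A B C) {M : ℝ} (hM : 0 < M) (hA : ‖A‖ ≤ M)
    (η : K) : ‖B η‖ ^ 2 ≤ M * (inner ℂ η (C η)).re := by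
  simpa using h.swap.norm_star_apply_sq_le hM hA η

end IsPositiveTriple

namespace WeakTendsto

variable {w w' : ℕ → K →L[ℂ] K} {l : Filter ℕ} {z z' : K →L[ℂ] K}

theorem unique [l.NeBot] (h : WeakTendsto w l z) (h' : WeakTendsto w l z') : z = z' := by
  ext η
  exact ext_inner_left ℂ fun ξ => tendsto_nhds_unique (h ξ η) (h' ξ η)

theorem of_apply (h : ∀ η, Tendsto (fun n => w n η) l (𝓝 (z η))) : WeakTendsto w l z :=
  fun _ η => tendsto_const_nhds.inner (h η)

theorem of_norm (h : Tendsto w l (𝓝 z)) : WeakTendsto w l z :=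
  of_apply fun η => ((ContinuousLinearMap.apply ℂ K η).continuous.tendsto z).comp h

theorem mono {l' : Filter ℕ} (h : WeakTendsto w l z) (hl : l' ≤ l) : WeakTendsto w l' z :=
  fun ξ η => (h ξ η).mono_left hl

theorem add (h : WeakTendsto w l z) (h' : WeakTendsto w' l z') :
    WeakTendsto (fun n => w n + w' n) l (z + z') := fun ξ η => by
  simpa only [add_apply, inner_add_right] using (h ξ η).add (h' ξ η)

theorem sub (h : WeakTendsto w l z) (h' : WeakTendsto w' l z') :
    WeakTendsto (fun n => w n - w' n) l (z - z') := fun ξ η => by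
  simpa only [sub_apply, inner_sub_right] using (h ξ η).sub (h' ξ η)

theorem smul {c : ℕ → ℂ} {c' : ℂ} (h : WeakTendsto w l z) (hc : Tendsto c l (𝓝 c')) :
    WeakTendsto (fun n => c n • w n) l (c' • z) := fun ξ η => by
  simpa only [smul_apply, inner_smul_right] using hc.mul (h ξ η)

theorem star (h : WeakTendsto w l z) : WeakTendsto (fun n => star (w n)) l (star z) :=
  fun ξ η => by
    simp only [ContinuousLinearMap.star_eq_adjoint, ContinuousLinearMap.adjoint_inner_right]
    simp only [← inner_conj_symm (𝕜 := ℂ) _ η]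
    exact (Complex.continuous_conj.tendsto _).comp (h η ξ)

theorem mul_left (h : WeakTendsto w l z) (a : K →L[ℂ] K) :
    WeakTendsto (fun n => a * w n) l (a * z) := fun ξ η => by
  simpa only [mul_apply_eq_comp, ContinuousLinearMap.adjoint_inner_left] using
    h (ContinuousLinearMap.adjoint a ξ) η

theorem mul_right (h : WeakTendsto w l z) (a : K →L[ℂ] K) :
    WeakTendsto (fun n => w n * a) l (z * a) := fun ξ η => h ξ (a η)

theorem norm_le [l.NeBot] (h : WeakTendsto w l z) {M : ℝ} (hM : 0 ≤ M) (hw : ∀ n, ‖w n‖ ≤ M) :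
    ‖z‖ ≤ M := by
  refine ContinuousLinearMap.opNorm_le_of_re_inner_le (𝕜 := ℂ) hM fun η ξ hη hξ => ?_
  have h1 : Tendsto (fun n => (inner ℂ ξ (w n η)).re) l (𝓝 (inner ℂ ξ (z η)).re) :=
    (Complex.continuous_re.tendsto _).comp (h ξ η)
  rw [← inner_conj_symm, RCLike.conj_re]
  refine le_of_tendsto h1 (Eventually.of_forall fun n => ?_)
  calc (inner ℂ ξ (w n η)).re ≤ ‖ξ‖ * ‖w n η‖ := re_inner_le_norm (𝕜 := ℂ) _ _
    _ ≤ ‖ξ‖ * (M * ‖η‖) := by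
      gcongr
      exact (w n).le_of_opNorm_le (hw n) _
    _ = M := by rw [hη, hξ]; ring

end WeakTendsto

namespace IsSchwarzMap

variable {τ σ : (K →L[ℂ] K) →L[ℂ] (K →L[ℂ] K)}

theorem one : IsSchwarzMap (1 : (K →L[ℂ] K) →L[ℂ] (K →L[ℂ] K)) where
  map_one := rfl
  map_star _ := rfl
  norm_le _ := le_rfl
  normal _ _ _ _ _ h := h
  map_triple _ _ _ h := h
  schwarz a b ξ η := by simp

theorem mul (hτ : IsSchwarzMap τ) (hσ : IsSchwarzMap σ) : IsSchwarzMap (τ * σ) where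
  map_one := by rw [mul_apply_eq_comp, hσ.map_one, hτ.map_one]
  map_star x := by simp only [mul_apply_eq_comp, hσ.map_star, hτ.map_star]
  norm_le x := (hτ.norm_le _).trans (hσ.norm_le x)
  normal l w z M hM h :=
    hτ.normal l _ _ M (fun n => (hσ.norm_le _).trans (hM n)) (hσ.normal l w z M hM h)
  map_triple A B C h := hτ.map_triple _ _ _ (hσ.map_triple _ _ _ h)
  schwarz a b := by
    -- The defect of the composite is `τ` applied to the defect of `σ`, plus the defect of `τ` at `σ
    -- a`, `σ b`; the middle terms cancel.
    have h := (hτ.map_triple _ _ _ (hσ.schwarz a b)).add (hτ.schwarz (σ a) (σ b))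
    simp only [map_sub, sub_add_sub_cancel] at h
    exact h

theorem pow (hτ : IsSchwarzMap τ) (n : ℕ) : IsSchwarzMap (τ ^ n) := by
  induction n with
  | zero => exact one
  | succ n ih => exact (pow_succ' τ n).symm ▸ hτ.mul ih

theorem pow_apply_eigen {c : ℂ} {x : K →L[ℂ] K} (hx : τ x = c • x) (n : ℕ) :
    (τ ^ n) x = c ^ n • x := by
  induction n with
  | zero => simp
  | succ n ih => rw [pow_succ', mul_apply_eq_comp, ih, map_smul, hx, smul_smul, pow_succ]

theorem norm_defect_le (hτ : IsSchwarzMap τ) (a : K →L[ℂ] K) :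
    ‖τ (star a * a) - star (τ a) * τ a‖ ≤ 2 * ‖a‖ ^ 2 := by
  have h1 : ‖τ (star a * a)‖ ≤ ‖a‖ ^ 2 :=
    (hτ.norm_le _).trans (by rw [CStarRing.norm_star_mul_self, sq])
  have h2 : ‖star (τ a) * τ a‖ ≤ ‖a‖ ^ 2 := by
    rw [CStarRing.norm_star_mul_self, ← sq]
    exact pow_le_pow_left₀ (norm_nonneg _) (hτ.norm_le a) 2
  linarith [norm_sub_le (τ (star a * a)) (star (τ a) * τ a)]

theorem re_inner_nonneg (hτ : IsSchwarzMap τ) {A : K →L[ℂ] K}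
    (hA : ∀ ξ, 0 ≤ (inner ℂ ξ (A ξ)).re) (ξ : K) : 0 ≤ (inner ℂ ξ (τ A ξ)).re :=
  (hτ.map_triple A 0 0 fun ξ η => by simpa using hA ξ).re_inner_nonneg_left ξ

theorem norm_apply_sq_le_re_inner (hτ : IsSchwarzMap τ) (a : K →L[ℂ] K) (ξ : K) :
    ‖τ a ξ‖ ^ 2 ≤ (inner ℂ ξ (τ (star a * a) ξ)).re := by
  have h := (hτ.schwarz a a).re_inner_nonneg_left ξ
  rw [sub_apply, inner_sub_right, Complex.sub_re, sub_nonneg,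
    mul_apply_eq_comp, ContinuousLinearMap.star_eq_adjoint,
    ContinuousLinearMap.adjoint_inner_right, inner_self_eq_norm_sq_to_K] at h
  refine le_trans (le_of_eq ?_) h
  norm_cast

/-- The operators `(τⁿ(y* y) ξ, ξ)` increase for a peripheral eigenvector `y`. -/
theorem star_mul_self_of_eigen {d : ℂ} (hd : ‖d‖ = 1) {y : K →L[ℂ] K} (hy : τ y = d • y) (k : ℕ) :
    star ((τ ^ k) y) * (τ ^ k) y = star y * y := by
  rw [pow_apply_eigen hy, star_smul, smul_mul_smul_comm]
  have : star (d ^ k) * d ^ k = 1 := by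
    rw [Complex.star_def, Complex.conj_mul', norm_pow, hd]
    simp
  rw [this, one_smul]

/-- Apply `τⁿ` to the Schwarz triple of `τᵏ` at the pair `x*`, `y`. Since `τᵏ(y)* τᵏ(y) = y*y`, the
lower corner becomes `τⁿ⁺ᵏ(y*y) - τⁿ(y*y)`. The upper corner has norm at most `2‖x‖²`; the added `1`
keeps the constant positive. -/
theorem norm_pow_defect_apply_sq_le (hτ : IsSchwarzMap τ) {d : ℂ} (hd : ‖d‖ = 1)
    (x : K →L[ℂ] K) {y : K →L[ℂ] K} (hy : τ y = d • y) (n k : ℕ) (ξ : K) :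
    ‖(τ ^ n) ((τ ^ k) (x * y) - (τ ^ k) x * (τ ^ k) y) ξ‖ ^ 2 ≤
      (2 * ‖x‖ ^ 2 + 1) * ((inner ℂ ξ ((τ ^ (n + k)) (star y * y) ξ)).re -
        (inner ℂ ξ ((τ ^ n) (star y * y) ξ)).re) := by
  have h := (hτ.pow n).map_triple _ _ _ ((hτ.pow k).schwarz (star x) y)
  have h2 := h.norm_apply_sq_le (M := 2 * ‖x‖ ^ 2 + 1) (by positivity)
    (((hτ.pow n).norm_le _).trans (((hτ.pow k).norm_defect_le _).trans (by simp))) ξ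
  rw [star_mul_self_of_eigen hd hy, (hτ.pow k).map_star, star_star, star_star, map_sub,
    map_sub (τ ^ n) _ (star y * y), sub_apply (_) _ ξ, 
    sub_apply (_) _ ξ, inner_sub_right, Complex.sub_re,
    ← mul_apply_eq_comp (τ ^ n) (τ ^ k) (star y * y), ← pow_add] at h2
  rwa [map_sub, sub_apply]

theorem exists_tendsto_re_inner (hτ : IsSchwarzMap τ) {d : ℂ} (hd : ‖d‖ = 1)
    {y : K →L[ℂ] K} (hy : τ y = d • y) (ξ : K) :
    ∃ r, Tendsto (fun n => (inner ℂ ξ ((τ ^ n) (star y * y) ξ)).re) atTop (𝓝 r) := by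
  refine ⟨_, tendsto_atTop_ciSup (monotone_nat_of_le_succ fun n => ?_)
    ⟨‖ξ‖ * (‖star y * y‖ * ‖ξ‖), ?_⟩⟩
  -- Taking `x = 0` leaves just the statement that the increments are nonnegative.
  · have h := norm_pow_defect_apply_sq_le hτ hd 0 hy n 1 ξ
    have h1 : (0 : ℝ) < 2 * ‖(0 : K →L[ℂ] K)‖ ^ 2 + 1 := by positivity
    exact sub_nonneg.1 (nonneg_of_mul_nonneg_right ((sq_nonneg _).trans h) h1)
  · rintro _ ⟨n, rfl⟩
    refine (re_inner_le_norm (𝕜 := ℂ) _ _).trans ?_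
    gcongr
    exact ContinuousLinearMap.le_of_opNorm_le _ ((hτ.pow n).norm_le _) _

/-- The difference between the terms `n + k` and `n` is, up to a unimodular factor, `τⁿ` of the
`k`-step defect of `x`, `y`. Its norm at a vector is controlled by increments of a convergent real
sequence, so the terms are strongly Cauchy. -/
theorem exists_tendsto_product (hτ : IsSchwarzMap τ) {c d : ℂ} (hc : ‖c‖ = 1) (hd : ‖d‖ = 1)
    {x y : K →L[ℂ] K} (hx : τ x = c • x) (hy : τ y = d • y) :
    ∃ z : K →L[ℂ] K, ∀ η, Tendsto (fun n => (((c * d) ^ n)⁻¹ • (τ ^ n) (x * y)) η) atTop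
      (𝓝 (z η)) := by
  have hcd : ‖c * d‖ = 1 := by rw [norm_mul, hc, hd, one_mul]
  have hcd0 : c * d ≠ 0 := norm_ne_zero_iff.1 (by rw [hcd]; exact one_ne_zero)
  have key : ∀ n k η, (((c * d) ^ (n + k))⁻¹ • (τ ^ (n + k)) (x * y)) η -
      (((c * d) ^ n)⁻¹ • (τ ^ n) (x * y)) η = ((c * d) ^ (n + k))⁻¹ •
        (τ ^ n) ((τ ^ k) (x * y) - (τ ^ k) x * (τ ^ k) y) η := by
    intro n k η
    rw [pow_apply_eigen hx, pow_apply_eigen hy, smul_mul_smul_comm, ← mul_pow, map_sub, map_smul,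
      ← mul_apply_eq_comp (τ ^ n), ← pow_add, sub_apply, smul_sub,
      smul_apply, smul_apply,
      smul_apply, smul_smul, pow_add (c * d) n k, mul_inv, mul_assoc,
      inv_mul_cancel₀ (pow_ne_zero k hcd0), mul_one]
  have hcau : ∀ η, ∃ v, Tendsto (fun n => (((c * d) ^ n)⁻¹ • (τ ^ n) (x * y)) η) atTop (𝓝 v) := by
    intro η
    apply cauchySeq_tendsto_of_complete
    obtain ⟨r, hr⟩ := exists_tendsto_re_inner hτ hd hy η
    have hC := hr.cauchySeq
    rw [Metric.cauchySeq_iff'] at hC ⊢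
    intro ε hε
    have hM : 0 < 2 * ‖x‖ ^ 2 + 1 := by positivity
    obtain ⟨N, hN⟩ := hC (ε ^ 2 / (2 * ‖x‖ ^ 2 + 1)) (by positivity)
    refine ⟨N, fun n hn => ?_⟩
    obtain ⟨k, rfl⟩ := Nat.exists_eq_add_of_le hn
    rw [dist_eq_norm, key, norm_smul, norm_inv, norm_pow, hcd, one_pow, inv_one, one_mul]
    have h1 := norm_pow_defect_apply_sq_le hτ hd x hy N k η
    have h2 := (le_abs_self _).trans_lt (hN (N + k) hn)
    rw [lt_div_iff₀' hM] at h2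
    exact lt_of_pow_lt_pow_left₀ 2 hε.le (h1.trans_lt h2)
  choose f hf using hcau
  exact ⟨continuousLinearMapOfTendsto _ (tendsto_pi_nhds.2 hf), hf⟩

end IsSchwarzMap

end SchwarzMaps

/-! ### Limits of families of bounded operators -/

/-- There is a filter on `ℕ`, finer than `atTop`, along which the powers of all complex numbers
of modulus one converge to `1`. -/
theorem exists_recurrence_filter :
    ∃ l : Filter ℕ, l.NeBot ∧ l ≤ atTop ∧
      ∀ c : ℂ, ‖c‖ = 1 → Tendsto (fun n : ℕ => c ^ n) l (𝓝 1) := by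
  -- The family of all unimodular numbers is a single element of the compact group `Circle →
  -- Circle`, and `1` is a cluster point of the powers of any element of a compact group.
  obtain ⟨U, hU, h⟩ := mapClusterPt_iff_ultrafilter.1
    (mapClusterPt_one_atTop_pow (fun c : Circle => c))
  refine ⟨U, inferInstance, hU, fun c hc => ?_⟩
  have h1 := ((continuous_subtype_val (p := (· ∈ Submonoid.unitSphere ℂ))).tendsto _).comp
    (tendsto_pi_nhds.1 h (⟨c, mem_sphere_zero_iff_norm.2 hc⟩ : Circle))
  exact h1

section Limits

variable {E Z : Type*} [NormedAddCommGroup E] [NormedSpace ℂ E] [NormedAddCommGroup Z]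
  [NormedSpace ℂ Z]

theorem isClosed_setOf_tendsto_zero {l : Filter ℕ} {u : ℕ → E →L[ℂ] Z} {C : ℝ}
    (hu : ∀ n, ‖u n‖ ≤ C) : IsClosed {x | Tendsto (fun n => u n x) l (𝓝 0)} := by
  refine isClosed_of_closure_subset fun x hx => ?_
  rw [Set.mem_ofPred_eq, Metric.tendsto_nhds]
  intro ε hε
  have hC : 0 < |C| + 1 := by positivity
  obtain ⟨y, hy, hxy⟩ := Metric.mem_closure_iff.1 hx (ε / 2 / (|C| + 1)) (by positivity)
  rw [Set.mem_ofPred_eq, Metric.tendsto_nhds] at hy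
  filter_upwards [hy (ε / 2) (by positivity)] with n hn
  rw [dist_zero_right] at hn ⊢
  have h1 : ‖u n (x - y)‖ ≤ (|C| + 1) * ‖x - y‖ :=
    (u n).le_of_opNorm_le ((hu n).trans (by linarith [le_abs_self C])) _
  rw [dist_eq_norm, lt_div_iff₀' hC] at hxy
  calc ‖u n x‖ = ‖u n (x - y) + u n y‖ := by rw [map_sub, sub_add_cancel]
    _ ≤ ‖u n (x - y)‖ + ‖u n y‖ := norm_add_le _ _
    _ < ε := by linarith

/-- On such a relation the first projection is bounded below for the maximum norm, so it has closed
range. A limit operation with a closed contractive graph is thus defined on a closed subspace, and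
it suffices to find limits on a total set. -/
theorem Submodule.isClosed_map_fst_of_norm_le [CompleteSpace E] [CompleteSpace Z] {R : Submodule ℂ (E × Z)}
    (hR : IsClosed (R : Set (E × Z))) (hb : ∀ p ∈ R, ‖p.2‖ ≤ ‖p.1‖) :
    IsClosed ((R.map (LinearMap.fst ℂ E Z) : Submodule ℂ E) : Set E) := by
  have := hR.completeSpace_coe
  let f : R →L[ℂ] E := (ContinuousLinearMap.fst ℂ E Z).comp R.subtypeL
  have hf : AntilipschitzWith 1 f := f.antilipschitz_of_bound fun p => by
    rw [NNReal.coe_one, one_mul]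
    exact max_le le_rfl (hb p p.2)
  have h := hf.isClosed_range f.uniformContinuous
  convert h using 1
  ext x
  simp [f]

/-- The norm bound applied to the difference of two pairs over the same point makes the relation
single valued; linearity and boundedness are inherited from it. -/
theorem Submodule.exists_continuousLinearMap_of_graph {R : Submodule ℂ (E × Z)}
    (hb : ∀ p ∈ R, ‖p.2‖ ≤ ‖p.1‖) :
    ∃ T : (R.map (LinearMap.fst ℂ E Z)) →L[ℂ] Z,
      (∀ x : R.map (LinearMap.fst ℂ E Z), ((x : E), T x) ∈ R) ∧ ∀ x, ‖T x‖ ≤ ‖x‖ := by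
  have hex : ∀ x : R.map (LinearMap.fst ℂ E Z), ∃ z : Z, ((x : E), z) ∈ R := by
    rintro ⟨_, p, hp, rfl⟩
    exact ⟨p.2, hp⟩
  choose f hf using hex
  have huniq : ∀ (x : E) (z z' : Z), (x, z) ∈ R → (x, z') ∈ R → z = z' := by
    intro x z z' h h'
    have h1 := hb _ (R.sub_mem h h')
    simp only [Prod.mk_sub_mk, sub_self, norm_zero, norm_le_zero_iff, sub_eq_zero] at h1
    exact h1
  refine ⟨LinearMap.mkContinuous ⟨⟨f, fun x y => ?_⟩, fun c x => ?_⟩ 1 fun x => ?_, hf, fun x => hb _ (hf x)⟩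
  · exact huniq _ _ _ (hf _) (R.add_mem (hf x) (hf y))
  · exact huniq _ _ _ (hf _) (R.smul_mem c (hf x))
  · rw [one_mul]
    exact hb _ (hf x)

theorem ContinuousLinearMap.exists_comp_bilinear {G : Type*} [NormedAddCommGroup G]
    [NormedSpace ℂ G] {W : Submodule ℂ G} (T : W →L[ℂ] Z) (β : E →L[ℂ] E →L[ℂ] G)
    (hβ : ∀ x y, β x y ∈ W) : ∃ m : E →L[ℂ] E →L[ℂ] Z, ∀ x y, m x y = T ⟨β x y, hβ x y⟩ := by
  let m₀ : E →ₗ[ℂ] E →ₗ[ℂ] Z := LinearMap.mk₂ ℂ (fun x y => T ⟨β x y, hβ x y⟩)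
      (fun x x' y => by
        rw [← map_add]
        exact congrArg T (Subtype.ext (by simp)))
      (fun c x y => by
        rw [← map_smul]
        exact congrArg T (Subtype.ext (by simp)))
      (fun x y y' => by
        rw [← map_add]
        exact congrArg T (Subtype.ext (by simp)))
      (fun c x y => by
        rw [← map_smul]
        exact congrArg T (Subtype.ext (by simp)))
  refine ⟨m₀.mkContinuous₂ (‖T‖ * ‖β‖) fun x y => ?_, fun x y => rfl⟩
  refine (T.le_opNorm _).trans ?_
  rw [mul_assoc, mul_assoc]
  gcongr
  rw [← mul_assoc]
  exact β.le_opNorm₂ x y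

end Limits

/-! ### The product on the peripheral Poisson boundary -/

section PeripheralInduction

variable {B : Type u} [NormedAddCommGroup B] [NormedSpace ℂ B] {τ : B →L[ℂ] B}

theorem isClosed_peripheralBoundary : IsClosed (peripheralBoundary τ : Set B) :=
  Submodule.isClosed_topologicalClosure _

theorem eigen_mem_peripheralBoundary {c : ℂ} (hc : ‖c‖ = 1) {x : B} (hx : τ x = c • x) :
    x ∈ peripheralBoundary τ :=
  Submodule.le_topologicalClosure _ (Submodule.subset_span ⟨c, hc, hx⟩)

/-- A closed subspace containing all peripheral eigenvectors is everything. The zero vector needs no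
separate case, being an eigenvector for the eigenvalue `1`. -/
theorem peripheralBoundary_induction {p : peripheralBoundary τ → Prop}
    (hcl : IsClosed {x | p x})
    (eigen : ∀ (c : ℂ) (x : peripheralBoundary τ), ‖c‖ = 1 → τ x = c • (x : B) → p x)
    (add : ∀ x y, p x → p y → p (x + y)) (smul : ∀ (c : ℂ) x, p x → p (c • x))
    (x : peripheralBoundary τ) : p x := by
  let N : Submodule ℂ (peripheralBoundary τ) :=
    { carrier := {x | p x}
      add_mem' := fun {x y} => add x y
      zero_mem' := eigen 1 0 norm_one (by simp)
      smul_mem' := smul }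
  have hN : IsClosed ((N.map (peripheralBoundary τ).subtype : Submodule ℂ B) : Set B) :=
    (isClosed_peripheralBoundary.isClosedEmbedding_subtypeVal).isClosedMap _ hcl
  have hle : peripheralBoundary τ ≤ N.map (peripheralBoundary τ).subtype := by
    refine Submodule.topologicalClosure_minimal _ (Submodule.span_le.2 ?_) hN
    rintro y ⟨c, hc, hy⟩
    exact ⟨⟨y, eigen_mem_peripheralBoundary hc hy⟩, eigen c _ hc hy, rfl⟩
  obtain ⟨y, hy, hyx⟩ := hle x.2
  have : y = x := Subtype.ext hyx
  exact this ▸ hy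

end PeripheralInduction

section PeripheralProduct

variable {K : Type u} [NormedAddCommGroup K] [InnerProductSpace ℂ K] [CompleteSpace K]
  {τ : (K →L[ℂ] K) →L[ℂ] (K →L[ℂ] K)}

/-- `m x y` is the strong limit of `(c d)⁻ⁿ τⁿ (x y)` for peripheral eigenvectors `x`, `y`. -/
def IsEigenProduct (τ : (K →L[ℂ] K) →L[ℂ] (K →L[ℂ] K))
    (m : peripheralBoundary τ →L[ℂ] peripheralBoundary τ →L[ℂ] peripheralBoundary τ) : Prop :=
  ∀ (c d : ℂ), ‖c‖ = 1 → ‖d‖ = 1 → ∀ x y : peripheralBoundary τ,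
    τ x = c • (x : K →L[ℂ] K) → τ y = d • (y : K →L[ℂ] K) → ∀ η : K,
      Tendsto (fun n : ℕ => (((c * d) ^ n)⁻¹ • (τ ^ n) ((x : K →L[ℂ] K) * y)) η)
        atTop (𝓝 ((m x y : K →L[ℂ] K) η))

theorem IsEigenProduct.eq {m m' : peripheralBoundary τ →L[ℂ] peripheralBoundary τ →L[ℂ]
    peripheralBoundary τ} (h : IsEigenProduct τ m) (h' : IsEigenProduct τ m') : m = m' := by
  refine ContinuousLinearMap.ext fun x => ?_
  refine peripheralBoundary_induction (isClosed_eq m.continuous m'.continuous) ?_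
    (fun x y hx hy => by rw [map_add, map_add, hx, hy])
    (fun c x hx => by rw [map_smul, map_smul, hx]) x
  intro c x hc hx
  refine ContinuousLinearMap.ext fun y => ?_
  refine peripheralBoundary_induction (isClosed_eq (m x).continuous (m' x).continuous) ?_
    (fun x y hx hy => by rw [map_add, map_add, hx, hy])
    (fun c x hx => by rw [map_smul, map_smul, hx]) y
  intro d y hd hy
  refine Subtype.ext (ContinuousLinearMap.ext fun η => ?_)
  exact tendsto_nhds_unique (h c d hc hd x y hx hy η) (h' c d hc hd x y hx hy η)

namespace IsSchwarzMap

theorem norm_scaled_pow_le (hτ : IsSchwarzMap τ) {c : ℂ} (hc : ‖c‖ = 1) (n : ℕ)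
    (w : K →L[ℂ] K) : ‖(c ^ n)⁻¹ • (τ ^ n) w‖ ≤ ‖w‖ := by
  rw [norm_smul, norm_inv, norm_pow, hc, one_pow, inv_one, one_mul]
  exact (hτ.pow n).norm_le w

/-- By normality `τ` passes through the limit and turns the sequence into `c` times its shift. This
puts the products of eigenvectors back into the peripheral boundary. -/
theorem map_of_weakTendsto (hτ : IsSchwarzMap τ) {c : ℂ} (hc : ‖c‖ = 1) {w z : K →L[ℂ] K}
    (h : WeakTendsto (fun n => (c ^ n)⁻¹ • (τ ^ n) w) atTop z) : τ z = c • z := by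
  have hc0 : c ≠ 0 := norm_ne_zero_iff.1 (by rw [hc]; exact one_ne_zero)
  have h1 := hτ.normal atTop _ z ‖w‖ (fun n => hτ.norm_scaled_pow_le hc n w) h
  have h2 : WeakTendsto (fun n => c • ((c ^ (n + 1))⁻¹ • (τ ^ (n + 1)) w)) atTop (c • z) :=
    WeakTendsto.smul (fun ξ η => (h ξ η).comp (tendsto_add_atTop_nat 1)) tendsto_const_nhds
  refine WeakTendsto.unique h1 ?_
  convert h2 using 2 with n
  rw [map_smul, smul_smul, pow_succ' τ, mul_apply_eq_comp, pow_succ' c, mul_inv, ← mul_assoc,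
    mul_inv_cancel₀ hc0, one_mul]

/-- Since `cⁿ → 1` along `l`, the normalisation can be dropped. The remaining limit no longer
depends on the eigenvalue and makes sense for linear combinations. -/
theorem weakTendsto_of_scaled {l : Filter ℕ} (hl : l ≤ atTop)
    {c : ℂ} (hc : ‖c‖ = 1) (hcl : Tendsto (fun n : ℕ => c ^ n) l (𝓝 1))
    {w z : K →L[ℂ] K} (h : WeakTendsto (fun n => (c ^ n)⁻¹ • (τ ^ n) w) atTop z) :
    WeakTendsto (fun n => (τ ^ n) w) l z := by
  have hc0 : c ≠ 0 := norm_ne_zero_iff.1 (by rw [hc]; exact one_ne_zero)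
  have h1 := (h.mono hl).smul hcl
  simpa only [smul_smul, mul_inv_cancel₀ (pow_ne_zero _ hc0), one_smul] using h1

/-- The pairs `(w, z)` such that `τⁿ w` converges weakly to `z` along `l`. -/
def limitGraph (τ : (K →L[ℂ] K) →L[ℂ] (K →L[ℂ] K)) (l : Filter ℕ) :
    Submodule ℂ ((K →L[ℂ] K) × peripheralBoundary τ) where
  carrier := {p | WeakTendsto (fun n => (τ ^ n) p.1) l p.2}
  add_mem' := fun {p q} hp hq => by
    rw [Set.mem_ofPred_eq] at *
    simpa only [Prod.fst_add, Prod.snd_add, map_add, Submodule.coe_add] using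
      WeakTendsto.add hp hq
  zero_mem' := by
    rw [Set.mem_ofPred_eq]
    intro ξ η
    simpa using tendsto_const_nhds
  smul_mem' := fun c p hp => by
    rw [Set.mem_ofPred_eq] at *
    simpa only [Prod.smul_fst, Prod.smul_snd, map_smul, Submodule.coe_smul] using
      WeakTendsto.smul hp tendsto_const_nhds

theorem mem_limitGraph {l : Filter ℕ} {w : K →L[ℂ] K} {z : peripheralBoundary τ} :
    (w, z) ∈ limitGraph τ l ↔ WeakTendsto (fun n => (τ ^ n) w) l z := Iff.rfl

theorem norm_le_of_mem_limitGraph (hτ : IsSchwarzMap τ) {l : Filter ℕ} [l.NeBot] :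
    ∀ p ∈ limitGraph τ l, ‖p.2‖ ≤ ‖p.1‖ := fun p hp =>
  WeakTendsto.norm_le (w := fun n => (τ ^ n) p.1) hp (norm_nonneg _)
    fun n => (hτ.pow n).norm_le _

theorem isClosed_limitGraph (hτ : IsSchwarzMap τ) (l : Filter ℕ) :
    IsClosed (limitGraph τ l : Set ((K →L[ℂ] K) × peripheralBoundary τ)) := by
  let e : K → K → (K →L[ℂ] K) →L[ℂ] ℂ := fun ξ η =>
    (innerSL ℂ ξ).comp (ContinuousLinearMap.apply ℂ K η)
  let f : ℕ → ((K →L[ℂ] K) × peripheralBoundary τ) →L[ℂ] (K →L[ℂ] K) := fun n =>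
    (τ ^ n).comp (ContinuousLinearMap.fst ℂ _ _) -
      (peripheralBoundary τ).subtypeL.comp (ContinuousLinearMap.snd ℂ _ _)
  have hf : ∀ n, ‖f n‖ ≤ 2 := fun n => by
    refine ContinuousLinearMap.opNorm_le_bound _ zero_le_two fun p => ?_
    calc ‖(τ ^ n) p.1 - (p.2 : K →L[ℂ] K)‖ ≤ ‖(τ ^ n) p.1‖ + ‖(p.2 : K →L[ℂ] K)‖ :=
          norm_sub_le _ _
      _ ≤ ‖p‖ + ‖p‖ :=
          add_le_add (((hτ.pow n).norm_le _).trans (norm_fst_le p)) (norm_snd_le p)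
      _ = 2 * ‖p‖ := (two_mul _).symm
  have : (limitGraph τ l : Set ((K →L[ℂ] K) × peripheralBoundary τ)) = ⋂ (ξ : K) (η : K),
      {p | Tendsto (fun n => ((e ξ η).comp (f n)) p) l (𝓝 0)} := by
    ext p
    simp only [Set.mem_iInter, Set.mem_ofPred_eq]
    refine forall₂_congr fun ξ η => ?_
    rw [← tendsto_sub_nhds_zero_iff]
    refine tendsto_congr fun n => ?_
    simp [e, f]
  rw [this]
  exact isClosed_iInter fun ξ => isClosed_iInter fun η =>
    isClosed_setOf_tendsto_zero (C := ‖e ξ η‖ * 2)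
      fun n => ((e ξ η).opNorm_comp_le _).trans (by gcongr; exact hf n)

theorem exists_eigen_limit (hτ : IsSchwarzMap τ) {l : Filter ℕ} (hl : l ≤ atTop)
    (hlc : ∀ c : ℂ, ‖c‖ = 1 → Tendsto (fun n : ℕ => c ^ n) l (𝓝 1)) {c d : ℂ} (hc : ‖c‖ = 1)
    (hd : ‖d‖ = 1) {x y : K →L[ℂ] K} (hx : τ x = c • x) (hy : τ y = d • y) :
    ∃ z : peripheralBoundary τ, (x * y, z) ∈ limitGraph τ l ∧
      ∀ η, Tendsto (fun n => (((c * d) ^ n)⁻¹ • (τ ^ n) (x * y)) η) atTop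
        (𝓝 ((z : K →L[ℂ] K) η)) := by
  have hcd : ‖c * d‖ = 1 := by rw [norm_mul, hc, hd, one_mul]
  obtain ⟨z, hz⟩ := hτ.exists_tendsto_product hc hd hx hy
  exact ⟨⟨z, eigen_mem_peripheralBoundary hcd (hτ.map_of_weakTendsto hcd (.of_apply hz))⟩,
    weakTendsto_of_scaled hl hcd (hlc _ hcd) (.of_apply hz), hz⟩

/-- The operators `w` for which `τⁿ w` converges weakly along `l` to an element of the peripheral
boundary form a closed subspace. It contains the products of eigenvectors, hence all products, by
density in each factor. -/
theorem mul_mem_map_limitGraph (hτ : IsSchwarzMap τ) {l : Filter ℕ} [l.NeBot] (hl : l ≤ atTop)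
    (hlc : ∀ c : ℂ, ‖c‖ = 1 → Tendsto (fun n : ℕ => c ^ n) l (𝓝 1))
    (x y : peripheralBoundary τ) :
    (x : K →L[ℂ] K) * (y : K →L[ℂ] K) ∈
      (limitGraph τ l).map (LinearMap.fst ℂ (K →L[ℂ] K) (peripheralBoundary τ)) := by
  have : CompleteSpace (peripheralBoundary τ) := isClosed_peripheralBoundary.completeSpace_coe
  have hW := Submodule.isClosed_map_fst_of_norm_le (hτ.isClosed_limitGraph l)
    hτ.norm_le_of_mem_limitGraph
  set W := (limitGraph τ l).map (LinearMap.fst ℂ (K →L[ℂ] K) (peripheralBoundary τ))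
  have hcont : ∀ y : K →L[ℂ] K,
      Continuous fun x : peripheralBoundary τ => (x : K →L[ℂ] K) * y := fun y => by fun_prop
  have hcont' : ∀ y : K →L[ℂ] K,
      Continuous fun x : peripheralBoundary τ => y * (x : K →L[ℂ] K) := fun y => by fun_prop
  refine peripheralBoundary_induction (τ := τ)
    (p := fun x => (x : K →L[ℂ] K) * (y : K →L[ℂ] K) ∈ W) (hW.preimage (hcont y)) ?_
    (fun x x' hx hx' => by rw [Submodule.coe_add, add_mul]; exact W.add_mem hx hx')
    (fun c x hx => by rw [Submodule.coe_smul, smul_mul_assoc]; exact W.smul_mem _ hx) x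
  intro c x hc hx
  refine peripheralBoundary_induction (τ := τ)
    (p := fun y => (x : K →L[ℂ] K) * (y : K →L[ℂ] K) ∈ W) (hW.preimage (hcont' x)) ?_
    (fun y y' hy hy' => by rw [Submodule.coe_add, mul_add]; exact W.add_mem hy hy')
    (fun c y hy => by rw [Submodule.coe_smul, mul_smul_comm]; exact W.smul_mem _ hy) y
  intro d y hd hy
  obtain ⟨z, hz, -⟩ := hτ.exists_eigen_limit hl hlc hc hd hx hy
  exact ⟨_, hz, rfl⟩

theorem exists_isEigenProduct (hτ : IsSchwarzMap τ) {l : Filter ℕ} [l.NeBot] (hl : l ≤ atTop)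
    (hlc : ∀ c : ℂ, ‖c‖ = 1 → Tendsto (fun n : ℕ => c ^ n) l (𝓝 1)) :
    ∃ m, IsEigenProduct τ m ∧ ∀ x y : peripheralBoundary τ,
      WeakTendsto (fun n => (τ ^ n) ((x : K →L[ℂ] K) * (y : K →L[ℂ] K))) l (m x y) := by
  obtain ⟨T, hT, -⟩ := Submodule.exists_continuousLinearMap_of_graph
    (hτ.norm_le_of_mem_limitGraph (l := l))
  have hmem := hτ.mul_mem_map_limitGraph hl hlc
  let ι := (peripheralBoundary τ).subtypeL
  obtain ⟨m, hmT⟩ := T.exists_comp_bilinear ((ContinuousLinearMap.mul ℂ (K →L[ℂ] K)).bilinearComp ι ι)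
    hmem
  have hm : ∀ x y : peripheralBoundary τ, WeakTendsto
      (fun n => (τ ^ n) ((x : K →L[ℂ] K) * (y : K →L[ℂ] K))) l (m x y) := fun x y => by
    have h : ((x : K →L[ℂ] K) * (y : K →L[ℂ] K), m x y) ∈ limitGraph τ l := by
      rw [hmT]
      exact hT ⟨(x : K →L[ℂ] K) * (y : K →L[ℂ] K), hmem x y⟩
    exact mem_limitGraph.1 h
  refine ⟨m, fun c d hc hd x y hx hy η => ?_, hm⟩
  obtain ⟨z, hz, hzη⟩ := hτ.exists_eigen_limit hl hlc hc hd hx hy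
  have h := (hm x y).unique hz
  rw [h]
  exact hzη η

end IsSchwarzMap

end PeripheralProduct

/-! ### The involution, the unit and the C⋆-identity -/

section PeripheralAlgebra

variable {K : Type u} [NormedAddCommGroup K] [InnerProductSpace ℂ K] [CompleteSpace K]
  {τ : (K →L[ℂ] K) →L[ℂ] (K →L[ℂ] K)}
  {m : peripheralBoundary τ →L[ℂ] peripheralBoundary τ →L[ℂ] peripheralBoundary τ}

namespace IsSchwarzMap

theorem star_mem (hτ : IsSchwarzMap τ) {x : K →L[ℂ] K} (hx : x ∈ peripheralBoundary τ) :
    star x ∈ peripheralBoundary τ := by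
  refine peripheralBoundary_induction (τ := τ)
    (p := fun x => star (x : K →L[ℂ] K) ∈ peripheralBoundary τ)
    (isClosed_peripheralBoundary.preimage (continuous_star.comp continuous_subtype_val)) ?_
    (fun x y hx hy => by rw [Submodule.coe_add, star_add]; exact Submodule.add_mem _ hx hy)
    (fun c x hx => by rw [Submodule.coe_smul, star_smul]; exact Submodule.smul_mem _ _ hx) ⟨x, hx⟩
  intro c x hc hx
  refine eigen_mem_peripheralBoundary (c := star c) (by rwa [norm_star]) ?_
  rw [hτ.map_star, hx, star_smul]

/-- On an eigenvector the difference is `(cⁿ - 1) x`. The maps `τⁿ - 1` have norm at most `2`, so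
the convergence persists on the closed span. -/
theorem tendsto_pow_self (hτ : IsSchwarzMap τ) {l : Filter ℕ}
    (hlc : ∀ c : ℂ, ‖c‖ = 1 → Tendsto (fun n : ℕ => c ^ n) l (𝓝 1)) (x : peripheralBoundary τ) :
    Tendsto (fun n => (τ ^ n) (x : K →L[ℂ] K)) l (𝓝 x) := by
  rw [← tendsto_sub_nhds_zero_iff]
  let f : ℕ → peripheralBoundary τ →L[ℂ] (K →L[ℂ] K) := fun n =>
    (τ ^ n - 1).comp (peripheralBoundary τ).subtypeL
  have hf : ∀ n, ‖f n‖ ≤ 2 := fun n => by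
    refine ContinuousLinearMap.opNorm_le_bound _ zero_le_two fun x => ?_
    calc ‖(τ ^ n) (x : K →L[ℂ] K) - x‖ ≤ ‖(τ ^ n) (x : K →L[ℂ] K)‖ + ‖(x : K →L[ℂ] K)‖ :=
          norm_sub_le _ _
      _ ≤ ‖x‖ + ‖x‖ := add_le_add ((hτ.pow n).norm_le _) le_rfl
      _ = 2 * ‖x‖ := (two_mul _).symm
  have hcl := isClosed_setOf_tendsto_zero (l := l) hf
  refine peripheralBoundary_induction (p := fun x => Tendsto (fun n => f n x) l (𝓝 0)) hcl ?_
    (fun x y hx hy => ?_) (fun c x hx => ?_) x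
  · intro c x hc hx
    have h1 : ∀ n, f n x = (c ^ n - 1) • (x : K →L[ℂ] K) := fun n => by
      change (τ ^ n) (x : K →L[ℂ] K) - x = _
      rw [pow_apply_eigen hx, sub_smul, one_smul]
    simp only [h1]
    have h2 := ((hlc c hc).sub_const 1).smul_const (x : K →L[ℂ] K)
    rwa [sub_self, zero_smul] at h2
  · simpa using hx.add hy
  · simpa using hx.const_smul c

/-- The norms along the orbit never increase, yet the orbit returns to `x` along a filter finer than
`atTop`; so no norm is ever lost. -/
theorem norm_pow_apply (hτ : IsSchwarzMap τ) (n : ℕ) (x : peripheralBoundary τ) :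
    ‖(τ ^ n) (x : K →L[ℂ] K)‖ = ‖x‖ := by
  refine le_antisymm ((hτ.pow n).norm_le _) ?_
  obtain ⟨l, hne, hl, hlc⟩ := exists_recurrence_filter
  refine le_of_tendsto (hτ.tendsto_pow_self hlc x).norm ?_
  filter_upwards [hl (eventually_ge_atTop n)] with k hk
  obtain ⟨j, rfl⟩ := Nat.exists_eq_add_of_le' hk
  rw [pow_add]
  exact (hτ.pow j).norm_le _

theorem map_mem (_ : IsSchwarzMap τ) (x : peripheralBoundary τ) :
    τ (x : K →L[ℂ] K) ∈ peripheralBoundary τ := by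
  refine peripheralBoundary_induction (τ := τ)
    (p := fun x => τ (x : K →L[ℂ] K) ∈ peripheralBoundary τ)
    (isClosed_peripheralBoundary.preimage (τ.continuous.comp continuous_subtype_val)) ?_
    (fun x y hx hy => by rw [Submodule.coe_add, map_add]; exact Submodule.add_mem _ hx hy)
    (fun c x hx => by rw [Submodule.coe_smul, map_smul]; exact Submodule.smul_mem _ _ hx) x
  intro c x hc hx
  rw [hx]
  exact Submodule.smul_mem _ _ x.2

/-- The restriction of `τ` to its peripheral Poisson boundary. -/
noncomputable def peripheralMap (hτ : IsSchwarzMap τ) :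
    peripheralBoundary τ →L[ℂ] peripheralBoundary τ :=
  (τ.comp (peripheralBoundary τ).subtypeL).codRestrict _ hτ.map_mem

theorem coe_peripheralMap (hτ : IsSchwarzMap τ) (x : peripheralBoundary τ) :
    (hτ.peripheralMap x : K →L[ℂ] K) = τ x := rfl

theorem coe_peripheralMap_pow (hτ : IsSchwarzMap τ) (n : ℕ) (x : peripheralBoundary τ) :
    ((hτ.peripheralMap ^ n) x : K →L[ℂ] K) = (τ ^ n) x := by
  induction n with
  | zero => rfl
  | succ n ih =>
    rw [pow_succ', pow_succ', mul_apply_eq_comp, mul_apply_eq_comp, coe_peripheralMap, ih]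

/-- The involution, the unit and the product `m` on the peripheral Poisson boundary. -/
noncomputable def starProduct (hτ : IsSchwarzMap τ)
    (m : peripheralBoundary τ →L[ℂ] peripheralBoundary τ →L[ℂ] peripheralBoundary τ) :
    StarProduct (peripheralBoundary τ) where
  mul x y := m x y
  adj x := ⟨star (x : K →L[ℂ] K), hτ.star_mem x.2⟩
  unit := ⟨1, mem_peripheralBoundary_of_fixed τ hτ.map_one⟩

theorem coe_adj (hτ : IsSchwarzMap τ) (x : peripheralBoundary τ) :
    ((hτ.starProduct m).adj x : K →L[ℂ] K) = star (x : K →L[ℂ] K) := rfl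

theorem starProduct_mul (hτ : IsSchwarzMap τ) (x y : peripheralBoundary τ) :
    (hτ.starProduct m).mul x y = m x y := rfl

theorem continuous_adj (hτ : IsSchwarzMap τ) : Continuous (hτ.starProduct m).adj :=
  Continuous.subtype_mk (continuous_star.comp continuous_subtype_val) _

theorem weakTendsto_product (hτ : IsSchwarzMap τ) (hm : IsEigenProduct τ m) {l : Filter ℕ}
    [l.NeBot] (hl : l ≤ atTop)
    (hlc : ∀ c : ℂ, ‖c‖ = 1 → Tendsto (fun n : ℕ => c ^ n) l (𝓝 1)) (x y : peripheralBoundary τ) :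
    WeakTendsto (fun n => (τ ^ n) ((x : K →L[ℂ] K) * (y : K →L[ℂ] K))) l (m x y) := by
  obtain ⟨m', hm', h⟩ := hτ.exists_isEigenProduct hl hlc
  rw [hm.eq hm']
  exact h x y

theorem norm_product_le (hτ : IsSchwarzMap τ) (hm : IsEigenProduct τ m)
    (x y : peripheralBoundary τ) : ‖m x y‖ ≤ ‖x‖ * ‖y‖ := by
  obtain ⟨l, hne, hl, hlc⟩ := exists_recurrence_filter
  exact (hτ.weakTendsto_product hm hl hlc x y).norm_le (by positivity)
    fun n => ((hτ.pow n).norm_le _).trans (norm_mul_le (x : K →L[ℂ] K) (y : K →L[ℂ] K))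

/-- The inequality `x*x ≤ x* ∘ x` of quadratic forms, as the limit of `τⁿ(x)* τⁿ(x) ≤ τⁿ(x*x)` along
the recurrence filter. It carries both the C⋆-identity and the definiteness of the inner product. -/
theorem norm_apply_sq_le_product (hτ : IsSchwarzMap τ) (hm : IsEigenProduct τ m)
    (x : peripheralBoundary τ) (ξ : K) :
    ‖(x : K →L[ℂ] K) ξ‖ ^ 2 ≤
      (inner ℂ ξ ((m ((hτ.starProduct m).adj x) x : K →L[ℂ] K) ξ)).re := by
  obtain ⟨l, hne, hl, hlc⟩ := exists_recurrence_filter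
  have h1 := (Complex.continuous_re.tendsto _).comp
    (hτ.weakTendsto_product hm hl hlc ((hτ.starProduct m).adj x) x ξ ξ)
  have h2 := (((ContinuousLinearMap.apply ℂ K ξ).continuous.tendsto _).comp
    (hτ.tendsto_pow_self hlc x)).norm.pow 2
  exact le_of_tendsto_of_tendsto' h2 h1 fun n => (hτ.pow n).norm_apply_sq_le_re_inner x ξ

theorem norm_adj_product_self (hτ : IsSchwarzMap τ) (hm : IsEigenProduct τ m)
    (x : peripheralBoundary τ) : ‖m ((hτ.starProduct m).adj x) x‖ = ‖x‖ * ‖x‖ := by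
  have hadj : ‖(hτ.starProduct m).adj x‖ = ‖x‖ := norm_star (x : K →L[ℂ] K)
  refine le_antisymm ((hτ.norm_product_le hm _ _).trans_eq (by rw [hadj])) ?_
  set z := m ((hτ.starProduct m).adj x) x
  have h : ‖x‖ ≤ √‖z‖ := by
    refine ContinuousLinearMap.opNorm_le_bound _ (Real.sqrt_nonneg _) fun ξ => ?_
    refine le_of_sq_le_sq ((hτ.norm_apply_sq_le_product hm x ξ).trans ?_) (by positivity)
    rw [mul_pow, Real.sq_sqrt (norm_nonneg _)]
    calc _ ≤ ‖ξ‖ * ‖(z : K →L[ℂ] K) ξ‖ := re_inner_le_norm (𝕜 := ℂ) _ _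
      _ ≤ ‖ξ‖ * (‖z‖ * ‖ξ‖) := by
        gcongr
        exact (z : K →L[ℂ] K).le_opNorm ξ
      _ = _ := by ring
  calc ‖x‖ * ‖x‖ ≤ √‖z‖ * √‖z‖ := by gcongr
    _ = ‖z‖ := Real.mul_self_sqrt (norm_nonneg _)

theorem adj_product (hτ : IsSchwarzMap τ) (hm : IsEigenProduct τ m) (x y : peripheralBoundary τ) :
    (hτ.starProduct m).adj (m x y) =
      m ((hτ.starProduct m).adj y) ((hτ.starProduct m).adj x) := by
  obtain ⟨l, hne, hl, hlc⟩ := exists_recurrence_filter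
  refine Subtype.ext ((hτ.weakTendsto_product hm hl hlc x y).star.unique ?_)
  have h := hτ.weakTendsto_product hm hl hlc ((hτ.starProduct m).adj y) ((hτ.starProduct m).adj x)
  simp only [coe_adj, ← star_mul, (hτ.pow _).map_star] at h
  exact h

theorem unit_product (hτ : IsSchwarzMap τ) (hm : IsEigenProduct τ m) (x : peripheralBoundary τ) :
    m (hτ.starProduct m).unit x = x := by
  obtain ⟨l, hne, hl, hlc⟩ := exists_recurrence_filter
  have h := hτ.weakTendsto_product hm hl hlc (hτ.starProduct m).unit x
  simp only [starProduct, one_mul] at h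
  exact Subtype.ext (h.unique (.of_norm (hτ.tendsto_pow_self hlc x)))

theorem product_unit (hτ : IsSchwarzMap τ) (hm : IsEigenProduct τ m) (x : peripheralBoundary τ) :
    m x (hτ.starProduct m).unit = x := by
  obtain ⟨l, hne, hl, hlc⟩ := exists_recurrence_filter
  have h := hτ.weakTendsto_product hm hl hlc x (hτ.starProduct m).unit
  simp only [starProduct, mul_one] at h
  exact Subtype.ext (h.unique (.of_norm (hτ.tendsto_pow_self hlc x)))

theorem map_product_eigen (hτ : IsSchwarzMap τ) (hm : IsEigenProduct τ m) {c d : ℂ} (hc : ‖c‖ = 1)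
    (hd : ‖d‖ = 1) {x y : peripheralBoundary τ} (hx : τ x = c • (x : K →L[ℂ] K))
    (hy : τ y = d • (y : K →L[ℂ] K)) : τ (m x y) = (c * d) • (m x y : K →L[ℂ] K) :=
  hτ.map_of_weakTendsto (by rw [norm_mul, hc, hd, one_mul])
    (.of_apply (hm c d hc hd x y hx hy))

/-- On eigenvectors both sides are `cd (x ∘ y)`. So `τ`, which need not be multiplicative for the
operator product, is multiplicative for `∘`. -/
theorem peripheralMap_product (hτ : IsSchwarzMap τ) (hm : IsEigenProduct τ m)
    (x y : peripheralBoundary τ) :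
    hτ.peripheralMap (m x y) = m (hτ.peripheralMap x) (hτ.peripheralMap y) := by
  refine peripheralBoundary_induction
    (p := fun x => hτ.peripheralMap (m x y) = m (hτ.peripheralMap x) (hτ.peripheralMap y))
    (isClosed_eq (by fun_prop) (by fun_prop)) ?_
    (fun x x' hx hx' => by simp only [map_add, add_apply, hx, hx'])
    (fun c x hx => by simp only [map_smul, smul_apply, hx]) x
  intro c x hc hx
  refine peripheralBoundary_induction
    (p := fun y => hτ.peripheralMap (m x y) = m (hτ.peripheralMap x) (hτ.peripheralMap y))
    (isClosed_eq (by fun_prop) (by fun_prop)) ?_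
    (fun y y' hy hy' => by simp only [map_add, hy, hy'])
    (fun c y hy => by simp only [map_smul, hy]) y
  intro d y hd hy
  have h1 : hτ.peripheralMap x = c • x := Subtype.ext hx
  have h2 : hτ.peripheralMap y = d • y := Subtype.ext hy
  rw [h1, h2, map_smul, map_smul, smul_apply, smul_smul, mul_comm d c]
  exact Subtype.ext (hτ.map_product_eigen hm hc hd hx hy)

/-- The adjoint form of `norm_pow_defect_apply_sq_le`: the left factor is now the eigenvector, and
the right factor is arbitrary. -/
theorem norm_pow_defect_star_apply_sq_le (hτ : IsSchwarzMap τ) {c : ℂ} (hc : ‖c‖ = 1)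
    {x : K →L[ℂ] K} (hx : τ x = c • x) (w : K →L[ℂ] K) (n k : ℕ) (ξ : K) :
    ‖star ((τ ^ n) ((τ ^ k) (x * w) - (τ ^ k) x * (τ ^ k) w)) ξ‖ ^ 2 ≤
      (2 * ‖w‖ ^ 2 + 1) * ((inner ℂ ξ ((τ ^ (n + k)) (x * star x) ξ)).re -
        (inner ℂ ξ ((τ ^ n) (x * star x) ξ)).re) := by
  have hx' : τ (star x) = star c • star x := by rw [hτ.map_star, hx, star_smul]
  have h := hτ.norm_pow_defect_apply_sq_le (d := star c) (by rwa [norm_star]) (star w) hx' n k ξ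
  rw [norm_star, star_star, ← star_mul, (hτ.pow k).map_star, (hτ.pow k).map_star,
    (hτ.pow k).map_star, ← star_mul, ← star_sub, (hτ.pow n).map_star] at h
  exact h

end IsSchwarzMap

end PeripheralAlgebra

/-! ### Associativity and the C⋆-algebra structure -/

section PeripheralAssoc

variable {K : Type u} [NormedAddCommGroup K] [InnerProductSpace ℂ K] [CompleteSpace K]
  {τ : (K →L[ℂ] K) →L[ℂ] (K →L[ℂ] K)}
  {m : peripheralBoundary τ →L[ℂ] peripheralBoundary τ →L[ℂ] peripheralBoundary τ}

namespace IsSchwarzMap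

/-- Replace `x ∘ y` and `y ∘ z` by their approximants at stage `k`, and write `x` and `z` as scaled
`τᵏ x` and `τᵏ z`. Up to a unimodular factor this leaves `τᵏ(xy) τᵏ(z) - τᵏ(x) τᵏ(yz)`. Inserting
`τᵏ(xyz)` splits it into two defects, one with the eigenvector `x` on the left and one with the
eigenvector `z` on the right. -/
theorem norm_inner_associator_le (hτ : IsSchwarzMap τ) (hm : IsEigenProduct τ m) {c d e : ℂ}
    (hc : ‖c‖ = 1) (hd : ‖d‖ = 1) (he : ‖e‖ = 1) {x y z : peripheralBoundary τ}
    (hx : τ x = c • (x : K →L[ℂ] K)) (hy : τ y = d • (y : K →L[ℂ] K))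
    (hz : τ z = e • (z : K →L[ℂ] K)) {ξ η : K} {r s : ℝ} (n : ℕ)
    (hr : ∀ k, ‖star ((τ ^ n) ((τ ^ k) ((x : K →L[ℂ] K) * ((y : K →L[ℂ] K) * z)) -
      (τ ^ k) x * (τ ^ k) ((y : K →L[ℂ] K) * z))) ξ‖ ≤ r)
    (hs : ∀ k, ‖(τ ^ n) ((τ ^ k) ((x : K →L[ℂ] K) * (y : K →L[ℂ] K) * z) -
      (τ ^ k) ((x : K →L[ℂ] K) * (y : K →L[ℂ] K)) * (τ ^ k) z) η‖ ≤ s) :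
    ‖inner ℂ ξ (((τ ^ n) ((m x y : K →L[ℂ] K) * z - (x : K →L[ℂ] K) * (m y z : K →L[ℂ] K))) η)‖ ≤
      r * ‖η‖ + ‖ξ‖ * s := by
  have hcd : ‖c * d‖ = 1 := by rw [norm_mul, hc, hd, one_mul]
  have hde : ‖d * e‖ = 1 := by rw [norm_mul, hd, he, one_mul]
  have hcde : ‖c * d * e‖ = 1 := by rw [norm_mul, hcd, he, one_mul]
  have hne : ∀ {t : ℂ}, ‖t‖ = 1 → t ≠ 0 := fun ht => norm_ne_zero_iff.1 (by rw [ht]; exact one_ne_zero)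
  have h1 : WeakTendsto (fun k => (((c * d) ^ k)⁻¹ • (τ ^ k) ((x : K →L[ℂ] K) * (y : K →L[ℂ] K))) *
      (z : K →L[ℂ] K) - (x : K →L[ℂ] K) * (((d * e) ^ k)⁻¹ • (τ ^ k) ((y : K →L[ℂ] K) * z))) atTop
      ((m x y : K →L[ℂ] K) * z - (x : K →L[ℂ] K) * (m y z : K →L[ℂ] K)) :=
    ((WeakTendsto.of_apply (hm c d hc hd x y hx hy)).mul_right _).sub
      ((WeakTendsto.of_apply (hm d e hd he y z hy hz)).mul_left _)
  -- Normality of `τⁿ` lets `k → ∞` inside; it needs the approximants to be uniformly bounded.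
  have h2 := (hτ.pow n).normal atTop _ _ (‖(x : K →L[ℂ] K) * (y : K →L[ℂ] K)‖ * ‖(z : K →L[ℂ] K)‖ +
    ‖(x : K →L[ℂ] K)‖ * ‖(y : K →L[ℂ] K) * (z : K →L[ℂ] K)‖) (fun k => by
      refine (norm_sub_le _ _).trans (add_le_add ?_ ?_)
      · refine (norm_mul_le _ _).trans ?_
        gcongr
        exact hτ.norm_scaled_pow_le hcd k _
      · refine (norm_mul_le _ _).trans ?_
        gcongr
        exact hτ.norm_scaled_pow_le hde k _) h1
  refine le_of_tendsto (h2 ξ η).norm (Eventually.of_forall fun k => ?_)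
  set A := (τ ^ n) ((τ ^ k) ((x : K →L[ℂ] K) * ((y : K →L[ℂ] K) * z)) -
      (τ ^ k) x * (τ ^ k) ((y : K →L[ℂ] K) * z)) with hA
  set B := (τ ^ n) ((τ ^ k) ((x : K →L[ℂ] K) * (y : K →L[ℂ] K) * z) -
      (τ ^ k) ((x : K →L[ℂ] K) * (y : K →L[ℂ] K)) * (τ ^ k) z) with hB
  have h3 : (τ ^ n) ((((c * d) ^ k)⁻¹ • (τ ^ k) ((x : K →L[ℂ] K) * (y : K →L[ℂ] K))) *
      (z : K →L[ℂ] K) - (x : K →L[ℂ] K) * (((d * e) ^ k)⁻¹ • (τ ^ k) ((y : K →L[ℂ] K) * z))) =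
      ((c * d * e) ^ k)⁻¹ • (A - B) := by
    have h4 : (((c * d) ^ k)⁻¹ • (τ ^ k) ((x : K →L[ℂ] K) * (y : K →L[ℂ] K))) *
        (z : K →L[ℂ] K) - (x : K →L[ℂ] K) * (((d * e) ^ k)⁻¹ • (τ ^ k) ((y : K →L[ℂ] K) * z)) =
        ((c * d * e) ^ k)⁻¹ • ((τ ^ k) ((x : K →L[ℂ] K) * (y : K →L[ℂ] K)) * (e ^ k • (z : K →L[ℂ] K)) -
          (c ^ k • (x : K →L[ℂ] K)) * (τ ^ k) ((y : K →L[ℂ] K) * z)) := by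
      rw [smul_sub, smul_mul_assoc, mul_smul_comm, mul_smul_comm, smul_mul_assoc, smul_smul,
        smul_smul]
      congr 2
      · rw [mul_pow (c * d), mul_inv, mul_assoc, inv_mul_cancel₀ (pow_ne_zero k (hne he)), mul_one]
      · rw [mul_assoc, mul_pow c, mul_inv, mul_comm (c ^ k)⁻¹, mul_assoc,
          inv_mul_cancel₀ (pow_ne_zero k (hne hc)), mul_one]
    rw [h4, map_smul, hA, hB, ← map_sub (τ ^ n), mul_assoc (x : K →L[ℂ] K), sub_sub_sub_cancel_left,
      pow_apply_eigen hx, pow_apply_eigen hz]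
  beta_reduce
  rw [h3, smul_apply, inner_smul_right, norm_mul, norm_inv, norm_pow, hcde, one_pow, inv_one,
    one_mul, sub_apply, inner_sub_right]
  refine (norm_sub_le _ _).trans (add_le_add ?_ ?_)
  · rw [← ContinuousLinearMap.adjoint_inner_left, ← ContinuousLinearMap.star_eq_adjoint]
    refine (norm_inner_le_norm _ _).trans ?_
    gcongr
    exact hr k
  · refine (norm_inner_le_norm _ _).trans ?_
    gcongr
    exact hs k

theorem product_assoc_eigen (hτ : IsSchwarzMap τ) (hm : IsEigenProduct τ m) {c d e : ℂ}
    (hc : ‖c‖ = 1) (hd : ‖d‖ = 1) (he : ‖e‖ = 1) {x y z : peripheralBoundary τ}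
    (hx : τ x = c • (x : K →L[ℂ] K)) (hy : τ y = d • (y : K →L[ℂ] K))
    (hz : τ z = e • (z : K →L[ℂ] K)) : m (m x y) z = m x (m y z) := by
  obtain ⟨l, hne, hl, hlc⟩ := exists_recurrence_filter
  have h1 := (hτ.weakTendsto_product hm hl hlc (m x y) z).sub
    (hτ.weakTendsto_product hm hl hlc x (m y z))
  have h2 : WeakTendsto (fun n => (τ ^ n) ((m x y : K →L[ℂ] K) * (z : K →L[ℂ] K)) -
      (τ ^ n) ((x : K →L[ℂ] K) * (m y z : K →L[ℂ] K))) atTop 0 := by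
    intro ξ η
    have hx' : τ (star (x : K →L[ℂ] K)) = star c • star (x : K →L[ℂ] K) := by
      rw [hτ.map_star, hx, star_smul]
    obtain ⟨F, hF⟩ := hτ.exists_tendsto_re_inner (d := star c) (by rwa [norm_star]) hx' ξ
    obtain ⟨G, hG⟩ := hτ.exists_tendsto_re_inner he hz η
    rw [star_star] at hF
    have hmono : ∀ {d : ℂ} {y : K →L[ℂ] K} (ξ : K), ‖d‖ = 1 → τ y = d • y → ∀ {G : ℝ},
        Tendsto (fun n => (inner ℂ ξ ((τ ^ n) (star y * y) ξ)).re) atTop (𝓝 G) →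
        ∀ n, (inner ℂ ξ ((τ ^ n) (star y * y) ξ)).re ≤ G := by
      intro d y ξ hd hy G hG n
      refine Monotone.ge_of_tendsto (monotone_nat_of_le_succ fun n => ?_) hG n
      have h := norm_pow_defect_apply_sq_le hτ hd 0 hy n 1 ξ
      have h1 : (0 : ℝ) < 2 * ‖(0 : K →L[ℂ] K)‖ ^ 2 + 1 := by positivity
      exact sub_nonneg.1 (nonneg_of_mul_nonneg_right ((sq_nonneg _).trans h) h1)
    have hmF := hmono (d := star c) ξ (by rwa [norm_star]) hx' (by rwa [star_star])
    rw [star_star] at hmF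
    have hmG := hmono η he hz hG
    set C₁ := 2 * ‖(y : K →L[ℂ] K) * (z : K →L[ℂ] K)‖ ^ 2 + 1 with hC₁
    set C₂ := 2 * ‖(x : K →L[ℂ] K) * (y : K →L[ℂ] K)‖ ^ 2 + 1 with hC₂
    -- The increments from `n` to `n + k` are at most the gap between the monotone limit and its
    -- `n`-th term. This bound is uniform in `k` and tends to zero with `n`.
    have h0 : Tendsto (fun n =>
        √(C₁ * (F - (inner ℂ ξ ((τ ^ n) ((x : K →L[ℂ] K) * star (x : K →L[ℂ] K)) ξ)).re)) * ‖η‖ +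
        ‖ξ‖ * √(C₂ * (G - (inner ℂ η ((τ ^ n) (star (z : K →L[ℂ] K) * (z : K →L[ℂ] K)) η)).re)))
        atTop (𝓝 0) := by
      have h3 := ((hF.const_sub F).const_mul C₁).sqrt.mul_const ‖η‖
      have h4 := ((hG.const_sub G).const_mul C₂).sqrt.const_mul ‖ξ‖
      simpa using h3.add h4
    have h3 := squeeze_zero_norm (fun n => hτ.norm_inner_associator_le hm hc hd he hx hy hz
      (ξ := ξ) (η := η) n (fun k => Real.le_sqrt_of_sq_le
        ((hτ.norm_pow_defect_star_apply_sq_le hc hx _ n k ξ).trans ?_))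
      (fun k => Real.le_sqrt_of_sq_le ((hτ.norm_pow_defect_apply_sq_le he _ hz n k η).trans ?_))) h0
    · simpa only [map_sub, zero_apply, inner_zero_right] using h3
    · rw [← hC₁]
      gcongr
      exact hmF _
    · rw [← hC₂]
      gcongr
      exact hmG _
  exact Subtype.ext (sub_eq_zero.1 (h1.unique (h2.mono hl)))

theorem product_assoc (hτ : IsSchwarzMap τ) (hm : IsEigenProduct τ m)
    (x y z : peripheralBoundary τ) : m (m x y) z = m x (m y z) := by
  refine peripheralBoundary_induction (p := fun x => m (m x y) z = m x (m y z))
    (isClosed_eq (by fun_prop) (by fun_prop)) ?_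
    (fun x x' hx hx' => by simp only [map_add, add_apply, hx, hx'])
    (fun c x hx => by simp only [map_smul, smul_apply, hx]) x
  intro c x hc hx
  refine peripheralBoundary_induction (p := fun y => m (m x y) z = m x (m y z))
    (isClosed_eq (by fun_prop) (by fun_prop)) ?_
    (fun x x' hx hx' => by simp only [map_add, add_apply, hx, hx'])
    (fun c x hx => by simp only [map_smul, smul_apply, hx]) y
  intro d y hd hy
  refine peripheralBoundary_induction (p := fun z => m (m x y) z = m x (m y z))
    (isClosed_eq (by fun_prop) (by fun_prop)) ?_
    (fun x x' hx hx' => by simp only [map_add, hx, hx'])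
    (fun c x hx => by simp only [map_smul, hx]) z
  intro e z he hz
  exact hτ.product_assoc_eigen hm hc hd he hx hy hz

theorem isUnitalCStarAlgebra (hτ : IsSchwarzMap τ) (hm : IsEigenProduct τ m) :
    (hτ.starProduct m).IsUnitalCStarAlgebra where
  complete := isClosed_peripheralBoundary.completeSpace_coe
  add_mul x y z := by simp only [starProduct_mul, map_add, add_apply]
  mul_add x y z := by simp only [starProduct_mul, map_add]
  smul_mul c x y := by simp only [starProduct_mul, map_smul, smul_apply]
  mul_smul c x y := by simp only [starProduct_mul, map_smul]
  mul_assoc := hτ.product_assoc hm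
  unit_mul := hτ.unit_product hm
  mul_unit := hτ.product_unit hm
  adj_add x y := Subtype.ext (star_add (x : K →L[ℂ] K) (y : K →L[ℂ] K))
  adj_smul c x := Subtype.ext (star_smul c (x : K →L[ℂ] K))
  adj_adj x := Subtype.ext (star_star (x : K →L[ℂ] K))
  adj_mul := hτ.adj_product hm
  norm_mul_le := hτ.norm_product_le hm
  norm_adj_mul_self := hτ.norm_adj_product_self hm

theorem mem_poissonBoundary {x : peripheralBoundary τ} :
    x ∈ poissonBoundary τ ↔ τ (x : K →L[ℂ] K) = x := Iff.rfl

theorem isCStarSubalgebra (hτ : IsSchwarzMap τ) (hm : IsEigenProduct τ m) :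
    (hτ.starProduct m).IsCStarSubalgebra (poissonBoundary τ) where
  isClosed := isClosed_eq (τ.continuous.comp continuous_subtype_val) continuous_subtype_val
  mul_mem {x y} hx hy := by
    rw [mem_poissonBoundary, ← one_smul ℂ (x : K →L[ℂ] K)] at hx
    rw [mem_poissonBoundary, ← one_smul ℂ (y : K →L[ℂ] K)] at hy
    have h := hτ.map_product_eigen hm norm_one norm_one
      (by rw [one_smul] at *; exact hx) (by rw [one_smul] at *; exact hy)
    rw [mul_one, one_smul] at h
    exact h
  adj_mem {x} hx := by
    rw [mem_poissonBoundary] at *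
    rw [coe_adj, hτ.map_star, hx]
  unit_mem := hτ.map_one

end IsSchwarzMap

end PeripheralAssoc

theorem Submodule.exists_continuousLinearMap_of_total_graph {E Z : Type*} [NormedAddCommGroup E]
    [NormedSpace ℂ E] [NormedAddCommGroup Z] [NormedSpace ℂ Z] {R : Submodule ℂ (E × Z)}
    (hb : ∀ p ∈ R, ‖p.2‖ ≤ ‖p.1‖) (hR : ∀ x, x ∈ R.map (LinearMap.fst ℂ E Z)) :
    ∃ T : E →L[ℂ] Z, ∀ x, (x, T x) ∈ R := by
  obtain ⟨T, hT, -⟩ := Submodule.exists_continuousLinearMap_of_graph hb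
  exact ⟨T.comp ((ContinuousLinearMap.id ℂ E).codRestrict _ hR), fun x => hT ⟨x, hR x⟩⟩

/-! ### The ergodic mean as a conditional expectation -/

section PeripheralExpectation

variable {K : Type u} [NormedAddCommGroup K] [InnerProductSpace ℂ K] [CompleteSpace K]
  {τ : (K →L[ℂ] K) →L[ℂ] (K →L[ℂ] K)}
  {m : peripheralBoundary τ →L[ℂ] peripheralBoundary τ →L[ℂ] peripheralBoundary τ}

namespace IsSchwarzMap

/-- The mean of the first `N + 1` powers of `τ` on its peripheral Poisson boundary. -/
noncomputable def cesaro (hτ : IsSchwarzMap τ) (N : ℕ) :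
    peripheralBoundary τ →L[ℂ] peripheralBoundary τ :=
  (((N + 1 : ℝ)⁻¹ : ℝ) : ℂ) • ∑ k ∈ Finset.range (N + 1), hτ.peripheralMap ^ k

theorem cesaro_apply (hτ : IsSchwarzMap τ) (N : ℕ) (x : peripheralBoundary τ) :
    hτ.cesaro N x =
      (((N + 1 : ℝ)⁻¹ : ℝ) : ℂ) • ∑ k ∈ Finset.range (N + 1), (hτ.peripheralMap ^ k) x := by
  simp [cesaro]

theorem norm_peripheralMap_pow (hτ : IsSchwarzMap τ) (n : ℕ) (x : peripheralBoundary τ) :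
    ‖(hτ.peripheralMap ^ n) x‖ = ‖x‖ := by
  rw [← hτ.norm_pow_apply n x, ← hτ.coe_peripheralMap_pow]
  rfl

theorem norm_cesaro_apply_le (hτ : IsSchwarzMap τ) (N : ℕ) (x : peripheralBoundary τ) :
    ‖hτ.cesaro N x‖ ≤ ‖x‖ := by
  have hN : (0 : ℝ) < N + 1 := by positivity
  rw [cesaro_apply, norm_smul, Complex.norm_real, Real.norm_of_nonneg (by positivity),
    inv_mul_le_iff₀ hN]
  refine (norm_sum_le _ _).trans ?_
  simp only [hτ.norm_peripheralMap_pow, Finset.sum_const, Finset.card_range, nsmul_eq_mul]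
  push_cast
  exact le_rfl

theorem peripheralMap_pow_of_mem (hτ : IsSchwarzMap τ) {x : peripheralBoundary τ}
    (hx : x ∈ poissonBoundary τ) (n : ℕ) : (hτ.peripheralMap ^ n) x = x := by
  induction n with
  | zero => rfl
  | succ n ih =>
    rw [pow_succ', mul_apply_eq_comp, ih]
    exact Subtype.ext hx

theorem cesaro_of_mem (hτ : IsSchwarzMap τ) {x : peripheralBoundary τ}
    (hx : x ∈ poissonBoundary τ) (N : ℕ) : hτ.cesaro N x = x := by
  have hN : ((N : ℂ) + 1) ≠ 0 := by exact_mod_cast N.succ_ne_zero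
  rw [cesaro_apply]
  simp only [hτ.peripheralMap_pow_of_mem hx, Finset.sum_const, Finset.card_range]
  rw [← Nat.cast_smul_eq_nsmul ℂ, smul_smul]
  push_cast
  rw [inv_mul_cancel₀ hN, one_smul]

/-- The geometric sums of `c` are bounded by `2 / ‖c - 1‖`, and are divided by `N + 1`. -/
theorem tendsto_cesaro_of_eigen (hτ : IsSchwarzMap τ) {c : ℂ} (hc : ‖c‖ = 1) (hc1 : c ≠ 1)
    {x : peripheralBoundary τ} (hx : τ x = c • (x : K →L[ℂ] K)) :
    Tendsto (fun N => hτ.cesaro N x) atTop (𝓝 0) := by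
  have h0 : Tendsto (fun N : ℕ => 1 / ((N : ℝ) + 1) * (2 / ‖c - 1‖ * ‖x‖)) atTop (𝓝 0) := by
    simpa using (tendsto_one_div_add_atTop_nhds_zero_nat (𝕜 := ℝ)).mul_const (2 / ‖c - 1‖ * ‖x‖)
  refine squeeze_zero_norm (fun N => ?_) h0
  have hk : ∀ k, (hτ.peripheralMap ^ k) x = c ^ k • x := fun k =>
    Subtype.ext ((hτ.coe_peripheralMap_pow k x).trans (pow_apply_eigen hx k))
  rw [cesaro_apply]
  simp only [hk]
  rw [← Finset.sum_smul, geom_sum_eq hc1, norm_smul, norm_smul, Complex.norm_real,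
    Real.norm_of_nonneg (by positivity), one_div, norm_div]
  gcongr
  refine (norm_sub_le _ _).trans ?_
  rw [norm_pow, hc, norm_one]
  norm_num

theorem exists_cesaro_graph (hτ : IsSchwarzMap τ) :
    ∃ R : Submodule ℂ (peripheralBoundary τ × poissonBoundary τ),
      IsClosed (R : Set (peripheralBoundary τ × poissonBoundary τ)) ∧ ∀ x z, (x, z) ∈ R ↔
        Tendsto (fun N => hτ.cesaro N x) atTop (𝓝 (z : peripheralBoundary τ)) := by
  let f : ℕ → (peripheralBoundary τ × poissonBoundary τ) →L[ℂ] peripheralBoundary τ := fun N =>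
    (hτ.cesaro N).comp (ContinuousLinearMap.fst ℂ _ _) -
      (poissonBoundary τ).subtypeL.comp (ContinuousLinearMap.snd ℂ _ _)
  have hf : ∀ n, ‖f n‖ ≤ 2 := fun n => by
    refine ContinuousLinearMap.opNorm_le_bound _ zero_le_two fun p => ?_
    calc ‖hτ.cesaro n p.1 - (p.2 : peripheralBoundary τ)‖
        ≤ ‖hτ.cesaro n p.1‖ + ‖(p.2 : peripheralBoundary τ)‖ := norm_sub_le _ _
      _ ≤ ‖p‖ + ‖p‖ :=
          add_le_add ((hτ.norm_cesaro_apply_le n _).trans (norm_fst_le p)) (norm_snd_le p)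
      _ = 2 * ‖p‖ := (two_mul _).symm
  refine ⟨{ carrier := {p | Tendsto (fun n => f n p) atTop (𝓝 0)}
            add_mem' := fun {p q} hp hq => ?_
            zero_mem' := ?_
            smul_mem' := fun c p hp => ?_ }, isClosed_setOf_tendsto_zero hf,
            fun x z => tendsto_sub_nhds_zero_iff⟩
  · rw [Set.mem_ofPred_eq] at *
    simpa using hp.add hq
  · rw [Set.mem_ofPred_eq]
    simp
  · rw [Set.mem_ofPred_eq] at *
    simpa using hp.const_smul c

theorem exists_tendsto_cesaro_of_eigen (hτ : IsSchwarzMap τ) {c : ℂ} (hc : ‖c‖ = 1)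
    {x : peripheralBoundary τ} (hx : τ x = c • (x : K →L[ℂ] K)) :
    ∃ z : poissonBoundary τ,
      Tendsto (fun N => hτ.cesaro N x) atTop (𝓝 (z : peripheralBoundary τ)) := by
  by_cases hc1 : c = 1
  · rw [hc1, one_smul] at hx
    refine ⟨⟨x, hx⟩, ?_⟩
    simp only [hτ.cesaro_of_mem (x := x) hx]
    exact tendsto_const_nhds
  · exact ⟨0, hτ.tendsto_cesaro_of_eigen hc hc1 hx⟩

theorem exists_mem_cesaro_graph (hτ : IsSchwarzMap τ)
    {R : Submodule ℂ (peripheralBoundary τ × poissonBoundary τ)}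
    (hW : IsClosed ((R.map (LinearMap.fst ℂ (peripheralBoundary τ) (poissonBoundary τ)) :
      Submodule ℂ (peripheralBoundary τ)) : Set (peripheralBoundary τ)))
    (hRm : ∀ x z, (x, z) ∈ R ↔
      Tendsto (fun N => hτ.cesaro N x) atTop (𝓝 (z : peripheralBoundary τ)))
    (x : peripheralBoundary τ) :
    x ∈ R.map (LinearMap.fst ℂ (peripheralBoundary τ) (poissonBoundary τ)) := by
  have hmem : ∀ x z, (x, z) ∈ R →
      x ∈ R.map (LinearMap.fst ℂ (peripheralBoundary τ) (poissonBoundary τ)) :=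
    fun x z h => ⟨(x, z), h, rfl⟩
  generalize R.map (LinearMap.fst ℂ (peripheralBoundary τ) (poissonBoundary τ)) = W at *
  refine peripheralBoundary_induction (p := fun x => x ∈ W) hW ?_
    (fun x y hx hy => W.add_mem hx hy) (fun c x hx => W.smul_mem c hx) x
  intro c x hc hx
  obtain ⟨z, hz⟩ := hτ.exists_tendsto_cesaro_of_eigen hc hx
  exact hmem x z ((hRm x z).2 hz)

/-- The ergodic mean on the peripheral Poisson boundary. -/
theorem exists_ergodic_mean (hτ : IsSchwarzMap τ) :
    ∃ E : peripheralBoundary τ →L[ℂ] poissonBoundary τ,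
      (∀ x, Tendsto (fun N => hτ.cesaro N x) atTop (𝓝 (E x))) ∧ ∀ x, ‖E x‖ ≤ ‖x‖ := by
  have : CompleteSpace (peripheralBoundary τ) := isClosed_peripheralBoundary.completeSpace_coe
  have hFc : IsClosed (poissonBoundary τ : Set (peripheralBoundary τ)) :=
    isClosed_eq (τ.continuous.comp continuous_subtype_val) continuous_subtype_val
  have : CompleteSpace (poissonBoundary τ) := hFc.completeSpace_coe
  obtain ⟨R, hR, hRm⟩ := hτ.exists_cesaro_graph
  have hb : ∀ p ∈ R, ‖p.2‖ ≤ ‖p.1‖ := by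
    rintro ⟨x, z⟩ hp
    exact le_of_tendsto ((hRm x z).1 hp).norm
      (Eventually.of_forall fun N => hτ.norm_cesaro_apply_le N x)
  have hW := Submodule.isClosed_map_fst_of_norm_le hR hb
  obtain ⟨T, hT⟩ := Submodule.exists_continuousLinearMap_of_total_graph hb
    (hτ.exists_mem_cesaro_graph hW hRm)
  exact ⟨T, fun x => (hRm x (T x)).1 (hT x), fun x => hb (x, T x) (hT x)⟩

theorem peripheralMap_pow_product (hτ : IsSchwarzMap τ) (hm : IsEigenProduct τ m) (n : ℕ)
    (x y : peripheralBoundary τ) :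
    (hτ.peripheralMap ^ n) (m x y) = m ((hτ.peripheralMap ^ n) x) ((hτ.peripheralMap ^ n) y) := by
  induction n with
  | zero => rfl
  | succ n ih =>
    simp only [pow_succ', mul_apply_eq_comp, ih, hτ.peripheralMap_product hm]

theorem peripheralMap_pow_adj (hτ : IsSchwarzMap τ) (n : ℕ) (x : peripheralBoundary τ) :
    (hτ.peripheralMap ^ n) ((hτ.starProduct m).adj x) =
      (hτ.starProduct m).adj ((hτ.peripheralMap ^ n) x) := by
  refine Subtype.ext ?_
  rw [hτ.coe_peripheralMap_pow, coe_adj, coe_adj, (hτ.pow n).map_star, hτ.coe_peripheralMap_pow]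

theorem cesaro_adj (hτ : IsSchwarzMap τ) (hm : IsEigenProduct τ m) (N : ℕ)
    (x : peripheralBoundary τ) :
    hτ.cesaro N ((hτ.starProduct m).adj x) = (hτ.starProduct m).adj (hτ.cesaro N x) := by
  have h := hτ.isUnitalCStarAlgebra hm
  let A : peripheralBoundary τ →+ peripheralBoundary τ :=
    AddMonoidHom.mk' (hτ.starProduct m).adj h.adj_add
  have hA : ∀ y, (hτ.starProduct m).adj y = A y := fun _ => rfl
  rw [cesaro_apply, cesaro_apply, h.adj_smul, Complex.conj_ofReal]
  simp only [hτ.peripheralMap_pow_adj]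
  rw [hA (∑ k ∈ Finset.range (N + 1), (hτ.peripheralMap ^ k) x), map_sum]
  rfl

section ErgodicMean

variable {E : peripheralBoundary τ →L[ℂ] poissonBoundary τ}

theorem ergodicMean_adj (hτ : IsSchwarzMap τ) (hm : IsEigenProduct τ m)
    (hE : ∀ x, Tendsto (fun N => hτ.cesaro N x) atTop (𝓝 (E x))) (x : peripheralBoundary τ) :
    (E ((hτ.starProduct m).adj x) : peripheralBoundary τ) = (hτ.starProduct m).adj (E x) := by
  refine tendsto_nhds_unique (hE _) ?_
  simp only [hτ.cesaro_adj hm]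
  exact (hτ.continuous_adj.tendsto _).comp (hE x)

/-- Powers of `τ` commute with the Cesàro means and fix their limit. -/
theorem ergodicMean_peripheralMap_pow (hτ : IsSchwarzMap τ)
    (hE : ∀ x, Tendsto (fun N => hτ.cesaro N x) atTop (𝓝 (E x))) (n : ℕ)
    (x : peripheralBoundary τ) : E ((hτ.peripheralMap ^ n) x) = E x := by
  refine Subtype.ext (tendsto_nhds_unique (hE _) ?_)
  have h := ((hτ.peripheralMap ^ n).continuous.tendsto _).comp (hE x)
  rw [hτ.peripheralMap_pow_of_mem (E x).2] at h
  refine h.congr fun N => ?_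
  rw [Function.comp_apply, cesaro_apply, cesaro_apply, map_smul, map_sum]
  simp only [← mul_apply_eq_comp, ← pow_add, add_comm n]

/-- Powers of `τ` are ⋆-homomorphisms for `∘`, so they send a matrix `c* c` to one of the same form.
Averages and limits stay in the closed positive cone, and positivity then descends to the fixed
points. The bimodule property holds already for each mean, because `τ` fixes the two outer factors.
-/
theorem isConditionalExpectation_ergodicMean (hτ : IsSchwarzMap τ) (hm : IsEigenProduct τ m)
    (hE : ∀ x, Tendsto (fun N => hτ.cesaro N x) atTop (𝓝 (E x))) (hEn : ∀ x, ‖E x‖ ≤ ‖x‖) :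
    (hτ.starProduct m).IsConditionalExpectation (poissonBoundary τ) (hτ.isCStarSubalgebra hm)
      (E : peripheralBoundary τ →ₗ[ℂ] poissonBoundary τ) := by
  have hA := hτ.isUnitalCStarAlgebra hm
  refine ⟨fun a => Subtype.ext ?_, hEn, fun n a ha => ?_, fun a c x => Subtype.ext ?_⟩
  · refine tendsto_nhds_unique (hE a) ?_
    simp only [hτ.cesaro_of_mem a.2]
    exact tendsto_const_nhds
  · refine StarProduct.IsPositiveMatrix.restrict hA _ ?_
    refine StarProduct.IsPositiveMatrix.of_tendsto hA (a := fun N i j => hτ.cesaro N (a i j))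
      (fun N => ?_) fun i j => hE (a i j)
    simp only [cesaro_apply]
    refine StarProduct.IsPositiveMatrix.smul hA ?_ (by positivity)
    generalize N + 1 = M
    induction M with
    | zero =>
      simp only [Finset.range_zero, Finset.sum_empty]
      exact StarProduct.IsPositiveMatrix.zero hA
    | succ M ih =>
      simp only [Finset.sum_range_succ]
      refine ih.add hA ?_
      obtain ⟨c, hc⟩ := ha
      refine ⟨fun i j => (hτ.peripheralMap ^ M) (c i j), fun i j => ?_⟩
      beta_reduce
      rw [hc, map_sum]
      refine Finset.sum_congr rfl fun k _ => ?_
      rw [starProduct_mul, starProduct_mul, hτ.peripheralMap_pow_product hm,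
        hτ.peripheralMap_pow_adj]
  · refine tendsto_nhds_unique (hE _) ?_
    have h1 : ∀ N, hτ.cesaro N (m (m a x) c) = m (m a (hτ.cesaro N x)) c := fun N => by
      simp only [cesaro_apply, map_smul, map_sum, smul_apply, sum_apply,
        hτ.peripheralMap_pow_product hm, hτ.peripheralMap_pow_of_mem a.2,
        hτ.peripheralMap_pow_of_mem c.2]
    simp only [starProduct_mul, h1]
    have h2 : Continuous fun y => m (m a y) c := by fun_prop
    exact (h2.tendsto _).comp (hE x)

end ErgodicMean

end IsSchwarzMap

end PeripheralExpectation

/-- The left side is `x (‖a‖² - a a*) x*`, and `‖a‖² - a a*` has the form `c* c`. -/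
theorem StarProduct.exists_norm_sq_smul_sub_eq {X : Type u} [NormedAddCommGroup X]
    [NormedSpace ℂ X] {S : StarProduct X} (h : S.IsUnitalCStarAlgebra) (x a : X) :
    ∃ e, ((‖a‖ ^ 2 : ℝ) : ℂ) • S.mul x (S.adj x) - S.mul (S.mul x a) (S.adj (S.mul x a)) =
      S.mul (S.adj e) e := by
  obtain ⟨c, hc⟩ := S.exists_norm_sq_sub_mul_adj h a
  refine ⟨S.mul c (S.adj x), ?_⟩
  have key : ∀ x a c : S.Carrier h, ∀ t : ℂ, t • (1 : S.Carrier h) - a * star a = star c * c →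
      t • (x * star x) - (x * a) * star (x * a) = star (c * star x) * (c * star x) := by
    intro x a c t h
    rw [star_mul c, star_star, mul_assoc x (star c), ← mul_assoc (star c), ← h, sub_mul, mul_sub,
      smul_mul_assoc, one_mul, mul_smul_comm, star_mul]
    simp only [mul_assoc]
  exact key x a c _ hc

/-! ### Almost periodicity, faithfulness of the mean and the bimodule -/

section PeripheralModule

variable {K : Type u} [NormedAddCommGroup K] [InnerProductSpace ℂ K] [CompleteSpace K]
  {τ : (K →L[ℂ] K) →L[ℂ] (K →L[ℂ] K)}
  {m : peripheralBoundary τ →L[ℂ] peripheralBoundary τ →L[ℂ] peripheralBoundary τ}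

namespace IsSchwarzMap

/-- The orbit of an eigenvector stays in the compact set of its multiples by the unit disc. Being
near a compact set survives sums and multiples, and also norm limits because powers of `τ` are
isometric here. -/
theorem exists_compact_near_orbit (hτ : IsSchwarzMap τ) (x : peripheralBoundary τ) :
    ∀ ε > 0, ∃ C : Set (peripheralBoundary τ), IsCompact C ∧
      ∀ n, ∃ c ∈ C, ‖(hτ.peripheralMap ^ n) x - c‖ < ε := by
  refine peripheralBoundary_induction (p := fun x => ∀ ε > 0, ∃ C : Set (peripheralBoundary τ),
    IsCompact C ∧ ∀ n, ∃ c ∈ C, ‖(hτ.peripheralMap ^ n) x - c‖ < ε) ?_ ?_ ?_ ?_ x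
  · refine isClosed_of_closure_subset fun x hx => ?_
    rw [Set.mem_ofPred_eq]
    intro ε hε
    obtain ⟨y, hy, hxy⟩ := Metric.mem_closure_iff.1 hx (ε / 2) (by positivity)
    obtain ⟨C, hC, h⟩ := hy (ε / 2) (by positivity)
    refine ⟨C, hC, fun n => ?_⟩
    obtain ⟨c, hc, hcy⟩ := h n
    refine ⟨c, hc, ?_⟩
    rw [dist_eq_norm] at hxy
    have h1 : ‖(hτ.peripheralMap ^ n) x - (hτ.peripheralMap ^ n) y‖ = ‖x - y‖ := by
      rw [← map_sub, hτ.norm_peripheralMap_pow]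
    have h2 := norm_sub_le_norm_sub_add_norm_sub ((hτ.peripheralMap ^ n) x)
      ((hτ.peripheralMap ^ n) y) c
    linarith
  · intro c x hc hx ε hε
    refine ⟨(fun t : ℂ => t • x) '' Metric.closedBall 0 1,
      (isCompact_closedBall 0 1).image (by fun_prop), fun n => ⟨_, ⟨c ^ n, ?_, rfl⟩, ?_⟩⟩
    · simp [hc]
    · have : (hτ.peripheralMap ^ n) x = c ^ n • x :=
        Subtype.ext ((hτ.coe_peripheralMap_pow n x).trans (pow_apply_eigen hx n))
      rwa [this, sub_self, norm_zero]
  · intro x y hx hy ε hε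
    obtain ⟨C, hC, h⟩ := hx (ε / 2) (by positivity)
    obtain ⟨C', hC', h'⟩ := hy (ε / 2) (by positivity)
    refine ⟨_, (hC.prod hC').image (continuous_fst.add continuous_snd), fun n => ?_⟩
    obtain ⟨c, hc, hcx⟩ := h n
    obtain ⟨c', hc', hcy⟩ := h' n
    refine ⟨_, ⟨(c, c'), ⟨hc, hc'⟩, rfl⟩, ?_⟩
    rw [map_add]
    change ‖_ + _ - (c + c')‖ < ε
    rw [add_sub_add_comm]
    exact (norm_add_le _ _).trans_lt (by linarith)
  · intro c x hx ε hε
    obtain ⟨C, hC, h⟩ := hx (ε / (‖c‖ + 1)) (by positivity)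
    refine ⟨_, hC.image (continuous_const_smul c), fun n => ?_⟩
    obtain ⟨y, hy, hyx⟩ := h n
    refine ⟨_, ⟨y, hy, rfl⟩, ?_⟩
    rw [lt_div_iff₀' (by positivity)] at hyx
    rw [map_smul, ← smul_sub, norm_smul]
    refine lt_of_le_of_lt ?_ hyx
    gcongr
    linarith

/-- Every element of the peripheral Poisson boundary returns to each of its neighbourhoods within
a bounded number of steps. -/
theorem exists_bounded_return (hτ : IsSchwarzMap τ) (x : peripheralBoundary τ) {ε : ℝ}
    (hε : 0 < ε) : ∃ N : ℕ, ∀ n, ∃ j ≤ N, ‖(hτ.peripheralMap ^ (n + j)) x - x‖ < ε := by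
  have htb : TotallyBounded (Set.range fun n => (hτ.peripheralMap ^ n) x) := by
    rw [Metric.totallyBounded_iff]
    intro δ hδ
    obtain ⟨C, hC, h⟩ := hτ.exists_compact_near_orbit x (δ / 2) (by positivity)
    obtain ⟨t, ht, hCt⟩ := Metric.totallyBounded_iff.1 hC.totallyBounded (δ / 2) (by positivity)
    refine ⟨t, ht, ?_⟩
    rintro _ ⟨n, rfl⟩
    obtain ⟨c, hc, hcn⟩ := h n
    obtain ⟨y, hy, hcy⟩ := Set.mem_iUnion₂.1 (hCt hc)
    refine Set.mem_iUnion₂.2 ⟨y, hy, ?_⟩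
    rw [Metric.mem_ball] at *
    rw [← dist_eq_norm] at hcn
    linarith [dist_triangle ((hτ.peripheralMap ^ n) x) c y]
  obtain ⟨t, hts, htf, hcov⟩ := Metric.finite_approx_of_totallyBounded htb ε hε
  have hts' : ∀ y ∈ t, ∃ n, (hτ.peripheralMap ^ n) x = y := fun y hy => hts hy
  choose! i hi using hts'
  obtain ⟨N, hN⟩ := (htf.image i).bddAbove
  refine ⟨N, fun n => ?_⟩
  -- The net consists of orbit points `τⁱ x` with `i ≤ N`. If `τⁿ⁺ᴺ x` is close to one of them,
  -- cancelling the isometry `τⁱ` shows that `τⁿ⁺ᴺ⁻ⁱ x` is close to `x`.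
  obtain ⟨y, hy, hny⟩ := Set.mem_iUnion₂.1 (hcov ⟨n + N, rfl⟩)
  have hiN : i y ≤ N := hN ⟨y, hy, rfl⟩
  refine ⟨N - i y, Nat.sub_le _ _, ?_⟩
  rw [Metric.mem_ball, dist_eq_norm] at hny
  beta_reduce at hny
  have h1 : (hτ.peripheralMap ^ (n + N)) x - y =
      (hτ.peripheralMap ^ (i y)) ((hτ.peripheralMap ^ (n + (N - i y))) x - x) := by
    rw [map_sub, ← mul_apply_eq_comp, ← pow_add]
    congr 2
    · congr 1
      omega
    · exact (hi y hy).symm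
  rwa [h1, hτ.norm_peripheralMap_pow] at hny

variable {E : peripheralBoundary τ →L[ℂ] poissonBoundary τ}

/-- If the form of `z` at `ξ` were `δ > 0`, every window of `N + 1` consecutive iterates would
contain one with value at least `δ/2`, while all others are nonnegative. The sum `S` over a window
then has all its iterates, hence its mean, at least `δ/2`, although `E S` is a sum of copies of `E z
= 0`. -/
theorem re_inner_eq_zero_of_ergodicMean_eq_zero (hτ : IsSchwarzMap τ)
    (hE : ∀ x, Tendsto (fun N => hτ.cesaro N x) atTop (𝓝 (E x))) {z : peripheralBoundary τ}
    (hz : ∀ ξ : K, 0 ≤ (inner ℂ ξ ((z : K →L[ℂ] K) ξ)).re) (h0 : E z = 0) (ξ : K) :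
    (inner ℂ ξ ((z : K →L[ℂ] K) ξ)).re = 0 := by
  refine le_antisymm (not_lt.1 fun hpos => ?_) (hz ξ)
  set δ := (inner ℂ ξ ((z : K →L[ℂ] K) ξ)).re with hδ
  let g : peripheralBoundary τ →L[ℝ] ℝ :=
    Complex.reCLM.comp (((innerSL ℂ ξ).comp ((ContinuousLinearMap.apply ℂ K ξ).comp
      (peripheralBoundary τ).subtypeL)).restrictScalars ℝ)
  have hg : ∀ x, g x = (inner ℂ ξ ((x : K →L[ℂ] K) ξ)).re := fun x => rfl
  have hgle : ∀ x, |g x| ≤ ‖x‖ * ‖ξ‖ ^ 2 := fun x => by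
    rw [hg]
    refine (Complex.abs_re_le_norm _).trans ((norm_inner_le_norm _ _).trans ?_)
    calc ‖ξ‖ * ‖(x : K →L[ℂ] K) ξ‖ ≤ ‖ξ‖ * (‖x‖ * ‖ξ‖) := by
          gcongr
          exact (x : K →L[ℂ] K).le_opNorm ξ
      _ = _ := by ring
  have hgz : ∀ n, 0 ≤ g ((hτ.peripheralMap ^ n) z) := fun n => by
    rw [hg, hτ.coe_peripheralMap_pow]
    exact (hτ.pow n).re_inner_nonneg hz ξ
  have hε : 0 < δ / (2 * (‖ξ‖ ^ 2 + 1)) := by positivity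
  obtain ⟨N, hN⟩ := hτ.exists_bounded_return z hε
  let S : peripheralBoundary τ := ∑ j ∈ Finset.range (N + 1), (hτ.peripheralMap ^ j) z
  have hES : E S = 0 := by
    rw [map_sum]
    exact Finset.sum_eq_zero fun j _ => by rw [hτ.ergodicMean_peripheralMap_pow hE, h0]
  have hgS : ∀ n, δ / 2 ≤ g ((hτ.peripheralMap ^ n) S) := fun n => by
    obtain ⟨j, hj, hjz⟩ := hN n
    have h1 : g ((hτ.peripheralMap ^ n) S) =
        ∑ j ∈ Finset.range (N + 1), g ((hτ.peripheralMap ^ (n + j)) z) := by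
      rw [map_sum, map_sum]
      exact Finset.sum_congr rfl fun j _ => by rw [pow_add]; rfl
    rw [h1]
    refine le_trans ?_ (Finset.single_le_sum (f := fun j => g ((hτ.peripheralMap ^ (n + j)) z))
      (fun j _ => hgz _) (Finset.mem_range.2 (Nat.lt_succ_of_le hj)))
    have h2 := hgle ((hτ.peripheralMap ^ (n + j)) z - z)
    rw [map_sub] at h2
    have h3 : ‖(hτ.peripheralMap ^ (n + j)) z - z‖ * ‖ξ‖ ^ 2 ≤ δ / 2 := by
      calc _ ≤ δ / (2 * (‖ξ‖ ^ 2 + 1)) * (‖ξ‖ ^ 2 + 1) := by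
            gcongr
            linarith
        _ = δ / 2 := by field_simp
    have h4 : g z = δ := rfl
    have h5 := neg_le_of_abs_le (h2.trans h3)
    linarith
  have hlim := (g.continuous.tendsto _).comp (hE S)
  have h6 : δ / 2 ≤ g (E S : peripheralBoundary τ) := by
    refine ge_of_tendsto' hlim fun M => ?_
    have hM : (0 : ℝ) < M + 1 := by positivity
    rw [Function.comp_apply, cesaro_apply, Complex.coe_smul, map_smul, map_sum, smul_eq_mul,
      le_inv_mul_iff₀ hM]
    have h7 := Finset.card_nsmul_le_sum (Finset.range (M + 1))
      (fun k => g ((hτ.peripheralMap ^ k) S)) (δ / 2) fun k _ => hgS k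
    rw [Finset.card_range, nsmul_eq_mul] at h7
    rw [Nat.cast_add, Nat.cast_one] at h7
    exact h7
  rw [hES, Submodule.coe_zero, map_zero] at h6
  linarith

/-- The form of `x ∘ x*` dominates `‖x* ξ‖²`, so it is nonnegative; by the previous lemma it
vanishes. -/
theorem eq_zero_of_ergodicMean_eq_zero (hτ : IsSchwarzMap τ) (hm : IsEigenProduct τ m)
    (hE : ∀ x, Tendsto (fun N => hτ.cesaro N x) atTop (𝓝 (E x))) {x : peripheralBoundary τ}
    (h0 : E (m x ((hτ.starProduct m).adj x)) = 0) : x = 0 := by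
  have hA := hτ.isUnitalCStarAlgebra hm
  have hadj : ((hτ.starProduct m).adj ((hτ.starProduct m).adj x)) = x := hA.adj_adj x
  have h1 := hτ.norm_apply_sq_le_product hm ((hτ.starProduct m).adj x)
  rw [hadj] at h1
  have h2 := hτ.re_inner_eq_zero_of_ergodicMean_eq_zero hE
    (fun ξ => (sq_nonneg _).trans (h1 ξ)) h0
  have h3 : star (x : K →L[ℂ] K) = 0 := by
    ext ξ
    have h4 := h1 ξ
    rw [h2] at h4
    exact norm_eq_zero.1 (pow_eq_zero_iff two_ne_zero |>.1 (le_antisymm h4 (sq_nonneg _)))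
  exact Subtype.ext (star_eq_zero.1 h3)

theorem isPreHilbertCStarBimodule (hτ : IsSchwarzMap τ) (hm : IsEigenProduct τ m)
    (hE : ∀ x, Tendsto (fun N => hτ.cesaro N x) atTop (𝓝 (E x)))
    (hEc : (hτ.starProduct m).IsConditionalExpectation (poissonBoundary τ)
      (hτ.isCStarSubalgebra hm) (E : peripheralBoundary τ →ₗ[ℂ] poissonBoundary τ)) :
    IsPreHilbertCStarBimodule
      ((hτ.starProduct m).restrict (poissonBoundary τ) (hτ.isCStarSubalgebra hm))
      (fun a x => (hτ.starProduct m).mul a x) (fun x a => (hτ.starProduct m).mul x a)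
      (fun x y => E ((hτ.starProduct m).mul x ((hτ.starProduct m).adj y))) := by
  have h := hτ.isUnitalCStarAlgebra hm
  -- Plain positivity is the `1 × 1` case of complete positivity.
  have hpos : ∀ c, ((hτ.starProduct m).restrict (poissonBoundary τ)
      (hτ.isCStarSubalgebra hm)).IsPositive
      (E ((hτ.starProduct m).mul ((hτ.starProduct m).adj c) c)) := by
    intro c
    obtain ⟨d, hd⟩ := hEc.completelyPositive 1
      (fun _ _ => (hτ.starProduct m).mul ((hτ.starProduct m).adj c) c)
      ⟨fun _ _ => c, fun _ _ => by rw [Fin.sum_univ_one]⟩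
    exact ⟨d 0 0, (hd 0 0).trans (Fin.sum_univ_one _)⟩
  refine
    { isUnitalCStarAlgebra := h.restrict _
      left_add := fun a x y => h.mul_add _ _ _
      add_left := fun a c x => h.add_mul _ _ _
      left_smul := fun z a x => h.mul_smul _ _ _
      smul_left := fun z a x => h.smul_mul _ _ _
      mul_left := fun a c x => h.mul_assoc _ _ _
      unit_left := fun x => h.unit_mul _
      add_right := fun x y a => h.add_mul _ _ _
      right_add := fun x a c => h.mul_add _ _ _
      smul_right := fun z x a => h.smul_mul _ _ _
      right_smul := fun z x a => h.mul_smul _ _ _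
      right_mul := fun x a c => (h.mul_assoc _ _ _).symm
      right_unit := fun x => h.mul_unit _
      left_right := fun a x c => h.mul_assoc _ _ _
      inner_add := fun x y z => by rw [h.add_mul, map_add]
      inner_smul := fun c x y => by rw [h.smul_mul, map_smul]
      inner_left := fun a x y => ?_
      adj_inner := fun x y => Subtype.ext ?_
      inner_self_positive := fun x => ?_
      inner_self_eq_zero := fun x hx => hτ.eq_zero_of_ergodicMean_eq_zero hm hE hx
      inner_right := fun x a y => ?_
      inner_right_le := fun x a => ?_ }
  · have h1 := hEc.map_bimodule a ⟨_, (hτ.isCStarSubalgebra hm).unit_mem⟩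
      ((hτ.starProduct m).mul x ((hτ.starProduct m).adj y))
    rw [h.mul_unit] at h1
    rw [h.mul_assoc]
    exact h1.trans ((h.restrict (hτ.isCStarSubalgebra hm)).mul_unit _)
  · have h1 := hτ.ergodicMean_adj hm hE ((hτ.starProduct m).mul x ((hτ.starProduct m).adj y))
    rw [h.adj_mul, h.adj_adj] at h1
    exact h1.symm
  · have h1 := hpos ((hτ.starProduct m).adj x)
    rwa [h.adj_adj] at h1
  · congr 1
    rw [h.mul_assoc, h.adj_mul]
    congr 2
    exact (h.adj_adj _).symm
  · obtain ⟨c, hc⟩ := StarProduct.exists_norm_sq_smul_sub_eq h x (a : peripheralBoundary τ)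
    have h1 := hpos c
    rw [← hc, map_sub, map_smul] at h1
    exact h1

end IsSchwarzMap

end PeripheralModule

/-! ### Convex combinations of isometric compressions -/

section ConvexCompression

variable {Θ : Type v} {K : Type u} [NormedAddCommGroup K] [InnerProductSpace ℂ K] [CompleteSpace K]

/-- `τ x = ∑ᵢ ωᵢ lᵢ* x lᵢ` with isometries `lᵢ`. -/
structure IsConvexCompression (ω : PositiveWeights Θ) (l : Θ → K →L[ℂ] K)
    (τ : (K →L[ℂ] K) →L[ℂ] (K →L[ℂ] K)) : Prop where
  norm_apply : ∀ i ξ, ‖l i ξ‖ = ‖ξ‖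
  hasSum : ∀ x, HasSum (fun i => (ω.val i : ℂ) • (star (l i) * x * l i)) (τ x)

namespace IsConvexCompression

variable {ω : PositiveWeights Θ} {l : Θ → K →L[ℂ] K} {τ : (K →L[ℂ] K) →L[ℂ] (K →L[ℂ] K)}

theorem hasSum_inner (h : IsConvexCompression ω l τ) (x : K →L[ℂ] K) (ξ η : K) :
    HasSum (fun i => (ω.val i : ℂ) * inner ℂ (l i ξ) (x (l i η))) (inner ℂ ξ (τ x η)) := by
  have h1 := ((innerSL ℂ ξ).comp (ContinuousLinearMap.apply ℂ K η)).hasSum (h.hasSum x)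
  refine h1.congr_fun fun i => ?_
  change _ = inner ℂ ξ ((ω.val i : ℂ) • (star (l i) (x (l i η))))
  rw [inner_smul_right, ContinuousLinearMap.star_eq_adjoint,
    ContinuousLinearMap.adjoint_inner_right]

theorem hasSum_re_inner (h : IsConvexCompression ω l τ) (x : K →L[ℂ] K) (ξ η : K) :
    HasSum (fun i => ω.val i * (inner ℂ (l i ξ) (x (l i η))).re) (inner ℂ ξ (τ x η)).re := by
  simpa only [Complex.reCLM_apply, Complex.re_ofReal_mul] using
    Complex.reCLM.hasSum (h.hasSum_inner x ξ η)

theorem map_one (h : IsConvexCompression ω l τ) : τ 1 = 1 := by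
  ext η
  refine ext_inner_left ℂ fun ξ => ?_
  refine (h.hasSum_inner 1 ξ η).unique ?_
  have hl : ∀ i, inner ℂ (l i ξ) (l i η) = inner ℂ ξ η := fun i =>
    (LinearIsometry.mk (l i).toLinearMap (h.norm_apply i)).inner_map_map ξ η
  simp only [one_apply_eq_self, hl]
  simpa using (Complex.hasSum_ofReal.2 ω.hasSum_one).mul_right (inner ℂ ξ η)

theorem map_star (h : IsConvexCompression ω l τ) (x : K →L[ℂ] K) : τ (star x) = star (τ x) := by
  refine (h.hasSum (star x)).unique ((h.hasSum x).star.congr_fun fun i => ?_)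
  rw [star_smul, star_mul, star_mul, star_star, mul_assoc]
  congr 1
  exact (Complex.conj_ofReal _).symm

theorem norm_apply_le (h : IsConvexCompression ω l τ) (x : K →L[ℂ] K) : ‖τ x‖ ≤ ‖x‖ := by
  have hl : ∀ i, ‖l i‖ ≤ 1 := fun i =>
    ContinuousLinearMap.opNorm_le_bound _ zero_le_one fun ξ => by rw [h.norm_apply, one_mul]
  have h1 := ω.hasSum_one.mul_right ‖x‖
  rw [one_mul] at h1
  refine (h.hasSum x).norm_le_of_bounded h1 fun i => ?_
  rw [norm_smul, Complex.norm_real, Real.norm_of_nonneg (ω.pos i).le]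
  refine mul_le_mul_of_nonneg_left ?_ (ω.pos i).le
  calc ‖star (l i) * x * l i‖ ≤ ‖star (l i)‖ * ‖x‖ * ‖l i‖ :=
        (norm_mul_le _ _).trans (by gcongr; exact norm_mul_le _ _)
    _ ≤ 1 * ‖x‖ * 1 := by
        rw [norm_star]
        gcongr <;> exact hl i
    _ = ‖x‖ := by ring

/-- Dominated convergence for the series over `Θ`; the summable weights absorb the uniform bound
`M`. -/
theorem weakTendsto_map (h : IsConvexCompression ω l τ) (F : Filter ℕ) (w : ℕ → K →L[ℂ] K)
    (z : K →L[ℂ] K) (M : ℝ) (hM : ∀ n, ‖w n‖ ≤ M) (hw : WeakTendsto w F z) :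
    WeakTendsto (fun n => τ (w n)) F (τ z) := by
  intro ξ η
  simp only [← (h.hasSum_inner _ ξ η).tsum_eq]
  refine tendsto_tsum_of_dominated_convergence (bound := fun i => ω.val i * (‖ξ‖ * (M * ‖η‖)))
    (ω.hasSum_one.summable.mul_right _) (fun i => (hw _ _).const_mul _)
    (Eventually.of_forall fun n i => ?_)
  rw [norm_mul, Complex.norm_real, Real.norm_of_nonneg (ω.pos i).le]
  refine mul_le_mul_of_nonneg_left ((norm_inner_le_norm _ _).trans ?_) (ω.pos i).le
  rw [h.norm_apply]
  gcongr
  rw [← h.norm_apply i η]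
  exact (w n).le_of_opNorm_le (hM n) _

theorem map_triple (h : IsConvexCompression ω l τ) {A B C : K →L[ℂ] K}
    (hABC : IsPositiveTriple A B C) : IsPositiveTriple (τ A) (τ B) (τ C) := by
  intro ξ η
  have h1 := ((h.hasSum_re_inner A ξ ξ).add ((h.hasSum_re_inner B ξ η).mul_left 2)).add
    (h.hasSum_re_inner C η η)
  refine h1.nonneg fun i => ?_
  have h2 := mul_nonneg (ω.pos i).le (hABC (l i ξ) (l i η))
  linarith

/-- Jensen's inequality. With `u = τ(a)ξ + τ(c)η` and `vᵢ = a lᵢξ + c lᵢη`, one has `‖u‖² = ∑ ωᵢ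
Re⟨lᵢu, vᵢ⟩`. Use `2 Re⟨lᵢu, vᵢ⟩ ≤ ‖u‖² + ‖vᵢ‖²` and `∑ ωᵢ = 1`. -/
theorem norm_sum_apply_sq_le (h : IsConvexCompression ω l τ) (a c : K →L[ℂ] K) (ξ η : K) {s : ℝ}
    (hs : HasSum (fun i => ω.val i * ‖a (l i ξ) + c (l i η)‖ ^ 2) s) :
    ‖τ a ξ + τ c η‖ ^ 2 ≤ s := by
  set u := τ a ξ + τ c η with hu
  have h1 := (h.hasSum_re_inner a u ξ).add (h.hasSum_re_inner c u η)
  rw [← Complex.add_re, ← inner_add_right, ← hu] at h1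
  have h2 : (inner ℂ u u).re = ‖u‖ ^ 2 := inner_self_eq_norm_sq (𝕜 := ℂ) u
  rw [h2] at h1
  have h3 := (ω.hasSum_one.mul_right (‖u‖ ^ 2)).add hs
  have h4 := hasSum_le (fun i => ?_) (h1.mul_left 2) h3
  · linarith
  · rw [← mul_add, ← Complex.add_re, ← inner_add_right, ← mul_add, ← h.norm_apply i u]
    have h5 : (inner ℂ (l i u) (a (l i ξ) + c (l i η))).re ≤
        ‖l i u‖ * ‖a (l i ξ) + c (l i η)‖ := re_inner_le_norm (𝕜 := ℂ) _ _
    have h6 : 2 * (inner ℂ (l i u) (a (l i ξ) + c (l i η))).re ≤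
        ‖l i u‖ ^ 2 + ‖a (l i ξ) + c (l i η)‖ ^ 2 := by
      nlinarith [sq_nonneg (‖l i u‖ - ‖a (l i ξ) + c (l i η)‖)]
    calc 2 * (ω.val i * _) = ω.val i * (2 * _) := by ring
      _ ≤ _ := mul_le_mul_of_nonneg_left h6 (ω.pos i).le

theorem re_inner_star_mul (a c : K →L[ℂ] K) (ξ η : K) :
    (inner ℂ ξ ((star a * c) η)).re = (inner ℂ (a ξ) (c η)).re := by
  rw [mul_apply_eq_comp, ContinuousLinearMap.star_eq_adjoint,
    ContinuousLinearMap.adjoint_inner_right]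

theorem norm_add_apply_sq (a c : K →L[ℂ] K) (ξ η : K) :
    ‖a ξ + c η‖ ^ 2 = (inner ℂ ξ ((star a * a) ξ)).re + 2 * (inner ℂ ξ ((star a * c) η)).re +
      (inner ℂ η ((star c * c) η)).re := by
  have h1 := norm_add_sq (𝕜 := ℂ) (a ξ) (c η)
  rw [h1, re_inner_star_mul, re_inner_star_mul, re_inner_star_mul]
  have h2 : ∀ v : K, (inner ℂ v v).re = ‖v‖ ^ 2 := fun v => inner_self_eq_norm_sq (𝕜 := ℂ) v
  rw [h2, h2]
  rfl

theorem schwarz (h : IsConvexCompression ω l τ) (a c : K →L[ℂ] K) :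
    IsPositiveTriple (τ (star a * a) - star (τ a) * τ a)
      (τ (star a * c) - star (τ a) * τ c) (τ (star c * c) - star (τ c) * τ c) := by
  intro ξ η
  have h1 := ((h.hasSum_re_inner (star a * a) ξ ξ).add
    ((h.hasSum_re_inner (star a * c) ξ η).mul_left 2)).add (h.hasSum_re_inner (star c * c) η η)
  have h2 := h.norm_sum_apply_sq_le a c ξ η (h1.congr_fun fun i => by
    rw [norm_add_apply_sq]; ring)
  rw [norm_add_apply_sq] at h2
  simp only [sub_apply, inner_sub_right, Complex.sub_re]
  linarith

theorem isSchwarzMap (h : IsConvexCompression ω l τ) : IsSchwarzMap τ where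
  map_one := h.map_one
  map_star := h.map_star
  norm_le := h.norm_apply_le
  normal := h.weakTendsto_map
  map_triple _ _ _ := h.map_triple
  schwarz := h.schwarz

end IsConvexCompression

end ConvexCompression

/-! ### Shifts on words -/

section HilbertBasis

set_option linter.unusedSectionVars false

variable {ι : Type*} {K : Type*} [NormedAddCommGroup K] [InnerProductSpace ℂ K] [CompleteSpace K]

theorem HilbertBasis.clm_ext {Y : Type*} [NormedAddCommGroup Y] [NormedSpace ℂ Y]
    (e : HilbertBasis ι ℂ K) {A B : K →L[ℂ] Y} (h : ∀ i, A (e i) = B (e i)) : A = B :=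
  ContinuousLinearMap.ext_on (Submodule.dense_iff_topologicalClosure_eq_top.2 e.dense_span)
    (by rintro _ ⟨i, rfl⟩; exact h i)

theorem HilbertBasis.ext_inner (e : HilbertBasis ι ℂ K) {x y : K}
    (h : ∀ i, inner ℂ (e i) x = inner ℂ (e i) y) : x = y := by
  apply e.repr.injective
  ext i
  rw [e.repr_apply_apply, e.repr_apply_apply, h]

theorem HilbertBasis.exists_isometry (e : HilbertBasis ι ℂ K) {v : ι → K}
    (hv : Orthonormal ℂ v) : ∃ V : K →L[ℂ] K, (∀ i, V (e i) = v i) ∧ star V * V = 1 := by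
  classical
  refine ⟨((hv.orthogonalFamily.linearIsometry).comp
    e.repr.toLinearIsometry).toContinuousLinearMap, fun i => ?_, ?_⟩
  · change hv.orthogonalFamily.linearIsometry (e.repr (e i)) = v i
    rw [e.repr_self, OrthogonalFamily.linearIsometry_apply_single]
    simp
  · exact (ContinuousLinearMap.norm_map_iff_adjoint_comp_self _).1
      fun η => LinearIsometry.norm_map _ η

end HilbertBasis

section WordShift

set_option linter.unusedSectionVars false

variable {Θ : Type v} {K : Type u} [NormedAddCommGroup K] [InnerProductSpace ℂ K] [CompleteSpace K]
  {l : Θ → K →L[ℂ] K} {e : HilbertBasis (List Θ) ℂ K}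

/-- The operators `lᵢ` prepend letters to the words which label an orthonormal basis. -/
def IsWordShift (l : Θ → K →L[ℂ] K) (e : HilbertBasis (List Θ) ℂ K) : Prop :=
  ∀ i w, l i (e w) = e (i :: w)

/-- The projection onto the basis vector of the empty word. -/
noncomputable def emptyProj (e : HilbertBasis (List Θ) ℂ K) : K →L[ℂ] K :=
  (innerSL ℂ (e [])).smulRight (e [])

theorem emptyProj_apply (e : HilbertBasis (List Θ) ℂ K) (x : K) :
    emptyProj e x = inner ℂ (e []) x • e [] := rfl

theorem HilbertBasis.inner_eq_ite [DecidableEq Θ] (e : HilbertBasis (List Θ) ℂ K) (w w' : List Θ) :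
    inner ℂ (e w) (e w') = if w = w' then 1 else 0 :=
  orthonormal_iff_ite.1 e.orthonormal w w'

theorem emptyProj_nil (e : HilbertBasis (List Θ) ℂ K) : emptyProj e (e []) = e [] := by
  classical
  rw [emptyProj_apply, e.inner_eq_ite, if_pos rfl, one_smul]

theorem emptyProj_of_ne (e : HilbertBasis (List Θ) ℂ K) {w : List Θ} (hw : w ≠ []) :
    emptyProj e (e w) = 0 := by
  classical
  rw [emptyProj_apply, e.inner_eq_ite, if_neg hw.symm, zero_smul]

namespace IsWordShift

theorem star_apply_nil (hl : IsWordShift l e) (i : Θ) : star (l i) (e []) = 0 := by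
  classical
  refine e.ext_inner fun w => ?_
  rw [ContinuousLinearMap.star_eq_adjoint, ContinuousLinearMap.adjoint_inner_right, hl,
    e.inner_eq_ite, inner_zero_right, if_neg (List.cons_ne_nil _ _)]

theorem star_apply_cons [DecidableEq Θ] (hl : IsWordShift l e) (i j : Θ) (w : List Θ) :
    star (l i) (e (j :: w)) = if i = j then e w else 0 := by
  refine e.ext_inner fun w' => ?_
  rw [ContinuousLinearMap.star_eq_adjoint, ContinuousLinearMap.adjoint_inner_right, hl,
    e.inner_eq_ite]
  by_cases hij : i = j
  · rw [if_pos hij, e.inner_eq_ite, hij]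
    simp
  · rw [if_neg hij, inner_zero_right, if_neg]
    simp [hij]

theorem star_mul_emptyProj (hl : IsWordShift l e) (i : Θ) : star (l i) * emptyProj e = 0 := by
  refine e.clm_ext fun w => ?_
  rw [mul_apply_eq_comp, emptyProj_apply, map_smul, hl.star_apply_nil, smul_zero, zero_apply]

theorem emptyProj_mul (hl : IsWordShift l e) (i : Θ) : emptyProj e * l i = 0 := by
  refine e.clm_ext fun w => ?_
  rw [mul_apply_eq_comp, hl, emptyProj_of_ne e (List.cons_ne_nil _ _), zero_apply]

/-- The operator which appends a letter. -/
theorem exists_append (e : HilbertBasis (List Θ) ℂ K) (j : Θ) :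
    ∃ r : K →L[ℂ] K, ∀ w, r (e w) = e (w ++ [j]) := by
  obtain ⟨r, hr, -⟩ := e.exists_isometry (v := fun w => e (w ++ [j]))
    (e.orthonormal.comp _ fun w w' h => List.append_cancel_right h)
  exact ⟨r, hr⟩

/-- The gauge unitaries. -/
theorem exists_gauge (e : HilbertBasis (List Θ) ℂ K) {c : ℂ} (hc : ‖c‖ = 1) :
    ∃ U : K →L[ℂ] K, (∀ w, U (e w) = c ^ w.length • e w) ∧ star U * U = 1 := by
  classical
  refine e.exists_isometry ?_
  rw [orthonormal_iff_ite]
  intro w w'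
  rw [inner_smul_left, inner_smul_right, e.inner_eq_ite]
  split_ifs with h
  · rw [h, mul_one, Complex.conj_mul', norm_pow, hc]
    simp
  · simp

section Append

variable {j : Θ} {r : K →L[ℂ] K} (hr : ∀ w, r (e w) = e (w ++ [j]))
include hr

theorem append_comm (hl : IsWordShift l e) (i : Θ) : l i * r = r * l i := by
  refine e.clm_ext fun w => ?_
  simp only [mul_apply_eq_comp, hr, hl i _, List.cons_append]

/-- Removing the first letter commutes with appending a last one, except on the empty word, where
the appended letter is itself the first. -/
theorem star_mul_append [DecidableEq Θ] (hl : IsWordShift l e) (i : Θ) :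
    star (l i) * r = r * star (l i) + if i = j then emptyProj e else 0 := by
  refine e.clm_ext fun w => ?_
  cases w with
  | nil =>
    simp only [mul_apply_eq_comp, hr, add_apply, hl.star_apply_nil, map_zero, zero_add,
      List.nil_append, hl.star_apply_cons]
    split_ifs
    · rw [emptyProj_nil]
    · rfl
  | cons k w =>
    simp only [mul_apply_eq_comp, hr, add_apply, List.cons_append, hl.star_apply_cons]
    have h0 : (if i = j then emptyProj e else 0) (e (k :: w)) = 0 := by
      split_ifs
      · exact emptyProj_of_ne e (List.cons_ne_nil _ _)
      · rfl
    rw [h0, add_zero]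
    split_ifs
    · rw [hr]
    · rw [map_zero]

theorem inner_nil_append (x : K) : inner ℂ (e []) (r x) = 0 := by
  classical
  have h : (innerSL ℂ (e [])).comp r = 0 := by
    refine e.clm_ext fun w => ?_
    change inner ℂ (e []) (r (e w)) = 0
    rw [hr, e.inner_eq_ite, if_neg (by simp)]
  exact DFunLike.congr_fun h x

end Append

section Gauge

variable {c : ℂ} {U : K →L[ℂ] K} (hU : ∀ w, U (e w) = c ^ w.length • e w)
include hU

theorem gauge_mul (hl : IsWordShift l e) (i : Θ) : U * l i = c • (l i * U) := by
  refine e.clm_ext fun w => ?_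
  simp only [mul_apply_eq_comp, hU, hl i _, smul_apply, map_smul, List.length_cons, smul_smul,
    pow_succ']

theorem gauge_append {j : Θ} {r : K →L[ℂ] K} (hr : ∀ w, r (e w) = e (w ++ [j])) :
    U * r = c • (r * U) := by
  refine e.clm_ext fun w => ?_
  simp only [mul_apply_eq_comp, hU, hr, smul_apply, map_smul, List.length_append,
    List.length_singleton, smul_smul, pow_succ']

theorem gauge_star_apply (hc : ‖c‖ = 1) (hUU : star U * U = 1) (w : List Θ) :
    star U (e w) = star c ^ w.length • e w := by
  have h2 : star c ^ w.length * c ^ w.length = 1 := by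
    rw [← mul_pow, Complex.star_def, Complex.conj_mul', hc]
    simp
  have h3 : star U (U (e w)) = e w := DFunLike.congr_fun hUU (e w)
  rw [hU, map_smul] at h3
  calc star U (e w) = (star c ^ w.length * c ^ w.length) • star U (e w) := by rw [h2, one_smul]
    _ = star c ^ w.length • e w := by rw [mul_smul, h3]

end Gauge

end IsWordShift

end WordShift

/-! ### Operators that commute with the append operators up to a phase -/

section Rigidity

variable {Θ : Type v} {K : Type u} [NormedAddCommGroup K] [InnerProductSpace ℂ K] [CompleteSpace K]
  {ω : PositiveWeights Θ} {l : Θ → K →L[ℂ] K} {τ : (K →L[ℂ] K) →L[ℂ] (K →L[ℂ] K)}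
  {e : HilbertBasis (List Θ) ℂ K}
  {m : peripheralBoundary τ →L[ℂ] peripheralBoundary τ →L[ℂ] peripheralBoundary τ}

theorem PositiveWeights.val_lt_one [Nontrivial Θ] (ω : PositiveWeights Θ) (i : Θ) :
    ω.val i < 1 := by
  classical
  obtain ⟨j, hj⟩ := exists_ne i
  have h := sum_le_hasSum {i, j} (fun k _ => (ω.pos k).le) ω.hasSum_one
  rw [Finset.sum_pair hj.symm] at h
  linarith [ω.pos j]

/-- A function on words which is scaled by weights less than one under rotation of a letter
vanishes on nonempty words. -/
theorem eq_zero_of_rotate [Nontrivial Θ] (ω : PositiveWeights Θ) {F : List Θ → ℝ}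
    (hF : ∀ j w, F (w ++ [j]) = ω.val j * F (j :: w)) {w : List Θ} (hw : w ≠ []) : F w = 0 := by
  have hrot : ∀ u v : List Θ, F (v ++ u) = (u.map ω.val).prod * F (u ++ v) := by
    intro u
    induction u using List.reverseRecOn with
    | nil => intro v; simp
    | append_singleton u j ih =>
      intro v
      rw [← List.append_assoc, hF, ← List.cons_append, ih (j :: v)]
      simp [List.append_assoc]
      ring
  -- Rotating every letter of `w` returns `w` itself, multiplied by the product of its weights,
  -- which is less than one.
  have h1 := hrot w []
  rw [List.nil_append, List.append_nil] at h1
  have hlt : ∀ u : List Θ, 0 ≤ (u.map ω.val).prod ∧ (u.map ω.val).prod ≤ 1 := by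
    intro u
    induction u with
    | nil => simp
    | cons i u ih =>
      rw [List.map_cons, List.prod_cons]
      exact ⟨mul_nonneg (ω.pos i).le ih.1,
        mul_le_one₀ (ω.val_lt_one i).le ih.1 ih.2⟩
  have h2 : (w.map ω.val).prod < 1 := by
    cases w with
    | nil => exact absurd rfl hw
    | cons i u =>
      rw [List.map_cons, List.prod_cons]
      exact (mul_le_of_le_one_right (ω.pos i).le (hlt u).2).trans_lt (ω.val_lt_one i)
  by_contra hne
  exact h2.ne' (mul_right_cancel₀ hne (by rw [one_mul]; exact h1))

/-- The normalised sequence is constant from `n = 1` on, so the product can be read off after one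
application of `τ`. -/
theorem IsEigenProduct.eq_of_map (hm : IsEigenProduct τ m) {c d : ℂ}
    (hc : ‖c‖ = 1) (hd : ‖d‖ = 1) {x y : peripheralBoundary τ} (hx : τ x = c • (x : K →L[ℂ] K))
    (hy : τ y = d • (y : K →L[ℂ] K)) {z : K →L[ℂ] K}
    (hxy : τ ((x : K →L[ℂ] K) * (y : K →L[ℂ] K)) = (c * d) • z) (hz : τ z = (c * d) • z) :
    (m x y : K →L[ℂ] K) = z := by
  have hcd : c * d ≠ 0 := norm_ne_zero_iff.1 (by rw [norm_mul, hc, hd]; norm_num)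
  refine WeakTendsto.unique (WeakTendsto.of_apply (hm c d hc hd x y hx hy)) (WeakTendsto.of_apply
    fun η => tendsto_const_nhds.congr' ?_)
  filter_upwards [eventually_ge_atTop 1] with n hn
  obtain ⟨k, rfl⟩ := Nat.exists_eq_add_of_le' hn
  rw [pow_succ τ, mul_apply_eq_comp, hxy, map_smul, IsSchwarzMap.pow_apply_eigen hz, smul_smul,
    smul_smul, mul_assoc, ← pow_succ', inv_mul_cancel₀ (pow_ne_zero _ hcd), one_smul]

namespace IsConvexCompression

theorem map_mul_append (h : IsConvexCompression ω l τ) (hl : IsWordShift l e) {j : Θ}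
    {r : K →L[ℂ] K} (hr : ∀ w, r (e w) = e (w ++ [j])) (x : K →L[ℂ] K) :
    τ (x * r) = τ x * r := by
  refine (h.hasSum (x * r)).unique (((h.hasSum x).mul_right r).congr_fun fun i => ?_)
  rw [smul_mul_assoc, mul_assoc _ (l i) r, hl.append_comm hr i]
  simp only [mul_assoc]

/-- The correction term comes from the vacuum defect in `star_mul_append`, which occurs only in the
summand `i = j`. -/
theorem map_append_mul (h : IsConvexCompression ω l τ) (hl : IsWordShift l e) {j : Θ}
    {r : K →L[ℂ] K} (hr : ∀ w, r (e w) = e (w ++ [j])) (y : K →L[ℂ] K) :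
    τ (r * y) = r * τ y + (ω.val j : ℂ) • (emptyProj e * y * l j) := by
  classical
  have h1 := hasSum_ite_eq j ((ω.val j : ℂ) • (emptyProj e * y * l j))
  refine (h.hasSum (r * y)).unique ((((h.hasSum y).mul_left r).add h1).congr_fun fun i => ?_)
  rw [← mul_assoc, hl.star_mul_append hr i, add_mul, add_mul, smul_add, mul_smul_comm]
  simp only [mul_assoc]
  congr 1
  split_ifs with hij
  · rw [hij]
  · rw [zero_mul, smul_zero]

theorem map_emptyProj_mul (h : IsConvexCompression ω l τ) (hl : IsWordShift l e)
    (y : K →L[ℂ] K) : τ (emptyProj e * y) = 0 := by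
  refine (h.hasSum _).unique (hasSum_zero.congr_fun fun i => ?_)
  rw [← mul_assoc, hl.star_mul_emptyProj, zero_mul, zero_mul, smul_zero]

theorem map_append (h : IsConvexCompression ω l τ) (hl : IsWordShift l e) {j : Θ}
    {r : K →L[ℂ] K} (hr : ∀ w, r (e w) = e (w ++ [j])) : τ r = r := by
  have h1 := h.map_mul_append hl hr 1
  rwa [h.map_one, one_mul] at h1

theorem map_mul_gauge (h : IsConvexCompression ω l τ) (hl : IsWordShift l e) {c : ℂ}
    {U : K →L[ℂ] K} (hU : ∀ w, U (e w) = c ^ w.length • e w) (x : K →L[ℂ] K) :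
    τ (x * U) = c • (τ x * U) := by
  refine (h.hasSum (x * U)).unique ((((h.hasSum x).mul_right U).const_smul c).congr_fun fun i => ?_)
  have h1 := congrArg (fun z => star (l i) * x * z) (hl.gauge_mul hU i)
  simp only [mul_smul_comm] at h1
  rw [smul_mul_assoc, smul_comm c, mul_assoc _ (l i) U, ← h1]
  simp only [mul_assoc]

theorem map_gauge (h : IsConvexCompression ω l τ) (hl : IsWordShift l e) {c : ℂ}
    {U : K →L[ℂ] K} (hU : ∀ w, U (e w) = c ^ w.length • e w) : τ U = c • U := by
  have h1 := h.map_mul_gauge hl hU 1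
  rwa [h.map_one, one_mul] at h1

/-- Evaluate the relation at `e w` and pair with the vacuum. The range of `r j` is orthogonal to it,
so only the correction term remains, and the absolute values satisfy the rotation identity of
`eq_zero_of_rotate`. -/
theorem inner_star_nil_eq_zero [Nontrivial Θ] {c : ℂ} (hc : ‖c‖ = 1) (hl : IsWordShift l e)
    {r : Θ → K →L[ℂ] K} (hr : ∀ j w, r j (e w) = e (w ++ [j])) {y : K →L[ℂ] K}
    (hy : ∀ j, y * r j = c • (r j * y + (ω.val j : ℂ) • (emptyProj e * y * l j)))
    {w : List Θ} (hw : w ≠ []) : inner ℂ (e []) (y (e w)) = 0 := by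
  classical
  rw [← norm_eq_zero]
  refine eq_zero_of_rotate ω (F := fun w => ‖inner ℂ (e []) (y (e w))‖) (fun j w => ?_) hw
  have h1 := DFunLike.congr_fun (hy j) (e w)
  simp only [mul_apply_eq_comp, hr, smul_apply, add_apply, hl j _, emptyProj_apply] at h1
  rw [h1, inner_smul_right, inner_add_right, IsWordShift.inner_nil_append (hr j), zero_add,
    inner_smul_right, inner_smul_right, e.inner_eq_ite, if_pos rfl, mul_one, norm_mul, hc, one_mul,
    norm_mul, Complex.norm_real, Real.norm_of_nonneg (ω.pos j).le]

/-- The relations for `y` and `star y` clear the vacuum row and column off the diagonal. The vacuum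
entry `a` is the weighted average of the one-letter diagonal entries, all equal to `ca`, so it
vanishes too. Without a vacuum row the correction term is zero, and `y r_j = c r_j y` propagates `y
e_∅ = 0` to all words. -/
theorem eq_zero_of_twisted [Nontrivial Θ] (h : IsConvexCompression ω l τ) (hl : IsWordShift l e)
    {c : ℂ} (hc : ‖c‖ = 1) (hc1 : c ≠ 1) {r : Θ → K →L[ℂ] K}
    (hr : ∀ j w, r j (e w) = e (w ++ [j])) {y : K →L[ℂ] K} (hτy : τ y = y)
    (hy : ∀ j, y * r j = c • (r j * y + (ω.val j : ℂ) • (emptyProj e * y * l j)))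
    (hy' : ∀ j, star y * r j =
      star c • (r j * star y + (ω.val j : ℂ) • (emptyProj e * star y * l j))) : y = 0 := by
  classical
  have h1 : ∀ w ≠ [], inner ℂ (e []) (y (e w)) = 0 := fun w hw =>
    inner_star_nil_eq_zero hc hl hr hy hw
  have h2 : ∀ w ≠ [], inner ℂ (e w) (y (e [])) = 0 := fun w hw => by
    have h3 := inner_star_nil_eq_zero (by rwa [norm_star]) hl hr hy' hw
    rw [ContinuousLinearMap.star_eq_adjoint, ContinuousLinearMap.adjoint_inner_right] at h3
    rw [← inner_conj_symm, h3, map_zero]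
  set a := inner ℂ (e []) (y (e [])) with ha
  have h3 : y (e []) = a • e [] := by
    refine e.ext_inner fun w => ?_
    rw [inner_smul_right, e.inner_eq_ite]
    split_ifs with hw
    · rw [hw, mul_one]
    · rw [h2 w hw, mul_zero]
  have h4 : ∀ i, y (e [i]) = (c * a) • e [i] := fun i => by
    have h5 := DFunLike.congr_fun (hy i) (e [])
    simp only [mul_apply_eq_comp, hr, smul_apply, add_apply, hl i _, emptyProj_apply,
      List.nil_append, h3, map_smul] at h5
    rw [h5, h1 [i] (List.cons_ne_nil _ _), zero_smul, smul_zero, add_zero, smul_smul]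
  have h5 : a = 0 := by
    have h6 := h.hasSum_inner y (e []) (e [])
    rw [hτy, ← ha] at h6
    have h7 : ∀ i, (ω.val i : ℂ) * inner ℂ (l i (e [])) (y (l i (e []))) = ω.val i * (c * a) :=
      fun i => by
        rw [hl i, h4, inner_smul_right, e.inner_eq_ite, if_pos rfl, mul_one]
    simp only [h7] at h6
    have h8 := h6.unique ((Complex.hasSum_ofReal.2 ω.hasSum_one).mul_right (c * a))
    rw [Complex.ofReal_one, one_mul] at h8
    have h9 : (1 - c) * a = 0 := by rw [sub_mul, one_mul, ← h8, sub_self]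
    exact (mul_eq_zero.1 h9).resolve_left (sub_ne_zero.2 hc1.symm)
  have h6 : ∀ x, inner ℂ (e []) (y x) = 0 := by
    have : (innerSL ℂ (e [])).comp y = 0 := by
      refine e.clm_ext fun w => ?_
      change inner ℂ (e []) (y (e w)) = 0
      by_cases hw : w = []
      · rw [hw, ← ha, h5]
      · exact h1 w hw
    exact fun x => DFunLike.congr_fun this x
  refine e.clm_ext fun w => ?_
  rw [zero_apply]
  induction w using List.reverseRecOn with
  | nil => rw [h3, h5, zero_smul]
  | append_singleton w j ih =>
    have h7 := DFunLike.congr_fun (hy j) (e w)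
    simp only [mul_apply_eq_comp, hr, smul_apply, add_apply, emptyProj_apply, h6, ih, map_zero,
      zero_smul, smul_zero, add_zero] at h7
    exact h7

end IsConvexCompression

end Rigidity

/-! ### Conditional expectations onto the Poisson boundary -/

section Rigidity

variable {Θ : Type v} {K : Type u} [NormedAddCommGroup K] [InnerProductSpace ℂ K] [CompleteSpace K]
  {ω : PositiveWeights Θ} {l : Θ → K →L[ℂ] K} {τ : (K →L[ℂ] K) →L[ℂ] (K →L[ℂ] K)}
  {e : HilbertBasis (List Θ) ℂ K}
  {m : peripheralBoundary τ →L[ℂ] peripheralBoundary τ →L[ℂ] peripheralBoundary τ}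
  {E : peripheralBoundary τ →ₗ[ℂ] poissonBoundary τ}

namespace IsSchwarzMap

theorem condExp_product_left (hτ : IsSchwarzMap τ) (hm : IsEigenProduct τ m)
    (hE : (hτ.starProduct m).IsConditionalExpectation (poissonBoundary τ)
      (hτ.isCStarSubalgebra hm) E) (a : poissonBoundary τ) (x : peripheralBoundary τ) :
    (E (m a x) : peripheralBoundary τ) = m a (E x) := by
  have h := congrArg Subtype.val
    (hE.map_bimodule a ⟨_, (hτ.isCStarSubalgebra hm).unit_mem⟩ x)
  simp only [StarProduct.restrict, starProduct_mul, hτ.product_unit hm] at h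
  exact h

theorem condExp_product_right (hτ : IsSchwarzMap τ) (hm : IsEigenProduct τ m)
    (hE : (hτ.starProduct m).IsConditionalExpectation (poissonBoundary τ)
      (hτ.isCStarSubalgebra hm) E) (a : poissonBoundary τ) (x : peripheralBoundary τ) :
    (E (m x a) : peripheralBoundary τ) = m (E x) a := by
  have h := congrArg Subtype.val
    (hE.map_bimodule ⟨_, (hτ.isCStarSubalgebra hm).unit_mem⟩ a x)
  simp only [StarProduct.restrict, starProduct_mul, hτ.unit_product hm] at h
  exact h

end IsSchwarzMap

namespace IsConvexCompression

theorem product_append (h : IsConvexCompression ω l τ) (hl : IsWordShift l e)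
    (hm : IsEigenProduct τ m) {j : Θ} {R : peripheralBoundary τ}
    (hR : ∀ w, (R : K →L[ℂ] K) (e w) = e (w ++ [j])) {c : ℂ} (hc : ‖c‖ = 1)
    {y : peripheralBoundary τ} (hy : τ y = c • (y : K →L[ℂ] K)) :
    (m y R : K →L[ℂ] K) = (y : K →L[ℂ] K) * (R : K →L[ℂ] K) := by
  have h1 : τ ((y : K →L[ℂ] K) * (R : K →L[ℂ] K)) =
      (c * 1) • ((y : K →L[ℂ] K) * (R : K →L[ℂ] K)) := by
    rw [h.map_mul_append hl hR, hy, smul_mul_assoc, mul_one]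
  exact hm.eq_of_map hc norm_one hy (by rw [one_smul]; exact h.map_append hl hR) h1 h1

/-- Here the correction term disappears: `U` moves past `l j` up to a scalar, and the vacuum
projection annihilates the range of `l j`. -/
theorem append_product_gauge (h : IsConvexCompression ω l τ) (hl : IsWordShift l e)
    (hm : IsEigenProduct τ m) {j : Θ} {R : peripheralBoundary τ}
    (hR : ∀ w, (R : K →L[ℂ] K) (e w) = e (w ++ [j])) {c : ℂ} (hc : ‖c‖ = 1)
    {U : peripheralBoundary τ} (hU : ∀ w, (U : K →L[ℂ] K) (e w) = c ^ w.length • e w) :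
    (m R U : K →L[ℂ] K) = (R : K →L[ℂ] K) * (U : K →L[ℂ] K) := by
  have h1 : τ ((R : K →L[ℂ] K) * (U : K →L[ℂ] K)) =
      (1 * c) • ((R : K →L[ℂ] K) * (U : K →L[ℂ] K)) := by
    rw [h.map_append_mul hl hR, h.map_gauge hl hU, mul_assoc, hl.gauge_mul hU, mul_smul_comm,
      mul_smul_comm, ← mul_assoc, hl.emptyProj_mul, zero_mul, smul_zero, smul_zero, add_zero,
      one_mul]
  exact hm.eq_of_map norm_one hc (by rw [one_smul]; exact h.map_append hl hR)
    (h.map_gauge hl hU) h1 h1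

/-- The sequence `τⁿ(R y)` stabilises after one step, because `τ` kills the correction term. -/
theorem append_product (h : IsConvexCompression ω l τ) (hl : IsWordShift l e)
    (hm : IsEigenProduct τ m) {j : Θ} {R : peripheralBoundary τ}
    (hR : ∀ w, (R : K →L[ℂ] K) (e w) = e (w ++ [j])) {y : peripheralBoundary τ}
    (hy : τ y = (y : K →L[ℂ] K)) :
    (m R y : K →L[ℂ] K) = (R : K →L[ℂ] K) * (y : K →L[ℂ] K) +
      (ω.val j : ℂ) • (emptyProj e * (y : K →L[ℂ] K) * l j) := by
  have h1 := h.map_append_mul hl hR (y : K →L[ℂ] K)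
  rw [hy] at h1
  have h2 : τ ((R : K →L[ℂ] K) * (y : K →L[ℂ] K) +
      (ω.val j : ℂ) • (emptyProj e * (y : K →L[ℂ] K) * l j)) =
      (R : K →L[ℂ] K) * (y : K →L[ℂ] K) +
      (ω.val j : ℂ) • (emptyProj e * (y : K →L[ℂ] K) * l j) := by
    rw [map_add, map_smul, mul_assoc (emptyProj e), h.map_emptyProj_mul hl, smul_zero, add_zero,
      h1, mul_assoc (emptyProj e)]
  exact hm.eq_of_map norm_one norm_one (by rw [one_smul]; exact h.map_append hl hR)
    (by rw [one_smul]; exact hy) (by rw [mul_one, one_smul]; exact h1)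
    (by rw [mul_one, one_smul]; exact h2)

theorem gauge_product_append (h : IsConvexCompression ω l τ) (hl : IsWordShift l e)
    (hm : IsEigenProduct τ m) {j : Θ} {R : peripheralBoundary τ}
    (hR : ∀ w, (R : K →L[ℂ] K) (e w) = e (w ++ [j])) {c : ℂ} (hc : ‖c‖ = 1)
    {U : peripheralBoundary τ} (hU : ∀ w, (U : K →L[ℂ] K) (e w) = c ^ w.length • e w) :
    m U R = c • m R U := by
  refine Subtype.ext ?_
  rw [Submodule.coe_smul, h.product_append hl hm hR hc (h.map_gauge hl hU),
    h.append_product_gauge hl hm hR hc hU, IsWordShift.gauge_append hU hR]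

/-- The append operators lie in the Poisson boundary, so the relation `U ∘ R = c (R ∘ U)` survives
under `E`. Written with operator products it becomes the twisted relation of `eq_zero_of_twisted`.
-/
theorem condExp_gauge [Nontrivial Θ] (h : IsConvexCompression ω l τ) (hl : IsWordShift l e)
    (hm : IsEigenProduct τ m)
    (hE : (h.isSchwarzMap.starProduct m).IsConditionalExpectation (poissonBoundary τ)
      (h.isSchwarzMap.isCStarSubalgebra hm) E) {c : ℂ} (hc : ‖c‖ = 1) (hc1 : c ≠ 1)
    {U : peripheralBoundary τ} (hU : ∀ w, (U : K →L[ℂ] K) (e w) = c ^ w.length • e w)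
    (hU' : ∀ w, star (U : K →L[ℂ] K) (e w) = star c ^ w.length • e w) : E U = 0 := by
  have hτ := h.isSchwarzMap
  have hA := hτ.isUnitalCStarAlgebra hm
  choose r hr using fun j => IsWordShift.exists_append e j
  let R : Θ → poissonBoundary τ := fun j =>
    ⟨⟨r j, mem_peripheralBoundary_of_fixed τ (h.map_append hl (hr j))⟩, h.map_append hl (hr j)⟩
  have hR : ∀ j w, ((R j : peripheralBoundary τ) : K →L[ℂ] K) (e w) = e (w ++ [j]) := hr
  have h1 : ∀ j, m (E U) (R j) = c • m (R j) (E U) := fun j => by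
    rw [← hτ.condExp_product_left hm hE, ← hτ.condExp_product_right hm hE,
      h.gauge_product_append hl hm (hR j) hc hU, map_smul, Submodule.coe_smul]
  -- The relation for the adjoint of `E U` is obtained from the bimodule property with `R*`, so that
  -- `E` need not be known to preserve adjoints.
  have h2 : ∀ j, m ((hτ.starProduct m).adj (R j)) U = c • m U ((hτ.starProduct m).adj (R j)) :=
    fun j => by
      have h3 := congrArg (hτ.starProduct m).adj (h.gauge_product_append hl hm (hR j)
        (by rwa [norm_star]) (U := (hτ.starProduct m).adj U) hU')
      rw [hA.adj_smul, hτ.adj_product hm, hτ.adj_product hm, hA.adj_adj] at h3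
      rwa [← Complex.star_def, star_star] at h3
  have h4 : ∀ j, m ((hτ.starProduct m).adj (E U)) (R j) =
      star c • m (R j) ((hτ.starProduct m).adj (E U)) := fun j => by
    let S : poissonBoundary τ := ⟨_, (hτ.isCStarSubalgebra hm).adj_mem (R j).2⟩
    have h5 : m S (E U) = c • m (E U) S := by
      rw [← hτ.condExp_product_left hm hE, ← hτ.condExp_product_right hm hE, ← Submodule.coe_smul,
        ← map_smul]
      exact congrArg (fun x => (E x : peripheralBoundary τ)) (h2 j)
    have h6 := congrArg (hτ.starProduct m).adj h5
    rw [hA.adj_smul, hτ.adj_product hm, hτ.adj_product hm, hA.adj_adj] at h6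
    exact h6
  have hfix : τ (E U : peripheralBoundary τ) = ((E U : peripheralBoundary τ) : K →L[ℂ] K) := (E U).2
  have hfix' : τ ((hτ.starProduct m).adj (E U)) =
      ((hτ.starProduct m).adj (E U) : K →L[ℂ] K) := (hτ.isCStarSubalgebra hm).adj_mem (E U).2
  refine Subtype.ext (Subtype.ext ?_)
  refine h.eq_zero_of_twisted hl hc hc1 hr hfix (fun j => ?_) fun j => ?_
  · have h5 := congrArg Subtype.val (h1 j)
    rw [Submodule.coe_smul, h.product_append hl hm (hR j) norm_one (by rw [one_smul]; exact hfix),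
      h.append_product hl hm (hR j) hfix] at h5
    exact h5
  · have h5 := congrArg Subtype.val (h4 j)
    rw [Submodule.coe_smul, h.product_append hl hm (hR j) norm_one (by rw [one_smul]; exact hfix'),
      h.append_product hl hm (hR j) hfix'] at h5
    exact h5

/-- Conditional expectations onto the Poisson boundary vanish on the other peripheral
eigenspaces. -/
theorem condExp_eigen [Nontrivial Θ] (h : IsConvexCompression ω l τ) (hl : IsWordShift l e)
    (hm : IsEigenProduct τ m)
    (hE : (h.isSchwarzMap.starProduct m).IsConditionalExpectation (poissonBoundary τ)
      (h.isSchwarzMap.isCStarSubalgebra hm) E) {c : ℂ} (hc : ‖c‖ = 1) (hc1 : c ≠ 1)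
    {x : peripheralBoundary τ} (hx : τ x = c • (x : K →L[ℂ] K)) : E x = 0 := by
  have hτ := h.isSchwarzMap
  obtain ⟨U, hU, hUU⟩ := IsWordShift.exists_gauge e hc
  have hU' := IsWordShift.gauge_star_apply hU hc hUU
  have hcc : star c * c = 1 := by
    rw [Complex.star_def, Complex.conj_mul', hc]
    norm_num
  -- The gauge unitary carries the whole eigenvalue: `x = a ∘ U` with `a = x U*` fixed by `τ`.
  have ha : τ ((x : K →L[ℂ] K) * star U) = (x : K →L[ℂ] K) * star U := by
    rw [h.map_mul_gauge hl hU', hx, smul_mul_assoc, smul_smul, hcc, one_smul]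
  let a : poissonBoundary τ := ⟨⟨_, mem_peripheralBoundary_of_fixed τ ha⟩, ha⟩
  let V : peripheralBoundary τ := ⟨U, eigen_mem_peripheralBoundary hc (h.map_gauge hl hU)⟩
  have haV : m a V = x := by
    have h1 : (x : K →L[ℂ] K) * star U * U = x := by rw [mul_assoc, hUU, mul_one]
    refine Subtype.ext (hm.eq_of_map norm_one hc (x := (a : peripheralBoundary τ)) (y := V)
      (by rw [one_smul]; exact ha) (h.map_gauge hl hU) ?_ (by rw [one_mul]; exact hx))
    rw [one_mul, ← hx]
    exact congrArg τ h1
  have hV : E V = 0 := h.condExp_gauge hl hm hE hc hc1 (U := V) hU hU'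
  refine Subtype.ext ((congrArg (fun y => (E y : peripheralBoundary τ)) haV.symm).trans ?_)
  refine (hτ.condExp_product_left hm hE a V).trans ?_
  rw [hV]
  exact map_zero (m a)

/-- Two expectations agree on the fixed points and both vanish on the other eigenspaces. By
continuity `E` is the ergodic mean, whose faithfulness is known. -/
theorem isPreHilbertCStarBimodule [Nontrivial Θ] (h : IsConvexCompression ω l τ)
    (hl : IsWordShift l e) (hm : IsEigenProduct τ m)
    (hE : (h.isSchwarzMap.starProduct m).IsConditionalExpectation (poissonBoundary τ)
      (h.isSchwarzMap.isCStarSubalgebra hm) E) :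
    IsPreHilbertCStarBimodule
      ((h.isSchwarzMap.starProduct m).restrict (poissonBoundary τ)
        (h.isSchwarzMap.isCStarSubalgebra hm))
      (fun a x => (h.isSchwarzMap.starProduct m).mul a x)
      (fun x a => (h.isSchwarzMap.starProduct m).mul x a)
      (fun x y => E ((h.isSchwarzMap.starProduct m).mul x
        ((h.isSchwarzMap.starProduct m).adj y))) := by
  have hτ := h.isSchwarzMap
  obtain ⟨E₀, hE₀, hE₀n⟩ := hτ.exists_ergodic_mean
  have hE₀c := hτ.isConditionalExpectation_ergodicMean hm hE₀ hE₀n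
  have hcont : Continuous E := (E.mkContinuous 1 fun x => by
    rw [one_mul]; exact hE.norm_le x).continuous
  have heq : E = (E₀ : peripheralBoundary τ →ₗ[ℂ] poissonBoundary τ) := by
    refine LinearMap.ext fun x => ?_
    refine peripheralBoundary_induction
      (p := fun x => E x = (E₀ : peripheralBoundary τ →ₗ[ℂ] poissonBoundary τ) x)
      (isClosed_eq hcont E₀.continuous) (fun c x hc hx => ?_)
      (fun x y hx hy => by rw [map_add, map_add, hx, hy])
      (fun c x hx => by rw [map_smul, map_smul, hx]) x
    by_cases hc1 : c = 1
    · rw [hc1, one_smul] at hx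
      exact (hE.map_coe ⟨x, hx⟩).trans (hE₀c.map_coe ⟨x, hx⟩).symm
    · rw [h.condExp_eigen hl hm hE hc hc1 hx, h.condExp_eigen hl hm hE₀c hc hc1 hx]
  subst heq
  exact hτ.isPreHilbertCStarBimodule hm hE₀ hE₀c

end IsConvexCompression

end Rigidity

/-! ### The basis of the full Fock space labelled by words -/

section Fock

variable {H : Type u} [NormedAddCommGroup H] [InnerProductSpace ℂ H]

theorem inner_tensorLeft (ξ ζ : H) (n : ℕ) (η θ : (hilbertTensorPower H n).carrier) :
    inner ℂ (tensorLeft ξ n η) (tensorLeft ζ n θ) = inner ℂ ξ ζ * inner ℂ η θ :=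
  (UniformSpace.Completion.inner_coe _ _).trans (TensorProduct.inner_tmul ℂ ξ ζ η θ)

theorem leftCreation_apply_zero (ξ : H) (x : FockSpace H) : leftCreation ξ x 0 = 0 := rfl

theorem leftCreation_apply_succ (ξ : H) (x : FockSpace H) (n : ℕ) :
    leftCreation ξ x (n + 1) = tensorLeft ξ n (x n) := rfl

theorem inner_leftCreation (ξ ζ : H) (x y : FockSpace H) :
    inner ℂ (leftCreation ξ x) (leftCreation ζ y) = inner ℂ ξ ζ * inner ℂ x y := by
  refine (lp.hasSum_inner (𝕜 := ℂ) (leftCreation ξ x) (leftCreation ζ y)).unique ?_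
  have h := (lp.hasSum_inner (𝕜 := ℂ) x y).mul_left (inner ℂ ξ ζ)
  rw [← hasSum_nat_add_iff' 1]
  simp only [Finset.range_one, Finset.sum_singleton, leftCreation_apply_zero, inner_zero_left,
    sub_zero, leftCreation_apply_succ, inner_tensorLeft]
  exact h

theorem leftCreation_single (ξ : H) (n : ℕ) (η : (hilbertTensorPower H n).carrier) :
    leftCreation ξ (lp.single 2 n η) = lp.single 2 (n + 1) (tensorLeft ξ n η) := by
  have h0 : ∀ k, tensorLeft ξ k 0 = 0 := fun k => by
    rw [← norm_eq_zero, norm_tensorLeft, norm_zero, mul_zero]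
  ext k
  cases k with
  | zero => rw [leftCreation_apply_zero, lp.single_apply_ne _ _ _ (Nat.zero_ne_add_one n)]
  | succ k =>
    rw [leftCreation_apply_succ]
    by_cases hk : k = n
    · subst hk
      rw [lp.single_apply_self, lp.single_apply_self]
    · rw [lp.single_apply_ne _ _ _ hk, lp.single_apply_ne _ _ _ (by simpa using hk), h0]

/-- The vacuum vector. -/
noncomputable def vacuum (H : Type u) [NormedAddCommGroup H] [InnerProductSpace ℂ H] :
    FockSpace H :=
  lp.single 2 0 (show (hilbertTensorPower H 0).carrier from
    (EuclideanSpace.single PUnit.unit 1 : EuclideanSpace ℂ PUnit.{u + 1}))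

theorem norm_vacuum : ‖vacuum H‖ = 1 := by
  rw [vacuum, lp.norm_single (by norm_num)]
  change ‖(EuclideanSpace.single PUnit.unit 1 : EuclideanSpace ℂ PUnit.{u + 1})‖ = 1
  simp

theorem inner_vacuum_leftCreation (ξ : H) (x : FockSpace H) :
    inner ℂ (vacuum H) (leftCreation ξ x) = 0 := by
  rw [vacuum, lp.inner_single_left, leftCreation_apply_zero, inner_zero_right]

theorem apply_zero_of_inner_vacuum {x : FockSpace H} (hx : inner ℂ (vacuum H) x = 0) :
    x 0 = 0 := by
  rw [vacuum, lp.inner_single_left] at hx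
  have h : ∀ z : EuclideanSpace ℂ PUnit.{u + 1},
      inner ℂ (EuclideanSpace.single PUnit.unit (1 : ℂ)) z = 0 → z = 0 := fun z hz => by
    ext i
    rw [EuclideanSpace.inner_single_left, map_one, one_mul] at hz
    exact hz
  exact h _ hx

variable {Θ : Type v}

/-- Orthogonality spreads from basis vectors to all left factors by continuity, to the algebraic
tensor product by additivity, and to the completion by density. -/
theorem eq_zero_of_inner_tensorLeft [CompleteSpace H] (b : HilbertBasis Θ ℂ H) (n : ℕ)
    {z : (hilbertTensorPower H (n + 1)).carrier}
    (hz : ∀ i η, inner ℂ z (tensorLeft (b i) n η) = 0) : z = 0 := by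
  have h1 : ∀ ξ η, inner ℂ z (tensorLeft ξ n η) = 0 := fun ξ η => by
    let φ : H →ₗ[ℂ] ℂ :=
      { toFun := fun ξ => inner ℂ z (tensorLeft ξ n η)
        map_add' := fun ξ ζ => by
          have h : ((ξ + ζ) ⊗ₜ[ℂ] η : H ⊗[ℂ] (hilbertTensorPower H n).carrier)
              = ξ ⊗ₜ[ℂ] η + ζ ⊗ₜ[ℂ] η := TensorProduct.add_tmul ξ ζ η
          have h' : tensorLeft (ξ + ζ) n η = tensorLeft ξ n η + tensorLeft ζ n η :=
            (congrArg _ h).trans (UniformSpace.Completion.coe_add _ _)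
          rw [h', inner_add_right]
        map_smul' := fun c ξ => by
          have h : ((c • ξ) ⊗ₜ[ℂ] η : H ⊗[ℂ] (hilbertTensorPower H n).carrier)
              = c • ξ ⊗ₜ[ℂ] η := TensorProduct.smul_tmul' c ξ η
          have h' : tensorLeft (c • ξ) n η = c • tensorLeft ξ n η :=
            (congrArg _ h).trans (UniformSpace.Completion.coe_smul _ _)
          rw [h', inner_smul_right, RingHom.id_apply, smul_eq_mul] }
    let ψ : H →L[ℂ] ℂ := φ.mkContinuous (‖z‖ * ‖η‖) fun ξ => by
      refine (norm_inner_le_norm (𝕜 := ℂ) z (tensorLeft ξ n η)).trans_eq ?_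
      rw [norm_tensorLeft]
      ring
    have hψ : ψ = 0 := b.clm_ext fun i => hz i η
    exact DFunLike.congr_fun hψ ξ
  have h2 : ∀ t : H ⊗[ℂ] (hilbertTensorPower H n).carrier,
      inner ℂ z (show (hilbertTensorPower H (n + 1)).carrier from
        (t : UniformSpace.Completion (H ⊗[ℂ] (hilbertTensorPower H n).carrier))) = 0 := by
    intro t
    induction t using TensorProduct.induction_on with
    | zero =>
      exact (congrArg (inner ℂ z) (UniformSpace.Completion.coe_zero)).trans (inner_zero_right z)
    | tmul ξ η => exact h1 ξ η
    | add s t hs ht =>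
      refine (congrArg (inner ℂ z) (UniformSpace.Completion.coe_add s t)).trans ?_
      exact (inner_add_right (𝕜 := ℂ) z _ _).trans (by rw [hs, ht, add_zero])
  have h3 : ∀ y : (hilbertTensorPower H (n + 1)).carrier, inner ℂ z y = 0 := fun y =>
    UniformSpace.Completion.induction_on
      (α := H ⊗[ℂ] (hilbertTensorPower H n).carrier)
      (p := fun y => inner ℂ z (show (hilbertTensorPower H (n + 1)).carrier from y) = 0) y
      (isClosed_eq (Continuous.inner continuous_const continuous_id) continuous_const) h2
  exact inner_self_eq_zero.1 (h3 z)

/-- The word `i₁ ⋯ iₙ` gives the vector `e_{i₁} ⊗ ⋯ ⊗ e_{iₙ}`. -/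
noncomputable def wordVector (b : HilbertBasis Θ ℂ H) : List Θ → FockSpace H
  | [] => vacuum H
  | i :: w => leftCreation (b i) (wordVector b w)

theorem inner_wordVector [DecidableEq Θ] (b : HilbertBasis Θ ℂ H) (w w' : List Θ) :
    inner ℂ (wordVector b w) (wordVector b w') = if w = w' then 1 else 0 := by
  induction w generalizing w' with
  | nil =>
    cases w' with
    | nil =>
      rw [if_pos rfl, wordVector, inner_self_eq_norm_sq_to_K, norm_vacuum]
      norm_num
    | cons j w' => rw [wordVector, wordVector, inner_vacuum_leftCreation, if_neg (by simp)]
  | cons i w ih =>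
    cases w' with
    | nil =>
      rw [wordVector, wordVector, ← inner_conj_symm, inner_vacuum_leftCreation, map_zero,
        if_neg (by simp)]
    | cons j w' =>
      rw [wordVector, wordVector, inner_leftCreation, ih, orthonormal_iff_ite.1 b.orthonormal]
      by_cases hij : i = j
      · simp [hij]
      · simp [hij]

/-- Induction on the degree: each `lᵢ* x` is again orthogonal to all word vectors, so its degree `n`
component vanishes. This says that the degree `n + 1` component of `x` is orthogonal to every `bᵢ ⊗
η`. -/
theorem apply_eq_zero_of_inner_wordVector [CompleteSpace H] (b : HilbertBasis Θ ℂ H) (n : ℕ) :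
    ∀ x : FockSpace H, (∀ w, inner ℂ (wordVector b w) x = 0) → x n = 0 := by
  induction n with
  | zero => exact fun x hx => apply_zero_of_inner_vacuum (hx [])
  | succ n ih =>
    refine fun x hx => eq_zero_of_inner_tensorLeft b n fun i η => ?_
    have h1 := ih (star (leftCreation (b i)) x) fun w => by
      rw [ContinuousLinearMap.star_eq_adjoint, ContinuousLinearMap.adjoint_inner_right]
      exact hx (i :: w)
    have h2 : inner ℂ (leftCreation (b i) (lp.single 2 n η)) x = 0 := by
      rw [← ContinuousLinearMap.adjoint_inner_right, ← ContinuousLinearMap.star_eq_adjoint,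
        lp.inner_single_left, h1, inner_zero_right]
    rw [leftCreation_single, lp.inner_single_left] at h2
    rw [← inner_conj_symm, h2, map_zero]

theorem exists_wordBasis [CompleteSpace H] (b : HilbertBasis Θ ℂ H) :
    ∃ e : HilbertBasis (List Θ) ℂ (FockSpace H), IsWordShift (fun i => leftCreation (b i)) e := by
  classical
  have ho : Orthonormal ℂ (wordVector b) := orthonormal_iff_ite.2 (inner_wordVector b)
  have hs : (Submodule.span ℂ (Set.range (wordVector b)))ᗮ = ⊥ := by
    refine (Submodule.eq_bot_iff _).2 fun x hx => ?_
    ext n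
    refine apply_eq_zero_of_inner_wordVector b n x fun w => ?_
    exact hx _ (Submodule.subset_span ⟨w, rfl⟩)
  refine ⟨HilbertBasis.mkOfOrthogonalEqBot ho hs, fun i w => ?_⟩
  rw [HilbertBasis.coe_mkOfOrthogonalEqBot]
  rfl

theorem isConvexCompression_POmega (b : HilbertBasis Θ ℂ H) (ω : PositiveWeights Θ) :
    IsConvexCompression ω (fun i => leftCreation (b i)) (POmega b ω) where
  norm_apply i ξ := by rw [norm_leftCreation_apply, b.orthonormal.1, one_mul]
  hasSum x := (summable_POmega b ω x).hasSum

theorem isPeripheralProduct_iff (b : HilbertBasis Θ ℂ H) (ω : PositiveWeights Θ)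
    (m : peripheralBoundary (POmega b ω) →L[ℂ] peripheralBoundary (POmega b ω) →L[ℂ]
      peripheralBoundary (POmega b ω)) :
    IsPeripheralProduct b ω m ↔ IsEigenProduct (POmega b ω) m := by
  unfold IsPeripheralProduct IsEigenProduct
  have h : ∀ (n : ℕ) (x : FockOperators H), (POmega b ω ^ n) x = (POmega b ω)^[n] x :=
    fun n x => by simp
  simp only [h]
  rfl

end Fock

/-! ### The theorem for the full Fock space -/

theorem mainTheorem4 {Θ : Type v} {H : Type u} [Countable Θ] [Nontrivial Θ]
    [NormedAddCommGroup H] [InnerProductSpace ℂ H] [CompleteSpace H]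
    (b : HilbertBasis Θ ℂ H) (ω : PositiveWeights Θ) :
    (∃! m, IsPeripheralProduct b ω m) ∧
    ∀ m, IsPeripheralProduct b ω m →
      (peripheralStarProduct b ω m).IsUnitalCStarAlgebra ∧
      ∃ hF : (peripheralStarProduct b ω m).IsCStarSubalgebra (poissonBoundary (POmega b ω)),
        (∃ E, (peripheralStarProduct b ω m).IsConditionalExpectation
          (poissonBoundary (POmega b ω)) hF E) ∧
        ∀ E, (peripheralStarProduct b ω m).IsConditionalExpectation
            (poissonBoundary (POmega b ω)) hF E →
          IsPreHilbertCStarBimodule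
            ((peripheralStarProduct b ω m).restrict (poissonBoundary (POmega b ω)) hF)
            (fun a x => (peripheralStarProduct b ω m).mul a x)
            (fun x a => (peripheralStarProduct b ω m).mul x a)
            (fun x y => E ((peripheralStarProduct b ω m).mul x
              ((peripheralStarProduct b ω m).adj y))) := by
  have h := isConvexCompression_POmega b ω
  have hτ := h.isSchwarzMap
  obtain ⟨e, he⟩ := exists_wordBasis b
  constructor
  · obtain ⟨l, hne, hl, hlc⟩ := exists_recurrence_filter
    obtain ⟨m, hm, -⟩ := hτ.exists_isEigenProduct hl hlc
    exact ⟨m, (isPeripheralProduct_iff b ω m).2 hm, fun m' hm' =>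
      ((isPeripheralProduct_iff b ω m').1 hm').eq hm⟩
  · intro m hm
    rw [isPeripheralProduct_iff] at hm
    obtain ⟨E, hE, hEn⟩ := hτ.exists_ergodic_mean
    exact ⟨hτ.isUnitalCStarAlgebra hm, hτ.isCStarSubalgebra hm,
      ⟨_, hτ.isConditionalExpectation_ergodicMean hm hE hEn⟩,
      fun _ hE' => h.isPreHilbertCStarBimodule he hm hE'⟩
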